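/- **Setting.** Index the coefficients by $j=-1,0,1,\dots$ and $1\le k\le 2^j\vee 1$. One observes $y_{jk}=\beta_{jk}+\varepsilon z_{jk}$ with $z_{jk}$ i.i.d. $N(0,1)$ and $\varepsilon>0$ known. For an estimator $\hat\beta=\hat\beta(y)$ (measurable in $y$) let $R^{(\varepsilon)}(\hat\beta,\beta)=\sum_{j,k}E^{(\varepsilon)}_\beta(\hat\beta_{jk}-\beta_{jk})^2\in[0,\infty]$; for a class $B$ of sequences let $\mathcal R^{(\varepsilon)}(B)=\inf_{\hat\beta}\sup_{\beta\in B}R^{(\varepsilon)}(\hat\beta,\beta)$, the infimum being over all estimators; and let $R^{(\varepsilon,*)}(\beta)=\inf R^{(\varepsilon)}(\hat\beta,\beta)$ over all separable estimators $\hat\beta_{jk}=h_j(y_{jk})$ with Borel $h_j$. **Besov balls.** For $0<\alpha<\infty$, $1/(\alpha+1/2)<p\le\infty$, $0<q\le\infty$, $0<C<\infty$ let $B^\alpha_{p,q}(C)=\{\beta:\|\beta\|^\alpha_{p,q}\le C\}$, where $$\|\beta\|^\alpha_{p,q}=\Big[|\beta_{-1,1}|^q+\sum_{j\ge0}\Big(2^{j(\alpha+1/2-1/p)}\big(\textstyle\sum_{k=1}^{2^j}|\beta_{jk}|^p\big)^{1/p}\Big)^q\Big]^{1/q},$$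 with suprema replacing the sums when $p=\infty$ or $q=\infty$. **The GEB estimator.** Fix an integer $j_*\ge1$, constants $\rho_0,b_0>0$ and reals $\eta_n\to0$; for $n=2^j$ put $\rho(n)=(1+\eta_n)\rho_0\sqrt{2(\log n)/n}$ and $b(n)=b_0(\log n)/\sqrt n$, and assume $\rho(2^j)>0$ for $j\ge j_*$. Let $K(x)=\sin x/(\pi x)$, $K(0)=1/\pi$. For $j\ge j_*$, with $n=2^j$ and $X_k=y_{jk}/\varepsilon$, put $$\hat\varphi_j(x)=\frac{\sqrt{2\log n}}{n}\sum_{k=1}^{n}K\big(\sqrt{2\log n}\,(x-X_k)\big),\qquad \hat\kappa_j=1-\frac{\sqrt2}{n}\sum_{k=1}^n e^{-X_k^2/2},$$ and let $\hat t_j(x)=x+\hat\varphi_j'(x)/\max\{\rho(n),\hat\varphi_j(x)\}$ if $\hat\kappa_j>b(n)$ and $\hat t_j(x)=\operatorname{sgn}(x)(|x|-\sqrt{2\log n})^+$ if $\hat\kappa_j\le b(n)$. The GEB estimator is $\hat\beta^{(\varepsilon)}_{jk}=y_{jk}$ for $j<j_*$ and $\hat\beta^{(\varepsilon)}_{jk}=\varepsilon\,\hat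 t_j(y_{jk}/\varepsilon)$ for $j\ge j_*$. **Theorem 3.6.** Let $B\subseteq B^\alpha_{p,q}(C)$ for some $(\alpha,p,q,C)$ as above, and suppose $$\liminf_{\varepsilon\to0+}\varepsilon^{-2\alpha/(\alpha+1/2)}\mathcal R^{(\varepsilon)}(B)>0.$$ Let $\tilde R^{(\varepsilon,*)}(\beta)\in[0,\infty]$ be any function ("restricted ideal risk") with $\tilde R^{(\varepsilon,*)}(\beta)\ge R^{(\varepsilon,*)}(\beta)$ for all $\varepsilon>0$, $\beta\in B$ (for instance the minimum risk over separable estimators whose rules $h_j$ are restricted to threshold or to linear functions), and let $\tilde\beta^{(\varepsilon)}$ be any estimators such that, as $\varepsilon\to0+$, $$\sup_{\beta\in B}\{\tilde R^{(\varepsilon,*)}(\beta)-R^{(\varepsilon)}(\tilde\beta^{(\varepsilon)},\beta)\}\le o(1)\,\varepsilon^{2\alpha/(\alpha+1/2)}.$$ Then $$\limsup_{\varepsilon\to0+}\frac{\sup_{\beta\in B}\{R^{(\varepsilon)}(\hat\beta^{(\varepsilon)},\beta)-R^{(\varepsilon)}(\tilde\beta^{(\varepsilon)},\beta)\}}{\mathcal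 R^{(\varepsilon)}(B)}\le0 \quad\text{and}\quad \limsup_{\varepsilon\to0+}\frac{\sup_{\beta\in B}R^{(\varepsilon)}(\hat\beta^{(\varepsilon)},\beta)}{\sup_{\beta\in B}R^{(\varepsilon)}(\tilde\beta^{(\varepsilon)},\beta)}\le1.$$ In the suprema of differences, a difference whose second term is $\infty$ counts as $-\infty$, and a ratio with infinite denominator counts as $0$. -/

import Mathlib

open MeasureTheory ProbabilityTheory Filter Topology
open scoped ENNReal

namespace GEB

noncomputable section

/-! ### The sequence model -/

/-- Number of coefficients in a block. Block `0` is the resolution level `-1` (one coefficient),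
and block `j + 1` is the resolution level `j` (with `2 ^ j` coefficients). -/
def blockSize : ℕ → ℕ
  | 0 => 1
  | j + 1 => 2 ^ j

/-- Index set of the coefficients: a block together with a position in it. -/
abbrev Idx : Type := Σ l : ℕ, Fin (blockSize l)

/-- Sequences indexed by resolution level and position. -/
abbrev Seq : Type := Idx → ℝ

/-- Law of the noise `z`: independent standard normal coordinates. -/
def noise : Measure Seq := Measure.infinitePi fun _ : Idx => gaussianReal 0 1

/-- The observation `y = β + ε z`. -/
def obs (ε : ℝ) (β z : Seq) : Seq := fun i => β i + ε * z i

/-- The total squared error risk, with values in `[0, ∞]`, of an estimator `δ` of `β` at noise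
level `ε`. -/
def risk (ε : ℝ) (δ : Seq → Seq) (β : Seq) : ℝ≥0∞ :=
  ∑' i : Idx, ∫⁻ z, ENNReal.ofReal ((δ (obs ε β z) i - β i) ^ 2) ∂noise

/-- The minimax risk over `B`: infimum over all (measurable) estimators of the maximum risk. -/
def minimaxRisk (ε : ℝ) (B : Set Seq) : ℝ≥0∞ :=
  ⨅ (δ : Seq → Seq) (_ : Measurable δ), ⨆ β ∈ B, risk ε δ β

/-- Separable estimators: in each block, one Borel function is applied to every coordinate. -/
def IsSeparable (δ : Seq → Seq) : Prop :=
  ∃ h : ℕ → ℝ → ℝ, (∀ l, Measurable (h l)) ∧ ∀ (y : Seq) (i : Idx), δ y i = h i.1 (y i)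

/-- The ideal risk at `β`: the minimum risk of separable estimators. -/
def idealRisk (ε : ℝ) (β : Seq) : ℝ≥0∞ :=
  ⨅ (δ : Seq → Seq) (_ : IsSeparable δ), risk ε δ β

/-! ### Besov balls -/

/-- The `ℓ_p` (quasi-)norm of a nonnegative family, `0 < p ≤ ∞`. -/
def lpSum {ι : Type} (p : ℝ≥0∞) (a : ι → ℝ≥0∞) : ℝ≥0∞ :=
  if p = ∞ then ⨆ i, a i else (∑' i, a i ^ p.toReal) ^ (1 / p.toReal)

/-- The weight of a block in the Besov norm: `1` for the level `-1`, and
`2 ^ (j (α + 1/2 - 1/p))` for the level `j ≥ 0` (here `1/p = 0` for `p = ∞`). -/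
def besovWeight (α : ℝ) (p : ℝ≥0∞) : ℕ → ℝ
  | 0 => 1
  | j + 1 => (2 : ℝ) ^ ((j : ℝ) * (α + 1 / 2 - (p⁻¹).toReal))

/-- The Besov (quasi-)norm of a coefficient sequence. -/
def besovNorm (α : ℝ) (p q : ℝ≥0∞) (β : Seq) : ℝ≥0∞ :=
  lpSum q fun l : ℕ => ENNReal.ofReal (besovWeight α p l) *
    lpSum p fun k : Fin (blockSize l) => ENNReal.ofReal |β ⟨l, k⟩|

/-- The Besov ball of radius `C`. -/
def besovBall (α : ℝ) (p q : ℝ≥0∞) (C : ℝ) : Set Seq :=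
  {β | besovNorm α p q β ≤ ENNReal.ofReal C}

/-! ### The general empirical Bayes estimator

Below `x : Fin n → ℝ` is the vector of standardized observations `y / ε` of one block. -/

/-- The kernel `K x = sin x / (π x)`, extended continuously by `K 0 = 1 / π`. -/
def kernel (x : ℝ) : ℝ := Real.sinc x / Real.pi

/-- Kernel estimate, with bandwidth `(2 log n) ^ (-1/2)`, of the mixture density. -/
def densityEst {n : ℕ} (x : Fin n → ℝ) (u : ℝ) : ℝ :=
  (1 / (n : ℝ)) * ∑ k, √(2 * Real.log n) * kernel (√(2 * Real.log n) * (u - x k))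

/-- The statistic that decides between the two regimes. -/
def kappaEst {n : ℕ} (x : Fin n → ℝ) : ℝ :=
  1 - (√2 / n) * ∑ k, Real.exp (-(x k) ^ 2 / 2)

/-- Soft threshold function. -/
def softThreshold (lam u : ℝ) : ℝ := Real.sign u * max (|u| - lam) 0

/-- The regularization level `ρ(n)`. -/
def rhoLevel (ρ₀ : ℝ) (η : ℕ → ℝ) (n : ℕ) : ℝ :=
  (1 + η n) * ρ₀ * √(2 * Real.log n / n)

/-- The switching level `b(n)`. -/
def switchLevel (b₀ : ℝ) (n : ℕ) : ℝ := b₀ * Real.log n / √n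

open Classical in
/-- The estimated rule of a block of size `n`: the regularized empirical Bayes rule if
`kappaEst x > b(n)`, the soft threshold rule at `√(2 log n)` otherwise. -/
def hybridRule (ρ₀ b₀ : ℝ) (η : ℕ → ℝ) {n : ℕ} (x : Fin n → ℝ) (u : ℝ) : ℝ :=
  if switchLevel b₀ n < kappaEst x then
    u + deriv (densityEst x) u / max (rhoLevel ρ₀ η n) (densityEst x u)
  else softThreshold (√(2 * Real.log n)) u

/-- The GEB estimator: the observation itself at levels `j < jstar`, and
`ε * t (y / ε)`, with `t` the estimated rule of the level, at levels `j ≥ jstar`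
(the block `l` is the level `j = l - 1`). -/
def gebEstimator (jstar : ℕ) (ρ₀ b₀ : ℝ) (η : ℕ → ℝ) (ε : ℝ) (y : Seq) : Seq := fun i =>
  if i.1 < jstar + 1 then y i
  else ε * hybridRule ρ₀ b₀ η (fun k : Fin (blockSize i.1) => y ⟨i.1, k⟩ / ε) (y i / ε)

end

end GEB

/-! Within one block, all separable rules compete against the same benchmark. Let θ be the `n`
standardized means of the block, and let g = `mixPDF θ` be the mixture density of its observations.
By Pythagoras at each point x, the best single rule is the Bayes rule x + g'/g for the empirical
distribution of θ, and any other rule t loses exactly ∫ n g (t - t*)². Hence the ideal separable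
risk is at least the sum over blocks of ε² times the Bayes risks (`tsum_ruleRisk_le_idealRisk`). It
remains to show that the GEB rule matches this sum up to o(ε^(2α/(α+1/2))), uniformly over the Besov
ball.

The GEB rule estimates g and g' with a sinc kernel of inverse bandwidth a = √(2 log n). Its Fourier
transform is an indicator, so the bias is a Gaussian tail exp(-a²/2) = 1/n. At its own observation
X_k the kernel contributes a constant. The estimate at X_k is therefore a leave-one-out estimate,
independent of X_k once x is fixed, and the total squared error is about √n up to small powers of
`n` (`Tuning.sum_lintegral_sq_looError_le`). Replacing g by max(ρ, g) costs about as much, plus the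
number of means outside [-T/2, T/2].

An error √n per block is too much for sparse blocks. The mean κ of the switching statistic measures
sparsity, and soft thresholding at a has risk of order a⁻³ + T n κ. This controls sparse blocks and
also bounds the Bayes risk, which sharpens the dense case. By Hoeffding, a wrong switch far from the
threshold has probability at most n⁻¹⁰. The result is the oracle inequality
`LargeBlock.hybridRisk_le`: with T = n^g for a small g, the excess in a large block is at most a
constant times T³ √n (√n κ)^s + #{|θ_k| > T/2} + (2 log n)^(-3/2).

In a Besov ball the r-th power mean of a block is O((λ/n)^(1+d)), with λ = ε^(-1/(α+1/2)) and 1 + d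
= r(α + 1/2) > 1. It bounds κ and, by Markov, the count. For suitable exponents each excess term is
a power of λ below the first times a summable sequence over the levels; the last term is summable
because log n is proportional to the level. The total excess is ε² o(λ), and ε² λ is the minimax
rate. The theorem follows by comparing with the lower bound assumed for the minimax risk. -/

namespace GEB

noncomputable section

/-! ### Gaussian mixtures and the Bayes rule of a block -/

/-- The standard normal law. -/
abbrev stdGauss : Measure ℝ := gaussianReal 0 1

/-- The standard normal density. -/
def npdf (x : ℝ) : ℝ := (√(2 * Real.pi))⁻¹ * Real.exp (-x ^ 2 / 2)

lemma npdf_eq (x : ℝ) : npdf x = gaussianPDFReal 0 1 x := by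
  simp [npdf, gaussianPDFReal]

lemma npdf_pos (x : ℝ) : 0 < npdf x := by unfold npdf; positivity

lemma npdf_nonneg (x : ℝ) : 0 ≤ npdf x := (npdf_pos x).le

@[fun_prop]
lemma continuous_npdf : Continuous npdf := by unfold npdf; fun_prop

@[fun_prop]
lemma measurable_npdf : Measurable npdf := continuous_npdf.measurable

lemma two_le_sqrt_two_pi : 2 ≤ √(2 * Real.pi) := by
  apply Real.le_sqrt_of_sq_le
  nlinarith [Real.pi_gt_three]

lemma inv_sqrt_two_pi_le : (√(2 * Real.pi))⁻¹ ≤ 1 / 2 := by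
  rw [inv_eq_one_div]
  exact one_div_le_one_div_of_le (by norm_num) two_le_sqrt_two_pi

lemma npdf_le_exp (x : ℝ) : npdf x ≤ 1 / 2 * Real.exp (-x ^ 2 / 2) := by
  unfold npdf
  gcongr
  exact inv_sqrt_two_pi_le

lemma npdf_le_half (x : ℝ) : npdf x ≤ 1 / 2 := by
  refine (npdf_le_exp x).trans ?_
  have : Real.exp (-x ^ 2 / 2) ≤ 1 := Real.exp_le_one_iff.2 (by nlinarith [sq_nonneg x])
  linarith

lemma lintegral_npdf : ∫⁻ x, ENNReal.ofReal (npdf x) = 1 := by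
  simp_rw [npdf_eq]
  exact lintegral_gaussianPDFReal_eq_one 0 one_ne_zero

lemma lintegral_stdGauss (f : ℝ → ℝ≥0∞) :
    ∫⁻ z, f z ∂stdGauss = ∫⁻ x, ENNReal.ofReal (npdf x) * f x := by
  rw [stdGauss, gaussianReal_of_var_ne_zero _ one_ne_zero,
    lintegral_withDensity_eq_lintegral_mul_non_measurable _ (measurable_gaussianPDF 0 1)
      (ae_of_all _ fun _ => gaussianPDF_lt_top)]
  simp [gaussianPDF, npdf_eq]

lemma lintegral_stdGauss_shift (f : ℝ → ℝ≥0∞) (c : ℝ) :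
    ∫⁻ z, f (c + z) ∂stdGauss = ∫⁻ x, ENNReal.ofReal (npdf (x - c)) * f x := by
  rw [lintegral_stdGauss,
    ← lintegral_add_left_eq_self (fun x => ENNReal.ofReal (npdf (x - c)) * f x) c]
  simp

lemma integral_stdGauss (f : ℝ → ℝ) :
    ∫ z, f z ∂stdGauss = ∫ x, npdf x * f x := by
  rw [stdGauss, integral_gaussianReal_eq_integral_smul one_ne_zero]
  simp [npdf_eq]

/-- The total risk of a separable rule in a block. -/
def ruleRisk {n : ℕ} (θ : Fin n → ℝ) (h : ℝ → ℝ) : ℝ≥0∞ :=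
  ∑ k, ∫⁻ z, ENNReal.ofReal ((h (θ k + z) - θ k) ^ 2) ∂stdGauss

/-- The mixture density. -/
def mixPDF {n : ℕ} (θ : Fin n → ℝ) (x : ℝ) : ℝ := (1 / (n : ℝ)) * ∑ k, npdf (x - θ k)

/-- The derivative of the mixture density. -/
def mixDeriv {n : ℕ} (θ : Fin n → ℝ) (x : ℝ) : ℝ :=
  (1 / (n : ℝ)) * ∑ k, -((x - θ k) * npdf (x - θ k))

/-- The mixture of the functions `u ^ 2 * npdf u`. -/
def mixSq {n : ℕ} (θ : Fin n → ℝ) (x : ℝ) : ℝ :=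
  (1 / (n : ℝ)) * ∑ k, (x - θ k) ^ 2 * npdf (x - θ k)

/-- The Bayes rule for the empirical distribution of the parameters. -/
def bayesRule {n : ℕ} (θ : Fin n → ℝ) (x : ℝ) : ℝ := x + mixDeriv θ x / mixPDF θ x

/-- The regularized Bayes rule. -/
def regRule {n : ℕ} (ρ : ℝ) (θ : Fin n → ℝ) (x : ℝ) : ℝ :=
  x + mixDeriv θ x / max ρ (mixPDF θ x)

section
variable {n : ℕ} (θ : Fin n → ℝ)

@[fun_prop]
lemma continuous_mixPDF : Continuous (mixPDF θ) := by unfold mixPDF; fun_prop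
@[fun_prop]
lemma continuous_mixDeriv : Continuous (mixDeriv θ) := by unfold mixDeriv; fun_prop
@[fun_prop]
lemma measurable_mixPDF : Measurable (mixPDF θ) := (continuous_mixPDF θ).measurable
@[fun_prop]
lemma measurable_mixDeriv : Measurable (mixDeriv θ) := (continuous_mixDeriv θ).measurable
@[fun_prop]
lemma measurable_bayesRule : Measurable (bayesRule θ) := by unfold bayesRule; fun_prop
@[fun_prop]
lemma measurable_regRule (ρ : ℝ) : Measurable (regRule ρ θ) := by unfold regRule; fun_prop

lemma mixPDF_pos [NeZero n] (x : ℝ) : 0 < mixPDF θ x := by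
  unfold mixPDF
  have : 0 < (n : ℝ) := by exact_mod_cast NeZero.pos n
  have h2 : 0 < ∑ k, npdf (x - θ k) :=
    Finset.sum_pos (fun k _ => npdf_pos _) ⟨⟨0, NeZero.pos n⟩, Finset.mem_univ _⟩
  positivity

lemma sum_npdf_eq [NeZero n] (x : ℝ) : ∑ k, npdf (x - θ k) = n * mixPDF θ x := by
  unfold mixPDF
  have : (n : ℝ) ≠ 0 := by exact_mod_cast NeZero.ne n
  field_simp

lemma sum_mul_npdf_eq [NeZero n] (x : ℝ) :
    ∑ k, (x - θ k) * npdf (x - θ k) = -(n * mixDeriv θ x) := by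
  unfold mixDeriv
  have : (n : ℝ) ≠ 0 := by exact_mod_cast NeZero.ne n
  rw [Finset.sum_neg_distrib]
  field_simp

lemma lintegral_mixPDF [NeZero n] : ∫⁻ x, ENNReal.ofReal (n * mixPDF θ x) = n := by
  simp_rw [← sum_npdf_eq, ENNReal.ofReal_sum_of_nonneg (fun k _ => npdf_nonneg _)]
  rw [lintegral_finsetSum _ (fun k _ => by fun_prop)]
  have : ∀ k, ∫⁻ x, ENNReal.ofReal (npdf (x - θ k)) = 1 := fun k => by
    rw [lintegral_sub_right_eq_self (fun x => ENNReal.ofReal (npdf x)) (θ k), lintegral_npdf]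
  simp [this]

lemma ruleRisk_eq {h : ℝ → ℝ} (hh : Measurable h) :
    ruleRisk θ h = ∫⁻ x, ENNReal.ofReal (∑ k, npdf (x - θ k) * (h x - θ k) ^ 2) := by
  unfold ruleRisk
  have : ∀ k, ∫⁻ z, ENNReal.ofReal ((h (θ k + z) - θ k) ^ 2) ∂stdGauss =
      ∫⁻ x, ENNReal.ofReal (npdf (x - θ k) * (h x - θ k) ^ 2) := fun k => by
    rw [lintegral_stdGauss_shift (fun x => ENNReal.ofReal ((h x - θ k) ^ 2)) (θ k)]
    simp_rw [ENNReal.ofReal_mul (npdf_nonneg _)]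
  simp_rw [this]
  rw [← lintegral_finsetSum _ (fun k _ => by fun_prop)]
  congr with x
  rw [ENNReal.ofReal_sum_of_nonneg]
  intro k _
  have := npdf_nonneg (x - θ k)
  positivity

/-- `bayesRule θ x` is the mean of the θ_k with weights φ(x - θ_k) (Tweedie's formula), so the cross
term vanishes when the weighted quadratic is expanded around it. -/
lemma sum_sq_eq [NeZero n] (x t : ℝ) :
    ∑ k, npdf (x - θ k) * (t - θ k) ^ 2 =
      ∑ k, npdf (x - θ k) * (bayesRule θ x - θ k) ^ 2
        + n * mixPDF θ x * (t - bayesRule θ x) ^ 2 := by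
  have hg := (mixPDF_pos θ x).ne'
  have h1 := sum_npdf_eq θ x
  have h2 := sum_mul_npdf_eq θ x
  have key : ∀ t, ∑ k, npdf (x - θ k) * (t - θ k) ^ 2 =
      (∑ k, npdf (x - θ k)) * (t - x) ^ 2
        + 2 * (t - x) * ∑ k, (x - θ k) * npdf (x - θ k)
        + ∑ k, npdf (x - θ k) * (x - θ k) ^ 2 := fun t => by
    rw [Finset.sum_mul, Finset.mul_sum, ← Finset.sum_add_distrib, ← Finset.sum_add_distrib]
    refine Finset.sum_congr rfl fun k _ => by ring
  rw [key t, key (bayesRule θ x), h1, h2]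
  unfold bayesRule
  field_simp
  ring

theorem ruleRisk_bayesRule_le [NeZero n] {h : ℝ → ℝ} (hh : Measurable h) :
    ruleRisk θ (bayesRule θ) ≤ ruleRisk θ h := by
  rw [ruleRisk_eq θ hh, ruleRisk_eq θ (by fun_prop)]
  refine lintegral_mono fun x => ENNReal.ofReal_le_ofReal ?_
  rw [sum_sq_eq θ x (h x)]
  have := mixPDF_pos θ x
  have : 0 ≤ n * mixPDF θ x * (h x - bayesRule θ x) ^ 2 := by positivity
  linarith

theorem ruleRisk_eq_add [NeZero n] {h : ℝ → ℝ} (hh : Measurable h) :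
    ruleRisk θ h = ruleRisk θ (bayesRule θ)
      + ∫⁻ x, ENNReal.ofReal (n * mixPDF θ x * (h x - bayesRule θ x) ^ 2) := by
  rw [ruleRisk_eq θ hh, ruleRisk_eq θ (by fun_prop), ← lintegral_add_right _ (by fun_prop)]
  congr with x
  rw [sum_sq_eq θ x (h x), ENNReal.ofReal_add]
  · exact Finset.sum_nonneg fun k _ => mul_nonneg (npdf_nonneg _) (sq_nonneg _)
  · have := mixPDF_pos θ x
    positivity

/-! ### Pointwise bounds for the mixture -/

/-- Beyond A, half of the Gaussian exponent absorbs the polynomial factor and the other half leaves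
exp(-A²/4). Averaged over θ, this controls g' by g up to a remainder that is negligible for A = 2a.
-/
lemma abs_mul_npdf_le (u A : ℝ) (hA : 0 ≤ A) :
    |u| * npdf u ≤ A * npdf u + Real.exp (-A ^ 2 / 4) := by
  rcases le_or_gt |u| A with h | h
  · have := npdf_nonneg u
    have := Real.exp_pos (-A ^ 2 / 4)
    nlinarith
  · have h1 : |u| * npdf u ≤ Real.exp (-A ^ 2 / 4) := by
      have e1 : |u| ≤ 2 * Real.exp (u ^ 2 / 4) := by
        have := Real.add_one_le_exp (u ^ 2 / 4)
        nlinarith [sq_abs u, sq_nonneg (|u| - 2)]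
      have e2 : Real.exp (-u ^ 2 / 4) ≤ Real.exp (-A ^ 2 / 4) := by
        apply Real.exp_le_exp.2
        have : A ^ 2 ≤ u ^ 2 := by rw [← sq_abs u]; gcongr
        linarith
      calc |u| * npdf u ≤ (2 * Real.exp (u ^ 2 / 4)) * (1 / 2 * Real.exp (-u ^ 2 / 2)) := by
            have := npdf_le_exp u
            have := npdf_nonneg u
            gcongr
        _ = Real.exp (u ^ 2 / 4) * Real.exp (-u ^ 2 / 2) := by ring
        _ = Real.exp (-u ^ 2 / 4) := by rw [← Real.exp_add]; congr 1; ring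
        _ ≤ _ := e2
    have := mul_nonneg hA (npdf_nonneg u)
    linarith

lemma sq_mul_npdf_le (u A : ℝ) (hA : 0 ≤ A) :
    u ^ 2 * npdf u ≤ A ^ 2 * npdf u + 2 * Real.exp (-A ^ 2 / 4) := by
  rcases le_or_gt |u| A with h | h
  · have := npdf_nonneg u
    have := Real.exp_pos (-A ^ 2 / 4)
    have : u ^ 2 ≤ A ^ 2 := by rw [← sq_abs u]; gcongr
    nlinarith
  · have h1 : u ^ 2 * npdf u ≤ 2 * Real.exp (-A ^ 2 / 4) := by
      have e1 : u ^ 2 ≤ 4 * Real.exp (u ^ 2 / 4) := by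
        have := Real.add_one_le_exp (u ^ 2 / 4)
        nlinarith
      have e2 : Real.exp (-u ^ 2 / 4) ≤ Real.exp (-A ^ 2 / 4) := by
        apply Real.exp_le_exp.2
        have : A ^ 2 ≤ u ^ 2 := by rw [← sq_abs u]; gcongr
        linarith
      calc u ^ 2 * npdf u ≤ (4 * Real.exp (u ^ 2 / 4)) * (1 / 2 * Real.exp (-u ^ 2 / 2)) := by
            have := npdf_le_exp u
            have := npdf_nonneg u
            gcongr
        _ = 2 * (Real.exp (u ^ 2 / 4) * Real.exp (-u ^ 2 / 2)) := by ring
        _ = 2 * Real.exp (-u ^ 2 / 4) := by rw [← Real.exp_add]; congr 2; ring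
        _ ≤ _ := by linarith
    have := mul_nonneg (sq_nonneg A) (npdf_nonneg u)
    linarith

lemma average_le_of_forall_le [NeZero n] {a b : Fin n → ℝ} {c d : ℝ} 
    (h : ∀ k, a k ≤ c * b k + d) :
    (1 / (n : ℝ)) * ∑ k, a k ≤ c * ((1 / (n : ℝ)) * ∑ k, b k) + d := by
  have hn : 0 < (n : ℝ) := by exact_mod_cast NeZero.pos n
  calc (1 / (n : ℝ)) * ∑ k, a k ≤ (1 / (n : ℝ)) * ∑ k, (c * b k + d) := by
        gcongr with k; exact h k
    _ = _ := by
        rw [Finset.sum_add_distrib, ← Finset.mul_sum]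
        simp only [Finset.sum_const, Finset.card_univ, Fintype.card_fin, nsmul_eq_mul]
        field_simp

lemma abs_mixDeriv_le [NeZero n] (x A : ℝ) (hA : 0 ≤ A) :
    |mixDeriv θ x| ≤ A * mixPDF θ x + Real.exp (-A ^ 2 / 4) := by
  have hn : 0 < (n : ℝ) := by exact_mod_cast NeZero.pos n
  unfold mixDeriv mixPDF
  rw [abs_mul, abs_of_pos (by positivity : 0 < 1 / (n : ℝ))]
  refine le_trans ?_ (average_le_of_forall_le
    (a := fun k => |x - θ k| * npdf (x - θ k)) fun k => abs_mul_npdf_le (x - θ k) A hA)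
  gcongr
  refine (Finset.abs_sum_le_sum_abs _ _).trans (Finset.sum_le_sum fun k _ => ?_)
  rw [abs_neg, abs_mul, abs_of_pos (npdf_pos _)]

lemma mixSq_le [NeZero n] (x A : ℝ) (hA : 0 ≤ A) :
    mixSq θ x ≤ A ^ 2 * mixPDF θ x + 2 * Real.exp (-A ^ 2 / 4) :=
  average_le_of_forall_le fun k => sq_mul_npdf_le (x - θ k) A hA

lemma mixSq_nonneg (x : ℝ) : 0 ≤ mixSq θ x := by
  unfold mixSq
  have : 0 ≤ ∑ k, (x - θ k) ^ 2 * npdf (x - θ k) :=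
    Finset.sum_nonneg fun k _ => mul_nonneg (sq_nonneg _) (npdf_nonneg _)
  positivity

/-- Cauchy-Schwarz with weights φ(x - θ_k). It keeps g'²/g bounded even where g is tiny. -/
lemma sq_mixDeriv_le (x : ℝ) : mixDeriv θ x ^ 2 ≤ mixPDF θ x * mixSq θ x := by
  have h := Finset.sum_mul_sq_le_sq_mul_sq Finset.univ (fun k => √(npdf (x - θ k)))
    (fun k => -((x - θ k) * √(npdf (x - θ k))))
  have e1 : ∀ k, √(npdf (x - θ k)) * -((x - θ k) * √(npdf (x - θ k))) =
      -((x - θ k) * npdf (x - θ k)) := fun k => by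
    have := Real.mul_self_sqrt (npdf_nonneg (x - θ k))
    linear_combination (-(x - θ k)) * this
  have e2 : ∀ k, (-((x - θ k) * √(npdf (x - θ k)))) ^ 2 = (x - θ k) ^ 2 * npdf (x - θ k) :=
    fun k => by
      rw [neg_sq, mul_pow, Real.sq_sqrt (npdf_nonneg _)]
  simp only [e1, e2, Real.sq_sqrt (npdf_nonneg _)] at h
  unfold mixDeriv mixPDF mixSq
  calc _ = (1 / (n : ℝ)) ^ 2 * (∑ k, -((x - θ k) * npdf (x - θ k))) ^ 2 := by ring
    _ ≤ (1 / (n : ℝ)) ^ 2 * ((∑ k, npdf (x - θ k)) * ∑ k, (x - θ k) ^ 2 * npdf (x - θ k)) := by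
        gcongr
    _ = _ := by ring

/-- Excess loss of the regularized Bayes rule. -/
lemma mixPDF_mul_sq_regRule_sub_le [NeZero n] {ρ : ℝ} (hρ : 0 < ρ) (x : ℝ) :
    mixPDF θ x * (regRule ρ θ x - bayesRule θ x) ^ 2 ≤ mixSq θ x := by
  have hg := mixPDF_pos θ x
  have hv := mixSq_nonneg θ x
  unfold regRule bayesRule
  have hm : mixPDF θ x ≤ max ρ (mixPDF θ x) := le_max_right _ _
  set g := mixPDF θ x
  set M := max ρ g
  have hM : 0 < M := hg.trans_le hm
  -- The two rules differ by the factor 1 - g/M applied to g'/g, and this factor lies in [0, 1].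
  have e : g * (x + mixDeriv θ x / M - (x + mixDeriv θ x / g)) ^ 2 =
      (mixDeriv θ x ^ 2 / g) * (1 - g / M) ^ 2 := by
    field_simp
    ring
  rw [e]
  have h1 : mixDeriv θ x ^ 2 / g ≤ mixSq θ x := by
    rw [div_le_iff₀ hg, mul_comm]; exact sq_mixDeriv_le θ x
  have h2 : (1 - g / M) ^ 2 ≤ 1 := by
    have : g / M ≤ 1 := (div_le_one hM).2 hm
    have : 0 < g / M := by positivity
    nlinarith
  calc _ ≤ mixSq θ x * 1 := by gcongr
    _ = _ := mul_one _

/-- Regularization changes the rule only where g ≤ ρ, and there the second-moment mixture is itself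
small. -/
lemma mixPDF_mul_sq_regRule_sub_le' [NeZero n] {ρ A : ℝ} (hρ : 0 < ρ) (hA : 0 ≤ A) (x : ℝ) :
    mixPDF θ x * (regRule ρ θ x - bayesRule θ x) ^ 2 ≤ A ^ 2 * ρ + 2 * Real.exp (-A ^ 2 / 4) := by
  rcases le_or_gt (mixPDF θ x) ρ with h | h
  · refine (mixPDF_mul_sq_regRule_sub_le θ hρ x).trans ((mixSq_le θ x A hA).trans ?_)
    gcongr
  · have : regRule ρ θ x - bayesRule θ x = 0 := by
      unfold regRule bayesRule
      rw [max_eq_right h.le, sub_self]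
    rw [this]
    have := Real.exp_pos (-A ^ 2 / 4)
    have : 0 ≤ A ^ 2 * ρ := by positivity
    simp only [ne_eq, OfNat.ofNat_ne_zero, not_false_eq_true, zero_pow, mul_zero]
    linarith

end

/-! ### Tails of the excess risk of the regularized Bayes rule -/

lemma lintegral_exp_neg_sq_div_eight :
    ∫⁻ x : ℝ, ENNReal.ofReal (Real.exp (-x ^ 2 / 8)) ≤ ENNReal.ofReal 6 := by
  have h : ∀ x : ℝ, -x ^ 2 / 8 = -(1 / 8) * x ^ 2 := fun x => by ring
  simp_rw [h]
  rw [← ofReal_integral_eq_lintegral_ofReal (integrable_exp_neg_mul_sq (by norm_num))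
    (ae_of_all _ fun x => (Real.exp_pos _).le), integral_gaussian]
  apply ENNReal.ofReal_le_ofReal
  rw [Real.sqrt_le_left (by norm_num)]
  have := Real.pi_lt_four
  linarith

/-- The number of parameters outside `[-y, y]`. -/
def farCount {n : ℕ} (θ : Fin n → ℝ) (y : ℝ) : ℕ := (Finset.univ.filter fun k => y < |θ k|).card

lemma sq_mul_npdf_le_exp (u : ℝ) : u ^ 2 * npdf u ≤ 2 * Real.exp (-u ^ 2 / 4) := by
  have e1 : u ^ 2 ≤ 4 * Real.exp (u ^ 2 / 4) := by
    have := Real.add_one_le_exp (u ^ 2 / 4)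
    nlinarith
  calc u ^ 2 * npdf u ≤ (4 * Real.exp (u ^ 2 / 4)) * (1 / 2 * Real.exp (-u ^ 2 / 2)) := by
        have := npdf_le_exp u
        have := npdf_nonneg u
        gcongr
    _ = 2 * (Real.exp (u ^ 2 / 4) * Real.exp (-u ^ 2 / 2)) := by ring
    _ = 2 * Real.exp (-u ^ 2 / 4) := by rw [← Real.exp_add]; congr 2; ring

/-- If |c| > x₀/2 the full integral is charged, as one far mean. Otherwise |x - c| ≥ x₀/2 on the
domain, and part of the exponential gives exp(-(x₀/2)²/8). -/
lemma setLIntegral_sq_mul_npdf_le (c x₀ : ℝ) (hx₀ : 0 < x₀) :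
    ∫⁻ x in {x | x₀ < |x|}, ENNReal.ofReal ((x - c) ^ 2 * npdf (x - c)) ≤
      ENNReal.ofReal (12 * ((if x₀ / 2 < |c| then 1 else 0) + Real.exp (-x₀ ^ 2 / 32))) := by
  have hE := Real.exp_pos (-x₀ ^ 2 / 32)
  have main : ∀ D : ℝ, 0 ≤ D → (∀ x, x₀ < |x| →
      (x - c) ^ 2 * npdf (x - c) ≤ D * Real.exp (-(x - c) ^ 2 / 8)) →
      ∫⁻ x in {x | x₀ < |x|}, ENNReal.ofReal ((x - c) ^ 2 * npdf (x - c)) ≤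
        ENNReal.ofReal (6 * D) := by
    intro D hD h
    calc _ ≤ ∫⁻ x in {x | x₀ < |x|}, ENNReal.ofReal (D * Real.exp (-(x - c) ^ 2 / 8)) :=
          setLIntegral_mono (by fun_prop) fun x hx => ENNReal.ofReal_le_ofReal (h x hx)
      _ ≤ ∫⁻ x, ENNReal.ofReal (D * Real.exp (-(x - c) ^ 2 / 8)) := setLIntegral_le_lintegral _ _
      _ = ENNReal.ofReal D * ∫⁻ x, ENNReal.ofReal (Real.exp (-(x - c) ^ 2 / 8)) := by
          simp_rw [ENNReal.ofReal_mul hD]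
          rw [lintegral_const_mul _ (by fun_prop)]
      _ ≤ ENNReal.ofReal D * ENNReal.ofReal 6 := by
          gcongr
          rw [lintegral_sub_right_eq_self (fun x => ENNReal.ofReal (Real.exp (-x ^ 2 / 8))) c]
          exact lintegral_exp_neg_sq_div_eight
      _ = _ := by rw [← ENNReal.ofReal_mul hD, mul_comm]
  have hexp : ∀ u : ℝ, Real.exp (-u ^ 2 / 4) = Real.exp (-u ^ 2 / 8) * Real.exp (-u ^ 2 / 8) :=
    fun u => by rw [← Real.exp_add]; congr 1; ring
  split_ifs with hc
  · refine (main 2 (by norm_num) fun x _ => ?_).trans (ENNReal.ofReal_le_ofReal (by linarith))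
    refine (sq_mul_npdf_le_exp (x - c)).trans ?_
    gcongr 2 * ?_
    exact Real.exp_le_exp.2 (by nlinarith [sq_nonneg (x - c)])
  · refine (main (2 * Real.exp (-x₀ ^ 2 / 32)) (by positivity) fun x hx => ?_).trans
      (ENNReal.ofReal_le_ofReal (by linarith))
    refine (sq_mul_npdf_le_exp (x - c)).trans ?_
    rw [hexp, mul_assoc]
    gcongr 2 * (?_ * _)
    apply Real.exp_le_exp.2
    have h1 : x₀ / 2 ≤ |x - c| := by
      have := abs_sub_abs_le_abs_sub x c
      push Not at hc
      linarith
    have h2 : (x₀ / 2) ^ 2 ≤ (x - c) ^ 2 := by rw [← sq_abs (x - c)]; gcongr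
    linarith

/-- On [-x₀, x₀] the pointwise bound is multiplied by the length 2x₀. Outside, where it is not
integrable, each coordinate is bounded by its own Gaussian tail, which counts the means beyond x₀/2.
-/
lemma lintegral_regRule_excess_le {n : ℕ} [NeZero n] (θ : Fin n → ℝ) {ρ A x₀ : ℝ} (hρ : 0 < ρ)
    (hA : 0 ≤ A) (hx₀ : 0 < x₀) :
    ∫⁻ x, ENNReal.ofReal (n * mixPDF θ x * (regRule ρ θ x - bayesRule θ x) ^ 2) ≤
      ENNReal.ofReal (n * (2 * x₀ * (A ^ 2 * ρ + 2 * Real.exp (-A ^ 2 / 4)))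
        + 12 * (farCount θ (x₀ / 2) + n * Real.exp (-x₀ ^ 2 / 32))) := by
  have hn : 0 < (n : ℝ) := by exact_mod_cast NeZero.pos n
  have hE := Real.exp_pos (-x₀ ^ 2 / 32)
  have hE2 := Real.exp_pos (-A ^ 2 / 4)
  have hmeas : MeasurableSet {x : ℝ | x₀ < |x|} := measurableSet_lt (by fun_prop) (by fun_prop)
  rw [← lintegral_add_compl _ hmeas, ENNReal.ofReal_add (by positivity) (by positivity), add_comm]
  gcongr
  · have hc : {x : ℝ | x₀ < |x|}ᶜ = Set.Icc (-x₀) x₀ := by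
      ext x; simp [abs_le]
    rw [hc]
    calc _ ≤ ∫⁻ x in Set.Icc (-x₀) x₀,
          ENNReal.ofReal (n * (A ^ 2 * ρ + 2 * Real.exp (-A ^ 2 / 4))) := by
          refine setLIntegral_mono (by fun_prop) fun x _ => ENNReal.ofReal_le_ofReal ?_
          rw [mul_assoc]
          gcongr
          exact mixPDF_mul_sq_regRule_sub_le' θ hρ hA x
      _ = _ := by
          rw [setLIntegral_const, Real.volume_Icc, ← ENNReal.ofReal_mul (by positivity)]
          congr 1; ring
  · calc _ ≤ ∫⁻ x in {x | x₀ < |x|}, ∑ k, ENNReal.ofReal ((x - θ k) ^ 2 * npdf (x - θ k)) := by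
          refine setLIntegral_mono (by fun_prop) fun x _ => ?_
          rw [← ENNReal.ofReal_sum_of_nonneg
            fun k _ => mul_nonneg (sq_nonneg _) (npdf_nonneg _)]
          apply ENNReal.ofReal_le_ofReal
          rw [mul_assoc]
          have h := mixPDF_mul_sq_regRule_sub_le θ hρ x
          have : (n : ℝ) * mixSq θ x = ∑ k, (x - θ k) ^ 2 * npdf (x - θ k) := by
            unfold mixSq; field_simp
          rw [← this]
          gcongr
      _ = ∑ k, ∫⁻ x in {x | x₀ < |x|}, ENNReal.ofReal ((x - θ k) ^ 2 * npdf (x - θ k)) :=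
          lintegral_finsetSum _ fun k _ => by fun_prop
      _ ≤ ∑ k, ENNReal.ofReal
            (12 * ((if x₀ / 2 < |θ k| then 1 else 0) + Real.exp (-x₀ ^ 2 / 32))) :=
          Finset.sum_le_sum fun k _ => setLIntegral_sq_mul_npdf_le (θ k) x₀ hx₀
      _ = _ := by
          rw [← ENNReal.ofReal_sum_of_nonneg fun k _ => by positivity, ← Finset.mul_sum,
            Finset.sum_add_distrib, Finset.sum_boole]
          simp [farCount]

/-! ### Soft thresholding -/

/-- Subtracting the projection of u onto [-lam, lam] is the useful form: the projection is
1-Lipschitz, which helps for small means, and bounded by lam, which helps for large ones. -/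
lemma softThreshold_eq {lam : ℝ} (h : 0 ≤ lam) (u : ℝ) :
    softThreshold lam u = u - max (-lam) (min lam u) := by
  unfold softThreshold
  rcases lt_trichotomy u 0 with hu | rfl | hu
  · rw [Real.sign_of_neg hu, abs_of_neg hu, min_eq_right (by linarith)]
    rcases le_total (-u) lam with h1 | h1
    · rw [max_eq_right (by linarith), max_eq_right (by linarith)]; ring
    · rw [max_eq_left (by linarith), max_eq_left (by linarith)]; ring
  · simp [h]
  · rw [Real.sign_of_pos hu, abs_of_pos hu]
    rcases le_total u lam with h1 | h1
    · rw [min_eq_right h1, max_eq_right (by linarith), max_eq_right (by linarith)]; ring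
    · rw [min_eq_left h1, max_eq_left (by linarith), max_eq_right (by linarith)]; ring

@[fun_prop]
lemma measurable_softThreshold (lam : ℝ) : Measurable (softThreshold lam) := by
  unfold softThreshold
  have : Measurable Real.sign := by
    unfold Real.sign
    exact Measurable.ite measurableSet_Iio (by fun_prop)
      (Measurable.ite measurableSet_Ioi (by fun_prop) (by fun_prop))
  fun_prop

lemma abs_clamp_sub_le (lam u v : ℝ) :
    |max (-lam) (min lam u) - max (-lam) (min lam v)| ≤ |u - v| :=
  calc _ ≤ |min lam u - min lam v| := by
        rw [max_comm (-lam), max_comm (-lam)]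
        exact abs_max_sub_max_le_abs _ _ _
    _ ≤ _ := by
        have := abs_min_sub_min_le_max lam u lam v
        simpa using this

lemma sq_softThreshold_sub_le {lam : ℝ} (h : 0 ≤ lam) (c z : ℝ) :
    (softThreshold lam (c + z) - c) ^ 2 ≤ 2 * softThreshold lam z ^ 2 + 2 * c ^ 2 := by
  have h1 := abs_clamp_sub_le lam (c + z) z
  rw [add_sub_cancel_right] at h1
  rw [softThreshold_eq h, softThreshold_eq h]
  set p := max (-lam) (min lam (c + z))
  set q := max (-lam) (min lam z)
  have h2 : (p - q) ^ 2 ≤ c ^ 2 := sq_le_sq.2 h1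
  nlinarith [sq_nonneg ((z - q) + (p - q))]

lemma sq_softThreshold_sub_le' {lam : ℝ} (h : 0 ≤ lam) (c z : ℝ) :
    (softThreshold lam (c + z) - c) ^ 2 ≤ 2 * z ^ 2 + 2 * lam ^ 2 := by
  rw [softThreshold_eq h]
  have h1 : -lam ≤ max (-lam) (min lam (c + z)) := le_max_left _ _
  have h2 : max (-lam) (min lam (c + z)) ≤ lam := max_le (by linarith) (min_le_left _ _)
  set p := max (-lam) (min lam (c + z))
  have h3 : p ^ 2 ≤ lam ^ 2 := sq_le_sq' h1 h2
  nlinarith [sq_nonneg (z + p)]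

lemma lintegral_exp_tail {b : ℝ} (hb : 0 < b) (lam : ℝ) :
    ∫⁻ x in {x : ℝ | lam < |x|}, ENNReal.ofReal (Real.exp (-(b * (|x| - lam)))) ≤
      ENNReal.ofReal (2 / b) := by
  have key : ∫⁻ x in Set.Ioi lam, ENNReal.ofReal (Real.exp (-(b * (x - lam)))) =
      ENNReal.ofReal (1 / b) := by
    have e : ∀ x, Real.exp (-(b * (x - lam))) = Real.exp (b * lam) * Real.exp (-b * x) :=
      fun x => by rw [← Real.exp_add]; congr 1; ring
    simp_rw [e]
    rw [← ofReal_integral_eq_lintegral_ofReal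
      ((integrableOn_exp_mul_Ioi (by linarith) lam).const_mul _)
      (ae_of_all _ fun x => by positivity), integral_const_mul,
      integral_exp_mul_Ioi (by linarith) lam]
    congr 1
    rw [neg_div_neg_eq, ← mul_div_assoc, ← Real.exp_add]
    congr 1
    simp
  have hsub : {x : ℝ | lam < |x|} ⊆ Set.Ioi lam ∪ Set.Iio (-lam) := by
    intro x hx
    rcases lt_abs.1 (show lam < |x| from hx) with h | h
    · exact Or.inl h
    · exact Or.inr (by simp; linarith)
  have hmono : ∀ s : ℝ, s = 1 ∨ s = -1 → ∀ x, Real.exp (-(b * (|x| - lam))) ≤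
      Real.exp (-(b * (s * x - lam))) := by
    intro s hs x
    apply Real.exp_le_exp.2
    have : s * x ≤ |x| := by
      rcases hs with rfl | rfl
      · simpa using le_abs_self x
      · simpa using neg_abs_le x |> fun h => by linarith
    nlinarith
  have key2 : ∫⁻ x in Set.Iio (-lam), ENNReal.ofReal (Real.exp (-(b * (-1 * x - lam)))) =
      ENNReal.ofReal (1 / b) := by
    rw [← key]
    have := (Measure.measurePreserving_neg (volume : Measure ℝ)).setLIntegral_comp_preimage
      (s := Set.Ioi lam) measurableSet_Ioi
      (f := fun x => ENNReal.ofReal (Real.exp (-(b * (x - lam))))) (by fun_prop)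
    rw [← this]
    have e : (Neg.neg ⁻¹' Set.Ioi lam : Set ℝ) = Set.Iio (-lam) := by
      ext x; simp
    rw [e]
    simp
  calc _ ≤ ∫⁻ x in Set.Ioi lam ∪ Set.Iio (-lam),
        ENNReal.ofReal (Real.exp (-(b * (|x| - lam)))) := lintegral_mono_set hsub
    _ ≤ _ := lintegral_union_le _ _ _
    _ ≤ ENNReal.ofReal (1 / b) + ENNReal.ofReal (1 / b) := by
        gcongr
        · rw [← key]
          refine lintegral_mono fun x => ENNReal.ofReal_le_ofReal ?_
          simpa using hmono 1 (Or.inl rfl) x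
        · rw [← key2]
          exact lintegral_mono fun x => ENNReal.ofReal_le_ofReal (hmono (-1) (Or.inr rfl) x)
    _ = _ := by
        rw [← ENNReal.ofReal_add (by positivity) (by positivity)]
        congr 1; ring

/-- The risk of soft thresholding at the origin. -/
lemma lintegral_sq_softThreshold_le {lam : ℝ} (h : 0 < lam) :
    ∫⁻ z, ENNReal.ofReal (softThreshold lam z ^ 2) ∂stdGauss ≤
      ENNReal.ofReal (16 * Real.exp (-lam ^ 2 / 2) / lam ^ 3) := by
  have hs : ∀ x, |x| ≤ lam → softThreshold lam x = 0 := fun x hx => by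
    unfold softThreshold; rw [max_eq_right (by linarith), mul_zero]
  have hb : ∀ x, lam < |x| → npdf x * softThreshold lam x ^ 2 ≤
      (4 * Real.exp (-lam ^ 2 / 2) / lam ^ 2) * Real.exp (-(lam / 2 * (|x| - lam))) := by
    intro x hx
    have e0 : softThreshold lam x ^ 2 ≤ (|x| - lam) ^ 2 := by
      unfold softThreshold
      rw [max_eq_left (by linarith), mul_pow]
      have : Real.sign x ^ 2 ≤ 1 := by
        rcases Real.sign_apply_eq x with h | h | h <;> rw [h] <;> norm_num
      nlinarith [sq_nonneg (|x| - lam)]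
    set u := |x| - lam with hu
    have hu0 : 0 < u := by linarith
    have e1 : npdf x ≤ 1 / 2 * (Real.exp (-lam ^ 2 / 2) * Real.exp (-(lam * u))) := by
      refine (npdf_le_exp x).trans ?_
      rw [← Real.exp_add]
      gcongr
      have : x ^ 2 = (u + lam) ^ 2 := by rw [hu, sub_add_cancel, sq_abs]
      rw [this]
      nlinarith [sq_nonneg u]
    -- Half of the decay exp(-lam u) pays for u². The remaining half integrates to a further 1/lam,
    -- whence the power lam⁻³ on which summability over the levels rests.
    have e2 : u ^ 2 ≤ 8 / lam ^ 2 * Real.exp (lam * u / 2) := by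
      have := Real.quadratic_le_exp_of_nonneg (x := lam * u / 2) (by positivity)
      rw [div_mul_eq_mul_div, le_div_iff₀ (by positivity)]
      have : 0 ≤ lam * u := by positivity
      nlinarith
    calc npdf x * softThreshold lam x ^ 2
        ≤ (1 / 2 * (Real.exp (-lam ^ 2 / 2) * Real.exp (-(lam * u)))) *
          (8 / lam ^ 2 * Real.exp (lam * u / 2)) := by
          have := npdf_nonneg x
          gcongr
          exact e0.trans e2
      _ = (4 * Real.exp (-lam ^ 2 / 2) / lam ^ 2) *
            (Real.exp (-(lam * u)) * Real.exp (lam * u / 2)) := by ring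
      _ = _ := by rw [← Real.exp_add]; congr 2; ring
  have hmeas : MeasurableSet {x : ℝ | lam < |x|} := measurableSet_lt (by fun_prop) (by fun_prop)
  rw [lintegral_stdGauss, ← lintegral_add_compl _ hmeas]
  have hz : ∫⁻ x in {x : ℝ | lam < |x|}ᶜ,
      ENNReal.ofReal (npdf x) * ENNReal.ofReal (softThreshold lam x ^ 2) = 0 := by
    rw [setLIntegral_congr_fun hmeas.compl (g := fun _ => 0)]
    · simp
    · intro x hx
      simp [hs x (by simpa using hx)]
  rw [hz, add_zero]
  calc _ ≤ ∫⁻ x in {x : ℝ | lam < |x|}, ENNReal.ofReal (4 * Real.exp (-lam ^ 2 / 2) / lam ^ 2) *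
        ENNReal.ofReal (Real.exp (-(lam / 2 * (|x| - lam)))) := by
        refine setLIntegral_mono (by fun_prop) fun x hx => ?_
        rw [← ENNReal.ofReal_mul (npdf_nonneg _), ← ENNReal.ofReal_mul (by positivity)]
        exact ENNReal.ofReal_le_ofReal (hb x hx)
    _ = ENNReal.ofReal (4 * Real.exp (-lam ^ 2 / 2) / lam ^ 2) *
        ∫⁻ x in {x : ℝ | lam < |x|}, ENNReal.ofReal (Real.exp (-(lam / 2 * (|x| - lam)))) :=
        lintegral_const_mul _ (by fun_prop)
    _ ≤ ENNReal.ofReal (4 * Real.exp (-lam ^ 2 / 2) / lam ^ 2) *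
        ENNReal.ofReal (2 / (lam / 2)) := by
        gcongr
        exact lintegral_exp_tail (by positivity) lam
    _ = _ := by
        rw [← ENNReal.ofReal_mul (by positivity)]
        congr 1
        field_simp
        norm_num

lemma lintegral_sq_stdGauss : ∫⁻ z, ENNReal.ofReal (z ^ 2) ∂stdGauss = 1 := by
  have h := variance_id_gaussianReal (μ := 0) (v := 1)
  have h1 : MemLp id 2 (gaussianReal 0 1) := memLp_id_gaussianReal 2
  have h2 := (memLp_two_iff_integrable_sq h1.1).1 h1
  rw [variance_eq_integral (by fun_prop)] at h
  simp only [id, integral_id_gaussianReal, sub_zero, NNReal.coe_one] at h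
  simp only [id] at h2
  rw [← ofReal_integral_eq_lintegral_ofReal h2 (ae_of_all _ fun z => sq_nonneg _)]
  simp [h]

lemma lintegral_pow_four_stdGauss_lt_top : ∫⁻ z, ENNReal.ofReal (z ^ 4) ∂stdGauss < ∞ := by
  have h1 : MemLp id 4 (gaussianReal 0 1) := memLp_id_gaussianReal 4
  have h2 := h1.integrable_norm_pow (p := 4) (by norm_num)
  have h3 := h2.lintegral_lt_top
  simpa [Even.pow_abs (by decide : Even 4)] using h3

/-- The sparsity of a parameter vector: the mean of the statistic `kappaEst`. -/
def sparsity {n : ℕ} (θ : Fin n → ℝ) : ℝ :=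
  (1 / (n : ℝ)) * ∑ k, (1 - Real.exp (-(θ k) ^ 2 / 4))

lemma one_sub_exp_ge (x : ℝ) (hx : 0 ≤ x) : x / (1 + x) ≤ 1 - Real.exp (-x) := by
  rw [Real.exp_neg, div_le_iff₀ (by linarith)]
  have h1 := Real.add_one_le_exp x
  have h2 := Real.exp_pos x
  have : (1 + x) * (Real.exp x)⁻¹ ≤ 1 := by
    rw [← div_eq_mul_inv, div_le_one h2]; linarith
  linarith

/-- The risk of soft thresholding at one coordinate. -/
lemma lintegral_softThreshold_le {lam : ℝ} (h : 0 < lam) (c : ℝ) :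
    ∫⁻ z, ENNReal.ofReal ((softThreshold lam (c + z) - c) ^ 2) ∂stdGauss ≤
      ENNReal.ofReal (32 * Real.exp (-lam ^ 2 / 2) / lam ^ 3
        + 10 * (1 + lam ^ 2) * (1 - Real.exp (-c ^ 2 / 4))) := by
  have hE := Real.exp_pos (-lam ^ 2 / 2)
  have hk : c ^ 2 / (4 + c ^ 2) ≤ 1 - Real.exp (-c ^ 2 / 4) := by
    have := one_sub_exp_ge (c ^ 2 / 4) (by positivity)
    rw [neg_div]
    refine le_trans (le_of_eq ?_) this
    field_simp
  -- For c² ≤ 1 the squared bias is at most 5(1 - exp(-c²/4)), since 4 + c² ≤ 5. For c² > 1 that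
  -- quantity is at least 1/5 and pays for the uniform bound 2 + 2 lam².
  rcases le_or_gt (c ^ 2) 1 with hc | hc
  · calc _ ≤ ∫⁻ z, (2 * ENNReal.ofReal (softThreshold lam z ^ 2)
          + ENNReal.ofReal (2 * c ^ 2)) ∂stdGauss := by
          refine lintegral_mono fun z => ?_
          have : (2 : ℝ≥0∞) = ENNReal.ofReal 2 := by simp
          rw [this, ← ENNReal.ofReal_mul (by norm_num), ← ENNReal.ofReal_add (by positivity)
            (by positivity)]
          exact ENNReal.ofReal_le_ofReal (sq_softThreshold_sub_le h.le c z)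
      _ = 2 * ∫⁻ z, ENNReal.ofReal (softThreshold lam z ^ 2) ∂stdGauss
          + ENNReal.ofReal (2 * c ^ 2) := by
          rw [lintegral_add_right _ (by fun_prop), lintegral_const_mul _ (by fun_prop)]
          simp
      _ ≤ ENNReal.ofReal 2 * ENNReal.ofReal (16 * Real.exp (-lam ^ 2 / 2) / lam ^ 3)
          + ENNReal.ofReal (2 * c ^ 2) := by
          gcongr
          · simp
          · exact lintegral_sq_softThreshold_le h
      _ ≤ _ := by
          rw [← ENNReal.ofReal_mul (by norm_num), ← ENNReal.ofReal_add (by positivity)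
            (by positivity)]
          apply ENNReal.ofReal_le_ofReal
          have h5 : c ^ 2 / 5 ≤ 1 - Real.exp (-c ^ 2 / 4) := by
            refine le_trans ?_ hk
            gcongr
            linarith
          have : 2 * c ^ 2 ≤ 10 * (1 + lam ^ 2) * (1 - Real.exp (-c ^ 2 / 4)) := by
            nlinarith [sq_nonneg c, sq_nonneg lam]
          have e : 2 * (16 * Real.exp (-lam ^ 2 / 2) / lam ^ 3) =
            32 * Real.exp (-lam ^ 2 / 2) / lam ^ 3 := by ring
          linarith
  · calc _ ≤ ∫⁻ z, (2 * ENNReal.ofReal (z ^ 2) + ENNReal.ofReal (2 * lam ^ 2)) ∂stdGauss := by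
          refine lintegral_mono fun z => ?_
          have : (2 : ℝ≥0∞) = ENNReal.ofReal 2 := by simp
          rw [this, ← ENNReal.ofReal_mul (by norm_num), ← ENNReal.ofReal_add (by positivity)
            (by positivity)]
          exact ENNReal.ofReal_le_ofReal (sq_softThreshold_sub_le' h.le c z)
      _ = ENNReal.ofReal (2 + 2 * lam ^ 2) := by
          rw [lintegral_add_right _ (by fun_prop), lintegral_const_mul _ (by fun_prop),
            lintegral_sq_stdGauss, ENNReal.ofReal_add (by norm_num) (by positivity)]
          simp
      _ ≤ _ := by
          apply ENNReal.ofReal_le_ofReal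
          have h5 : 1 / 5 ≤ 1 - Real.exp (-c ^ 2 / 4) := by
            refine le_trans ?_ hk
            rw [div_le_div_iff₀ (by norm_num) (by positivity)]
            linarith
          have : 0 ≤ 32 * Real.exp (-lam ^ 2 / 2) / lam ^ 3 := by positivity
          nlinarith [sq_nonneg lam]

lemma ruleRisk_softThreshold_le {n : ℕ} [NeZero n] (θ : Fin n → ℝ) {lam : ℝ} (h : 0 < lam) :
    ruleRisk θ (softThreshold lam) ≤ ENNReal.ofReal (n * (32 * Real.exp (-lam ^ 2 / 2) / lam ^ 3)
        + 10 * (1 + lam ^ 2) * (n * sparsity θ)) := by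
  have hn : (n : ℝ) ≠ 0 := by exact_mod_cast NeZero.ne n
  refine (Finset.sum_le_sum fun k _ => lintegral_softThreshold_le h (θ k)).trans (le_of_eq ?_)
  rw [← ENNReal.ofReal_sum_of_nonneg]
  · congr 1
    rw [Finset.sum_add_distrib, ← Finset.mul_sum]
    unfold sparsity
    simp only [Finset.sum_const, Finset.card_univ, Fintype.card_fin, nsmul_eq_mul]
    field_simp
  · intro k _
    have : Real.exp (-(θ k) ^ 2 / 4) ≤ 1 := Real.exp_le_one_iff.2 (by nlinarith [sq_nonneg (θ k)])
    have : 0 ≤ 1 - Real.exp (-(θ k) ^ 2 / 4) := by linarith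
    positivity

/-- Completing the square; √2 normalizes the value at c = 0 to one. It follows that `kappaEst` is an
unbiased estimate of `sparsity`. -/
lemma integral_sqrt_two_mul_exp (c : ℝ) :
    ∫ z, √2 * Real.exp (-(c + z) ^ 2 / 2) ∂stdGauss = Real.exp (-c ^ 2 / 4) := by
  rw [integral_stdGauss]
  have e : ∀ x : ℝ, npdf x * (√2 * Real.exp (-(c + x) ^ 2 / 2)) =
      (√2 * (√(2 * Real.pi))⁻¹ * Real.exp (-c ^ 2 / 4)) * Real.exp (-1 * (x + c / 2) ^ 2) := by
    intro x
    unfold npdf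
    have : Real.exp (-x ^ 2 / 2) * Real.exp (-(c + x) ^ 2 / 2) =
        Real.exp (-c ^ 2 / 4) * Real.exp (-1 * (x + c / 2) ^ 2) := by
      rw [← Real.exp_add, ← Real.exp_add]; congr 1; ring
    linear_combination (√2 * (√(2 * Real.pi))⁻¹) * this
  simp_rw [e]
  rw [integral_const_mul, integral_add_right_eq_self (fun x => Real.exp (-1 * x ^ 2)) (c / 2),
    integral_gaussian, div_one, Real.sqrt_mul (by norm_num)]
  have := Real.pi_pos
  field_simp

/-! ### The rescaled kernel and its derivative -/

/-- The kernel with bandwidth `1 / a`. -/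
def scaledKernel (a v : ℝ) : ℝ := a * kernel (a * v)

/-- The derivative of `scaledKernel a`. -/
def scaledKernelDeriv (a v : ℝ) : ℝ :=
  -((1 / (2 * Real.pi)) * ∫ t in (-a)..a, t * Real.sin (t * v))

/-- The sinc kernel is the inverse Fourier transform of the indicator of [-a, a]; all bias
computations rest on this form. -/
lemma scaledKernel_eq (a v : ℝ) :
    scaledKernel a v = (1 / (2 * Real.pi)) * ∫ t in (-a)..a, Real.cos (t * v) := by
  have hpi := Real.pi_pos
  unfold scaledKernel kernel
  rcases eq_or_ne v 0 with rfl | hv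
  · simp
    field_simp
    norm_num
  · rw [intervalIntegral.integral_comp_mul_right (fun x => Real.cos x) hv, integral_cos]
    rcases eq_or_ne a 0 with rfl | ha
    · simp
    · rw [Real.sinc_of_ne_zero (mul_ne_zero ha hv), neg_mul, Real.sin_neg, smul_eq_mul]
      field_simp
      ring

lemma hasDerivAt_scaledKernel (a v : ℝ) :
    HasDerivAt (scaledKernel a) (scaledKernelDeriv a v) v := by
  have h := (intervalIntegral.hasDerivAt_integral_of_dominated_loc_of_deriv_le
    (μ := volume) (a := -a) (b := a) (F := fun v t => Real.cos (t * v))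
    (F' := fun v t => -(t * Real.sin (t * v))) (x₀ := v) (s := Set.univ)
    (bound := fun t => |t|) Filter.univ_mem
    (Eventually.of_forall fun x => Continuous.aestronglyMeasurable (by fun_prop))
    (Continuous.intervalIntegrable (by fun_prop) _ _)
    (Continuous.aestronglyMeasurable (by fun_prop))
    (ae_of_all _ fun t _ x _ => ?_)
    (Continuous.intervalIntegrable (by fun_prop) _ _)
    (ae_of_all _ fun t _ x _ => ?_)).2
  · have h2 := h.const_mul (1 / (2 * Real.pi))
    have e1 : (fun v => 1 / (2 * Real.pi) * ∫ t in (-a)..a, Real.cos (t * v)) = scaledKernel a := by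
      ext v; rw [scaledKernel_eq]
    rw [e1, intervalIntegral.integral_neg, mul_neg] at h2
    exact h2
  · rw [norm_neg, norm_mul, Real.norm_eq_abs]
    have := Real.abs_sin_le_one (t * x)
    exact mul_le_of_le_one_right (abs_nonneg _) this
  · have := (Real.hasDerivAt_cos (t * x)).comp x ((hasDerivAt_id x).const_mul t)
    convert! this using 1
    simp
    ring

lemma scaledKernelDeriv_zero (a : ℝ) : scaledKernelDeriv a 0 = 0 := by
  simp [scaledKernelDeriv]

@[fun_prop]
lemma continuous_scaledKernel (a : ℝ) : Continuous (scaledKernel a) :=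
  continuous_iff_continuousAt.2 fun v => (hasDerivAt_scaledKernel a v).continuousAt

@[fun_prop]
lemma continuous_scaledKernelDeriv (a : ℝ) : Continuous (scaledKernelDeriv a) := by
  unfold scaledKernelDeriv
  have : Continuous fun v => ∫ t in (-a)..a, t * Real.sin (t * v) :=
    intervalIntegral.continuous_parametric_intervalIntegral_of_continuous' (by fun_prop) _ _
  fun_prop

lemma one_div_two_pi_le : 1 / (2 * Real.pi) ≤ 1 / 6 := by
  apply one_div_le_one_div_of_le (by norm_num)
  linarith [Real.pi_gt_three]

lemma abs_scaledKernel_le {a : ℝ} (ha : 0 ≤ a) (v : ℝ) : |scaledKernel a v| ≤ a := by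
  unfold scaledKernel kernel
  have h1 := Real.abs_sinc_le_one (a * v)
  have h2 := Real.pi_gt_three
  rw [abs_mul, abs_of_nonneg ha, abs_div, abs_of_pos Real.pi_pos]
  apply mul_le_of_le_one_right ha
  rw [div_le_one Real.pi_pos]
  linarith

lemma abs_scaledKernelDeriv_le {a : ℝ} (ha : 0 ≤ a) (v : ℝ) :
    |scaledKernelDeriv a v| ≤ a ^ 2 := by
  have h := intervalIntegral.norm_integral_le_of_norm_le_const (a := -a) (b := a) (C := a)
    (f := fun t => t * Real.sin (t * v)) fun t ht => by
      rw [Set.uIoc_of_le (by linarith)] at ht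
      rw [norm_mul, Real.norm_eq_abs, Real.norm_eq_abs]
      have h1 := Real.abs_sin_le_one (t * v)
      have h2 : |t| ≤ a := abs_le.2 ⟨ht.1.le, ht.2⟩
      have := abs_nonneg (Real.sin (t * v))
      have := abs_nonneg t
      nlinarith
  unfold scaledKernelDeriv
  have hpi := one_div_two_pi_le
  have hpi0 := Real.pi_pos
  rw [abs_neg, abs_mul, abs_of_pos (by positivity : 0 < 1 / (2 * Real.pi))]
  rw [Real.norm_eq_abs, sub_neg_eq_add, abs_of_nonneg (by linarith : 0 ≤ a + a)] at h
  calc _ ≤ 1 / 6 * (a * (a + a)) := by gcongr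
    _ ≤ _ := by nlinarith [sq_nonneg a]

/-- Merges boundedness near 0 and 1/|v| decay into a single integrable majorant, used for both the
kernel and its derivative. -/
lemma sq_le_of_abs_le {y b v : ℝ} (h1 : |y| ≤ b) (h2 : 1 ≤ |v| → |y| ≤ b / |v|) :
    y ^ 2 ≤ 2 * b ^ 2 * (1 + v ^ 2)⁻¹ := by
  rw [← div_eq_mul_inv, le_div_iff₀ (by positivity), ← sq_abs y, ← sq_abs v]
  have h0 := abs_nonneg y
  rcases le_or_gt 1 |v| with hv | hv
  · have h3 : |y| * |v| ≤ b := by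
      rw [← le_div_iff₀ (by linarith)]; exact h2 hv
    have h4 : 0 ≤ |y| * |v| := by positivity
    nlinarith
  · have := abs_nonneg v
    have h5 : |v| ^ 2 ≤ 1 := by nlinarith
    nlinarith [sq_nonneg |y|]

lemma sq_scaledKernel_le {a : ℝ} (ha : 1 ≤ a) (v : ℝ) :
    scaledKernel a v ^ 2 ≤ 2 * a ^ 2 * (1 + v ^ 2)⁻¹ := by
  refine sq_le_of_abs_le (abs_scaledKernel_le (by linarith) v) fun hv => ?_
  have hv0 : v ≠ 0 := by rintro rfl; norm_num at hv
  unfold scaledKernel kernel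
  rw [Real.sinc_of_ne_zero (mul_ne_zero (by linarith) hv0)]
  have e : a * (Real.sin (a * v) / (a * v) / Real.pi) = Real.sin (a * v) / (v * Real.pi) := by
    field_simp
  rw [e, abs_div, abs_mul, abs_of_pos Real.pi_pos]
  have := Real.abs_sin_le_one (a * v)
  have hpi := Real.pi_gt_three
  rw [div_le_div_iff₀ (by positivity) (by positivity)]
  calc |Real.sin (a * v)| * |v| ≤ 1 * |v| := by gcongr
    _ ≤ a * (|v| * Real.pi) := by
        have h3 : |v| * 1 ≤ |v| * Real.pi := by gcongr; linarith
        calc 1 * |v| ≤ 1 * (|v| * Real.pi) := by linarith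
          _ ≤ _ := by gcongr

/-- The Fourier form of the derivative shows boundedness; its decay in v is read off from
sin(av)/(πv) differentiated away from 0. -/
lemma scaledKernelDeriv_eq {a v : ℝ} (ha : a ≠ 0) (hv : v ≠ 0) :
    scaledKernelDeriv a v =
      (a * v * Real.cos (a * v) - Real.sin (a * v)) / (Real.pi * v ^ 2) := by
  have h1 : HasDerivAt (fun x => Real.sin (a * x) / (Real.pi * x))
      ((a * v * Real.cos (a * v) - Real.sin (a * v)) / (Real.pi * v ^ 2)) v := by
    have := ((Real.hasDerivAt_sin (a * v)).comp v ((hasDerivAt_id v).const_mul a)).div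
      ((hasDerivAt_id v).const_mul Real.pi) (mul_ne_zero Real.pi_ne_zero hv)
    convert! this using 1
    simp
    field_simp
  have h2 : scaledKernel a =ᶠ[𝓝 v] fun x => Real.sin (a * x) / (Real.pi * x) := by
    filter_upwards [isOpen_ne.mem_nhds hv] with x hx
    unfold scaledKernel kernel
    rw [Real.sinc_of_ne_zero (mul_ne_zero ha hx)]
    have : x ≠ 0 := hx
    field_simp
  exact (hasDerivAt_scaledKernel a v).unique (h1.congr_of_eventuallyEq h2)

lemma sq_scaledKernelDeriv_le {a : ℝ} (ha : 1 ≤ a) (v : ℝ) :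
    scaledKernelDeriv a v ^ 2 ≤ 2 * (a ^ 2) ^ 2 * (1 + v ^ 2)⁻¹ := by
  refine sq_le_of_abs_le (abs_scaledKernelDeriv_le (by linarith) v) fun hv => ?_
  have hv0 : v ≠ 0 := by rintro rfl; norm_num at hv
  rw [scaledKernelDeriv_eq (by linarith) hv0, abs_div,
    abs_of_pos (by positivity : 0 < Real.pi * v ^ 2), ← sq_abs v,
    div_le_div_iff₀ (by positivity) (by positivity)]
  have h1 : |a * v * Real.cos (a * v) - Real.sin (a * v)| ≤ a * |v| + 1 := by
    refine (abs_sub _ _).trans ?_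
    rw [abs_mul, abs_mul, abs_of_pos (by linarith : 0 < a)]
    have := Real.abs_sin_le_one (a * v)
    have := Real.abs_cos_le_one (a * v)
    have : 0 ≤ a * |v| := by positivity
    nlinarith
  have h2 : a * |v| + 1 ≤ a ^ 2 * (3 * |v|) := by
    have h3 : a * |v| ≤ a ^ 2 * |v| := by
      have : a ≤ a ^ 2 := by nlinarith
      gcongr
    nlinarith
  calc _ ≤ (a ^ 2 * (3 * |v|)) * |v| :=
        mul_le_mul_of_nonneg_right (h1.trans h2) (abs_nonneg v)
    _ = a ^ 2 * (3 * |v| ^ 2) := by ring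
    _ ≤ _ := by gcongr; exact Real.pi_gt_three.le

lemma lintegral_inv_one_add_sq (c : ℝ) (hc : 0 ≤ c) :
    ∫⁻ v : ℝ, ENNReal.ofReal (c * (1 + v ^ 2)⁻¹) = ENNReal.ofReal (c * Real.pi) := by
  rw [← ofReal_integral_eq_lintegral_ofReal (integrable_inv_one_add_sq.const_mul c)
    (ae_of_all _ fun v => by positivity), integral_const_mul, integral_univ_inv_one_add_sq]

/-! ### Bias of the kernel estimates -/

lemma integral_cexp_stdGauss (c : ℝ) :
    ∫ z, Complex.exp (c * z * Complex.I) ∂stdGauss = (Real.exp (-c ^ 2 / 2) : ℝ) := by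
  have := charFun_gaussianReal (μ := 0) (v := 1) c
  rw [charFun_apply_real] at this
  rw [this]
  push_cast
  congr 1
  simp
  ring

lemma integrable_cexp_stdGauss (c : ℝ) :
    Integrable (fun z : ℝ => Complex.exp (c * z * Complex.I)) stdGauss := by
  refine Integrable.of_bound (C := 1) (Continuous.aestronglyMeasurable (by fun_prop))
    (ae_of_all _ fun z => ?_)
  rw [← Complex.ofReal_mul, Complex.norm_exp_ofReal_mul_I]

lemma integral_cos_stdGauss (c : ℝ) :
    ∫ z, Real.cos (c * z) ∂stdGauss = Real.exp (-c ^ 2 / 2) := by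
  have h := congrArg Complex.re (integral_cexp_stdGauss c)
  rw [Complex.ofReal_re] at h
  rw [← h]
  have := integral_re (𝕜 := ℂ) (integrable_cexp_stdGauss c)
  simp only [RCLike.re_to_complex] at this
  rw [← this]
  congr with z
  rw [← Complex.ofReal_mul, Complex.exp_ofReal_mul_I_re]

lemma integral_sin_stdGauss (c : ℝ) : ∫ z, Real.sin (c * z) ∂stdGauss = 0 := by
  have h := congrArg Complex.im (integral_cexp_stdGauss c)
  rw [Complex.ofReal_im] at h
  rw [← h]
  have := integral_im (𝕜 := ℂ) (integrable_cexp_stdGauss c)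
  simp only [RCLike.im_to_complex] at this
  rw [← this]
  congr with z
  rw [← Complex.ofReal_mul, Complex.exp_ofReal_mul_I_im]

lemma integrable_of_continuous_of_abs_le {μ : Measure ℝ} [IsFiniteMeasure μ] {f : ℝ → ℝ}
    (hf : Continuous f) {C : ℝ} (h : ∀ x, |f x| ≤ C) : Integrable f μ :=
  Integrable.of_bound hf.aestronglyMeasurable C (ae_of_all _ h)

lemma integral_cos_sub_stdGauss (t c : ℝ) :
    ∫ z, Real.cos (t * (c - z)) ∂stdGauss = Real.cos (t * c) * Real.exp (-t ^ 2 / 2) := by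
  have e : ∀ z, Real.cos (t * (c - z)) =
      Real.cos (t * c) * Real.cos (t * z) + Real.sin (t * c) * Real.sin (t * z) := fun z => by
    rw [mul_sub, Real.cos_sub]
  simp_rw [e]
  rw [integral_add, integral_const_mul, integral_const_mul, integral_cos_stdGauss,
    integral_sin_stdGauss]
  · ring
  · exact (integrable_of_continuous_of_abs_le (by fun_prop)
      fun x => Real.abs_cos_le_one (t * x)).const_mul _
  · exact (integrable_of_continuous_of_abs_le (by fun_prop)
      fun x => Real.abs_sin_le_one (t * x)).const_mul _

lemma integral_sin_sub_stdGauss (t c : ℝ) :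
    ∫ z, Real.sin (t * (c - z)) ∂stdGauss = Real.sin (t * c) * Real.exp (-t ^ 2 / 2) := by
  have e : ∀ z, Real.sin (t * (c - z)) =
      Real.sin (t * c) * Real.cos (t * z) - Real.cos (t * c) * Real.sin (t * z) := fun z => by
    rw [mul_sub, Real.sin_sub]
  simp_rw [e]
  rw [integral_sub, integral_const_mul, integral_const_mul, integral_cos_stdGauss,
    integral_sin_stdGauss]
  · ring
  · exact (integrable_of_continuous_of_abs_le (by fun_prop)
      fun x => Real.abs_cos_le_one (t * x)).const_mul _
  · exact (integrable_of_continuous_of_abs_le (by fun_prop)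
      fun x => Real.abs_sin_le_one (t * x)).const_mul _

lemma integrable_abs_stdGauss : Integrable (fun z : ℝ => |z|) stdGauss := by
  have h1 : MemLp id 1 (gaussianReal 0 1) := memLp_id_gaussianReal 1
  have := (memLp_one_iff_integrable.1 h1).abs
  simpa using this

/-- Differentiate ∫ cos(cz) = exp(-c²/2) in c under the integral sign. -/
lemma integral_mul_sin_stdGauss (c : ℝ) :
    ∫ z, z * Real.sin (c * z) ∂stdGauss = c * Real.exp (-c ^ 2 / 2) := by
  have h := (hasDerivAt_integral_of_dominated_loc_of_deriv_le
    (μ := stdGauss) (F := fun c z => Real.cos (c * z))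
    (F' := fun c z => -(z * Real.sin (c * z))) (x₀ := c) (s := Set.univ)
    (bound := fun t => |t|) Filter.univ_mem
    (Eventually.of_forall fun x => Continuous.aestronglyMeasurable (by fun_prop))
    (integrable_of_continuous_of_abs_le (by fun_prop) fun x => Real.abs_cos_le_one (c * x))
    (Continuous.aestronglyMeasurable (by fun_prop))
    (ae_of_all _ fun t x _ => ?_) integrable_abs_stdGauss
    (ae_of_all _ fun t x _ => ?_)).2
  · simp_rw [integral_cos_stdGauss] at h
    have h2 : HasDerivAt (fun c : ℝ => Real.exp (-c ^ 2 / 2)) (-(c * Real.exp (-c ^ 2 / 2))) c := by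
      have := (((hasDerivAt_id c).pow 2).neg.div_const 2).exp
      convert! this using 1
      simp
      ring
    have h3 := h.unique h2
    rw [integral_neg] at h3
    linarith
  · rw [norm_neg, norm_mul, Real.norm_eq_abs]
    exact mul_le_of_le_one_right (abs_nonneg _) (Real.abs_sin_le_one _)
  · have := (Real.hasDerivAt_cos (x * t)).comp x ((hasDerivAt_id x).mul_const t)
    convert! this using 1
    simp
    ring

lemma exp_eq_npdf (t : ℝ) : Real.exp (-t ^ 2 / 2) = √(2 * Real.pi) * npdf t := by
  unfold npdf
  have : 0 < √(2 * Real.pi) := by have := Real.pi_pos; positivity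
  field_simp

/-- Fourier inversion for the Gaussian needs no inversion theorem: the transform is again Gaussian,
so the characteristic function identity is reread with exp(-t²/2) as a multiple of the density. -/
lemma npdf_eq_integral (c : ℝ) :
    npdf c = (1 / (2 * Real.pi)) * ∫ t, Real.cos (t * c) * Real.exp (-t ^ 2 / 2) := by
  have h := integral_cos_stdGauss c
  rw [integral_stdGauss] at h
  have e : ∀ t, Real.cos (t * c) * Real.exp (-t ^ 2 / 2) =
      √(2 * Real.pi) * (npdf t * Real.cos (c * t)) := fun t => by
    rw [exp_eq_npdf, mul_comm t c]; ring
  simp_rw [e]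
  rw [integral_const_mul, h]
  unfold npdf
  have h2 := Real.mul_self_sqrt (by have := Real.pi_pos; positivity : 0 ≤ 2 * Real.pi)
  have : 0 < √(2 * Real.pi) := by have := Real.pi_pos; positivity
  nth_rewrite 2 [← h2]
  field_simp

lemma mul_npdf_eq_integral (c : ℝ) :
    c * npdf c = (1 / (2 * Real.pi)) * ∫ t, t * Real.sin (t * c) * Real.exp (-t ^ 2 / 2) := by
  have h := integral_mul_sin_stdGauss c
  rw [integral_stdGauss] at h
  have e : ∀ t, t * Real.sin (t * c) * Real.exp (-t ^ 2 / 2) =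
      √(2 * Real.pi) * (npdf t * (t * Real.sin (c * t))) := fun t => by
    rw [exp_eq_npdf, mul_comm t c]; ring
  simp_rw [e]
  rw [integral_const_mul, h]
  unfold npdf
  have h2 := Real.mul_self_sqrt (by have := Real.pi_pos; positivity : 0 ≤ 2 * Real.pi)
  have : 0 < √(2 * Real.pi) := by have := Real.pi_pos; positivity
  nth_rewrite 2 [← h2]
  field_simp

lemma integrable_abs_mul_exp : Integrable fun t : ℝ => |t| * Real.exp (-t ^ 2 / 2) := by
  have := (integrable_mul_exp_neg_mul_sq (b := 1 / 2) (by norm_num)).abs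
  convert! this using 2 with t
  rw [abs_mul, abs_of_pos (Real.exp_pos _)]
  congr 2
  ring

lemma setIntegral_abs_mul_exp_le {a : ℝ} (ha : 0 ≤ a) :
    ∫ t in (Set.Ioc (-a) a)ᶜ, |t| * Real.exp (-t ^ 2 / 2) ≤ 2 * Real.exp (-a ^ 2 / 2) := by
  have h1 : ∫ t in Set.Ioi a, |t| * Real.exp (-t ^ 2 / 2) = Real.exp (-a ^ 2 / 2) := by
    have e : ∫ t in Set.Ioi a, |t| * Real.exp (-t ^ 2 / 2) =
        ∫ t in Set.Ioi a, t * Real.exp (-t ^ 2 / 2) :=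
      setIntegral_congr_fun measurableSet_Ioi fun t ht => by
        have h0 : 0 ≤ t := ha.trans (le_of_lt ht)
        simp only [abs_of_nonneg h0]
    have hint : IntegrableOn (fun t => t * Real.exp (-t ^ 2 / 2)) (Set.Ioi a) :=
      integrable_abs_mul_exp.integrableOn.congr_fun (fun t ht => by
        have h0 : 0 ≤ t := ha.trans (le_of_lt ht)
        simp only [abs_of_nonneg h0]) measurableSet_Ioi
    have hlim : Tendsto (fun t : ℝ => -Real.exp (-t ^ 2 / 2)) atTop (𝓝 (-0)) := by
      refine (Real.tendsto_exp_atBot.comp ?_).neg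
      have : Tendsto (fun t : ℝ => t ^ 2 / 2) atTop atTop :=
        (tendsto_pow_atTop (by norm_num)).atTop_div_const (by norm_num)
      exact (tendsto_neg_atTop_atBot.comp this).congr fun t => by simp [neg_div]
    have := integral_Ioi_of_hasDerivAt_of_tendsto' (a := a)
      (f := fun t : ℝ => -Real.exp (-t ^ 2 / 2)) (f' := fun t => t * Real.exp (-t ^ 2 / 2))
      (fun t _ => by
        have := (((hasDerivAt_id t).pow 2).neg.div_const 2).exp.neg
        convert! this using 1
        simp
        ring) hint hlim
    rw [e, this]
    simp
  have h2 : ∫ t in Set.Iic (-a), |t| * Real.exp (-t ^ 2 / 2) = Real.exp (-a ^ 2 / 2) := by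
    have := integral_comp_neg_Iic (-a) (fun t => |t| * Real.exp (-t ^ 2 / 2))
    simpa [h1] using this
  have hc : (Set.Ioc (-a) a)ᶜ = Set.Iic (-a) ∪ Set.Ioi a := by
    ext t; simp only [Set.mem_compl_iff, Set.mem_Ioc, Set.mem_union, Set.mem_Iic, Set.mem_Ioi]
    grind
  rw [hc, setIntegral_union _ measurableSet_Ioi integrable_abs_mul_exp.integrableOn
    integrable_abs_mul_exp.integrableOn, h1, h2]
  · linarith
  · rw [Set.disjoint_left]
    intro t h1 h2
    simp only [Set.mem_Iic, Set.mem_Ioi] at h1 h2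
    linarith

/-- Since a ≥ 1, both alternatives for w give |w t| ≤ |t| outside [-a, a], and the tail of |t|
exp(-t²/2) has a closed form. -/
lemma abs_truncation_le {a : ℝ} (ha : 1 ≤ a) {w : ℝ → ℝ} (hw : Continuous w)
    (hw1 : ∀ t, |w t| ≤ 1 ∨ |w t| ≤ |t|) :
    |(1 / (2 * Real.pi)) * (∫ t in (-a)..a, w t * Real.exp (-t ^ 2 / 2)) -
      (1 / (2 * Real.pi)) * ∫ t, w t * Real.exp (-t ^ 2 / 2)| ≤ Real.exp (-a ^ 2 / 2) := by
  have hint1 : Integrable fun t : ℝ => Real.exp (-t ^ 2 / 2) := by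
    have := integrable_exp_neg_mul_sq (b := 1 / 2) (by norm_num)
    convert! this using 3 with t
    ring
  have hint : Integrable fun t => w t * Real.exp (-t ^ 2 / 2) := by
    refine (hint1.add integrable_abs_mul_exp).mono'
      (Continuous.aestronglyMeasurable (by fun_prop)) (ae_of_all _ fun t => ?_)
    have := Real.exp_pos (-t ^ 2 / 2)
    rw [norm_mul, Real.norm_eq_abs, Real.norm_eq_abs, abs_of_pos this]
    have h3 : |w t| ≤ 1 + |t| := by
      rcases hw1 t with h | h <;> linarith [abs_nonneg t]
    simp only [Pi.add_apply]
    nlinarith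
  rw [intervalIntegral.integral_of_le (by linarith), ← mul_sub, abs_mul,
    ← integral_add_compl measurableSet_Ioc hint, sub_add_cancel_left, abs_neg]
  have hpi := one_div_two_pi_le
  have hpi0 := Real.pi_pos
  rw [abs_of_pos (by positivity : 0 < 1 / (2 * Real.pi))]
  have h2 : |∫ t in (Set.Ioc (-a) a)ᶜ, w t * Real.exp (-t ^ 2 / 2)| ≤
      2 * Real.exp (-a ^ 2 / 2) := by
    refine le_trans ?_ (setIntegral_abs_mul_exp_le (by linarith : 0 ≤ a))
    rw [← Real.norm_eq_abs]
    refine norm_integral_le_of_norm_le integrable_abs_mul_exp.integrableOn ?_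
    refine (ae_restrict_iff' measurableSet_Ioc.compl).2 (ae_of_all _ fun t ht => ?_)
    rw [norm_mul, Real.norm_eq_abs, Real.norm_eq_abs, abs_of_pos (Real.exp_pos _)]
    refine mul_le_mul_of_nonneg_right ?_ (Real.exp_pos _).le
    have h3 : a ≤ |t| := by
      by_contra! h
      rw [abs_lt] at h
      exact ht ⟨h.1, h.2.le⟩
    rcases hw1 t with h | h <;> linarith
  calc _ ≤ 1 / 6 * (2 * Real.exp (-a ^ 2 / 2)) := by gcongr
    _ ≤ _ := by have := Real.exp_pos (-a ^ 2 / 2); linarith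

lemma integral_intervalIntegral_swap {a : ℝ} (ha : 0 ≤ a) {F : ℝ → ℝ → ℝ}
    (hF : Continuous (Function.uncurry F)) {C : ℝ} (hC : ∀ z t, |t| ≤ a → |F z t| ≤ C) :
    ∫ z, (∫ t in (-a)..a, F z t) ∂stdGauss = ∫ t in (-a)..a, (∫ z, F z t ∂stdGauss) := by
  simp_rw [intervalIntegral.integral_of_le (by linarith : -a ≤ a)]
  refine integral_integral_swap (Integrable.of_bound (C := C) hF.aestronglyMeasurable ?_)
  have : ∀ᵐ p ∂(stdGauss.prod (volume.restrict (Set.Ioc (-a) a))), p.2 ∈ Set.Ioc (-a) a := by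
    refine Measure.ae_prod_iff_ae_ae ?_ |>.2 (ae_of_all _ fun z => ?_)
    · exact measurable_snd measurableSet_Ioc
    · exact ae_restrict_mem measurableSet_Ioc
  filter_upwards [this] with p hp
  exact hC p.1 p.2 (abs_le.2 ⟨hp.1.le, hp.2⟩)

/-- Smoothing with the sinc kernel cuts the characteristic function off at frequency a, so the bias
is a Gaussian Fourier tail: 1/n for a = √(2 log n). -/
lemma abs_integral_scaledKernel_sub_le {a : ℝ} (ha : 1 ≤ a) (c : ℝ) :
    |∫ z, scaledKernel a (c - z) ∂stdGauss - npdf c| ≤ Real.exp (-a ^ 2 / 2) := by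
  simp_rw [scaledKernel_eq]
  rw [integral_const_mul, integral_intervalIntegral_swap (by linarith) (C := 1) (by fun_prop)
    fun z t _ => Real.abs_cos_le_one _, npdf_eq_integral]
  simp_rw [integral_cos_sub_stdGauss]
  exact abs_truncation_le ha (by fun_prop) fun t => Or.inl (Real.abs_cos_le_one _)

lemma abs_integral_scaledKernelDeriv_sub_le {a : ℝ} (ha : 1 ≤ a) (c : ℝ) :
    |∫ z, scaledKernelDeriv a (c - z) ∂stdGauss - -(c * npdf c)| ≤ Real.exp (-a ^ 2 / 2) := by
  unfold scaledKernelDeriv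
  have hle : ∀ t x : ℝ, |t * Real.sin x| ≤ |t| := fun t x => by
    rw [abs_mul]
    exact mul_le_of_le_one_right (abs_nonneg _) (Real.abs_sin_le_one _)
  rw [integral_neg, integral_const_mul, integral_intervalIntegral_swap (by linarith) (C := a)
    (by fun_prop) fun z t ht => (hle _ _).trans ht, mul_npdf_eq_integral]
  simp_rw [integral_const_mul, integral_sin_sub_stdGauss, ← mul_assoc]
  rw [neg_sub_neg, abs_sub_comm]
  exact abs_truncation_le ha (w := fun t => t * Real.sin (t * c)) (by fun_prop)
    fun t => Or.inr (hle _ _)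

/-! ### Independent coordinates -/

/-- The noise of a block. -/
abbrev blockNoise (n : ℕ) : Measure (Fin n → ℝ) := Measure.pi fun _ => stdGauss

lemma lintegral_blockNoise_eval {n : ℕ} (k : Fin n) {f : ℝ → ℝ≥0∞} (hf : Measurable f) :
    ∫⁻ w, f (w k) ∂blockNoise n = ∫⁻ z, f z ∂stdGauss :=
  (measurePreserving_eval (fun _ : Fin n => stdGauss) k).lintegral_comp hf

lemma integral_blockNoise_eval {n : ℕ} (k : Fin n) {f : ℝ → ℝ} (hf : Measurable f) :
    ∫ w, f (w k) ∂blockNoise n = ∫ z, f z ∂stdGauss := by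
  rw [← (measurePreserving_eval (fun _ : Fin n => stdGauss) k).map_eq,
    integral_map (measurable_pi_apply k).aemeasurable hf.aestronglyMeasurable]

/-- Resampling one coordinate preserves the product law. This decouples the noise at `k` from
quantities that do not depend on it. -/
lemma lintegral_blockNoise_update {n : ℕ} (k : Fin n) {F : (Fin n → ℝ) → ℝ≥0∞}
    (hF : Measurable F) :
    ∫⁻ w, F w ∂blockNoise n = ∫⁻ w, ∫⁻ z, F (Function.update w k z) ∂stdGauss ∂blockNoise n := by
  refine lintegral_eq_of_lmarginal_eq {k} hF ?_ ?_
  · have := hF.lmarginal (fun _ : Fin n => stdGauss) (s := {k})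
    rwa [lmarginal_singleton] at this
  · have e : ∀ G : (Fin n → ℝ) → ℝ≥0∞, ∫⋯∫⁻_{k}, G ∂(fun _ : Fin n => stdGauss) =
        fun w => ∫⁻ z, G (Function.update w k z) ∂stdGauss := fun G => lmarginal_singleton G k
    rw [e, e]
    ext w
    simp

section
variable {n : ℕ} {h : Fin n → ℝ → ℝ} {M : ℝ}

lemma iIndepFun_blockNoise (hh : ∀ i, Measurable (h i)) :
    iIndepFun (fun i w => h i (w i)) (blockNoise n) :=
  iIndepFun_pi fun i => (hh i).aemeasurable

/-- Bias-variance decomposition for an average of functions of independent coordinates. -/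
lemma lintegral_sq_average_sub_le (hh : ∀ i, Measurable (h i)) (hM : ∀ i z, |h i z| ≤ M)
    {v : Fin n → ℝ} (hv : ∀ i, Var[h i; stdGauss] ≤ v i) {g b : ℝ}
    (hb : |(1 / (n : ℝ)) * ∑ i, ∫ z, h i z ∂stdGauss - g| ≤ b) :
    ∫⁻ w, ENNReal.ofReal (((1 / (n : ℝ)) * ∑ i, h i (w i) - g) ^ 2) ∂blockNoise n ≤
      ENNReal.ofReal ((1 / (n : ℝ)) ^ 2 * ∑ i, v i + b ^ 2) := by
  have hmem : ∀ i, MemLp (fun w : Fin n → ℝ => h i (w i)) 2 (blockNoise n) := fun i =>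
    MemLp.of_bound ((hh i).comp (measurable_pi_apply i)).aestronglyMeasurable M
      (ae_of_all _ fun w => hM i (w i))
  have hmemS : MemLp (fun w : Fin n → ℝ => ∑ i, h i (w i)) 2 (blockNoise n) :=
    memLp_finsetSum _ fun i _ => hmem i
  have hmemY : MemLp (fun w : Fin n → ℝ => (1 / (n : ℝ)) * ∑ i, h i (w i)) 2 (blockNoise n) :=
    hmemS.const_mul _
  have hmemZ : MemLp (fun w : Fin n → ℝ => (1 / (n : ℝ)) * ∑ i, h i (w i) - g) 2 (blockNoise n) :=
    hmemY.sub (memLp_const g)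
  rw [← ofReal_integral_eq_lintegral_ofReal hmemZ.integrable_sq (ae_of_all _ fun _ => sq_nonneg _)]
  apply ENNReal.ofReal_le_ofReal
  have h1 := variance_eq_sub hmemZ
  have h2 : Var[fun w => (1 / (n : ℝ)) * ∑ i, h i (w i) - g; blockNoise n] =
      (1 / (n : ℝ)) ^ 2 * ∑ i, Var[h i; stdGauss] := by
    rw [variance_sub_const hmemY.aestronglyMeasurable, variance_const_mul]
    congr 1
    have := IndepFun.variance_sum (μ := blockNoise n) (s := Finset.univ)
      (X := fun i (w : Fin n → ℝ) => h i (w i)) (fun i _ => hmem i)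
      (fun i _ j _ hij => (iIndepFun_blockNoise hh).indepFun hij)
    convert! this using 2 with i
    · ext w; simp
    · rw [← (measurePreserving_eval (fun _ : Fin n => stdGauss) i).map_eq,
        variance_map (hh i).aemeasurable (measurable_pi_apply i).aemeasurable]
      rfl
  have h3 : ∫ w, ((1 / (n : ℝ)) * ∑ i, h i (w i) - g) ∂blockNoise n =
      (1 / (n : ℝ)) * ∑ i, ∫ z, h i z ∂stdGauss - g := by
    rw [integral_sub (hmemY.integrable (by norm_num)) (integrable_const _), integral_const_mul,
      integral_finsetSum _ fun i _ => (hmem i).integrable (by norm_num)]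
    simp_rw [integral_blockNoise_eval _ (hh _)]
    simp
  have h4 : ∫ w, ((1 / (n : ℝ)) * ∑ i, h i (w i) - g) ^ 2 ∂blockNoise n =
      (1 / (n : ℝ)) ^ 2 * ∑ i, Var[h i; stdGauss] +
        ((1 / (n : ℝ)) * ∑ i, ∫ z, h i z ∂stdGauss - g) ^ 2 := by
    rw [← h2, ← h3, h1]
    simp only [Pi.pow_apply]
    ring
  rw [h4]
  have h5 : ((1 / (n : ℝ)) * ∑ i, ∫ z, h i z ∂stdGauss - g) ^ 2 ≤ b ^ 2 := by
    rw [← sq_abs]; gcongr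
  gcongr with i
  exact hv i

/-- Hoeffding's inequality for functions of independent coordinates. -/
lemma measure_sum_sub_ge_le (hh : ∀ i, Measurable (h i)) (hM : ∀ i z, |h i z| ≤ M)
    {t : ℝ} (ht : 0 ≤ t) :
    blockNoise n {w | t ≤ ∑ i, (h i (w i) - ∫ z, h i z ∂stdGauss)} ≤
      ENNReal.ofReal (Real.exp (-t ^ 2 / (2 * (n * M ^ 2)))) := by
  have hsub : ∀ i ∈ (Finset.univ : Finset (Fin n)),
      HasSubgaussianMGF (fun w : Fin n → ℝ => h i (w i) - ∫ z, h i z ∂stdGauss)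
        ((‖M - -M‖₊ / 2) ^ 2) (blockNoise n) := fun i _ => by
    have := hasSubgaussianMGF_of_mem_Icc (μ := blockNoise n) (a := -M) (b := M)
      (X := fun w : Fin n → ℝ => h i (w i))
      ((hh i).comp (measurable_pi_apply i)).aemeasurable
      (ae_of_all _ fun w => abs_le.1 (hM i (w i)))
    rwa [integral_blockNoise_eval i (hh i)] at this
  have hind : iIndepFun (fun i (w : Fin n → ℝ) => h i (w i) - ∫ z, h i z ∂stdGauss)
      (blockNoise n) :=
    iIndepFun_blockNoise (h := fun i z => h i z - ∫ z, h i z ∂stdGauss)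
      fun i => (hh i).sub_const _
  have := HasSubgaussianMGF.measure_sum_ge_le_of_iIndepFun hind hsub ht
  rw [← ENNReal.ofReal_toReal (measure_ne_top (blockNoise n) _)]
  refine ENNReal.ofReal_le_ofReal (this.trans (le_of_eq ?_))
  congr 3
  -- Hoeffding's lemma on [-M, M] gives the variance proxy (2M/2)² = M² for each coordinate.
  have e : M - -M = 2 * M := by ring
  simp only [Finset.sum_const, Finset.card_univ, Fintype.card_fin, nsmul_eq_mul, e]
  push_cast
  rw [norm_mul, Real.norm_ofNat, Real.norm_eq_abs,
    mul_div_cancel_left₀ _ (by norm_num : (2 : ℝ) ≠ 0), sq_abs]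

lemma measure_sum_sub_le_neg_le (hh : ∀ i, Measurable (h i)) (hM : ∀ i z, |h i z| ≤ M)
    {t : ℝ} (ht : 0 ≤ t) :
    blockNoise n {w | ∑ i, (h i (w i) - ∫ z, h i z ∂stdGauss) ≤ -t} ≤
      ENNReal.ofReal (Real.exp (-t ^ 2 / (2 * (n * M ^ 2)))) := by
  have := measure_sum_sub_ge_le (h := fun i z => -h i z) (M := M) (fun i => (hh i).neg)
    (fun i z => by rw [abs_neg]; exact hM i z) ht
  refine le_trans (measure_mono fun w hw => ?_) this
  have hw' : ∑ i, (h i (w i) - ∫ z, h i z ∂stdGauss) ≤ -t := hw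
  change t ≤ ∑ i, (-h i (w i) - ∫ z, -h i z ∂stdGauss)
  rw [← neg_le_neg_iff, neg_neg, ← Finset.sum_neg_distrib] at hw'
  have : ∀ i, -(h i (w i) - ∫ z, h i z ∂stdGauss) = -h i (w i) - ∫ z, -h i z ∂stdGauss :=
    fun i => by rw [integral_neg]; ring
  simp_rw [this] at hw'
  exact hw'

end

/-! ### Leave-one-out estimates of the mixture density -/

/-- The argument of the kernel at the `i`-th observation, with `0` at the omitted index `k`. -/
def looArg {n : ℕ} (θ : Fin n → ℝ) (k : Fin n) (w : Fin n → ℝ) (x : ℝ) (i : Fin n) : ℝ :=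
  if i = k then 0 else x - θ i - w i

/-- Density estimate at `x` with the observation `k` replaced by `x`. -/
def looDensity {n : ℕ} (a : ℝ) (θ : Fin n → ℝ) (k : Fin n) (w : Fin n → ℝ) (x : ℝ) : ℝ :=
  (1 / (n : ℝ)) * ∑ i, scaledKernel a (looArg θ k w x i)

/-- Estimate of the derivative of the density at `x` with the observation `k` replaced by `x`. -/
def looDeriv {n : ℕ} (a : ℝ) (θ : Fin n → ℝ) (k : Fin n) (w : Fin n → ℝ) (x : ℝ) : ℝ :=
  (1 / (n : ℝ)) * ∑ i, scaledKernelDeriv a (looArg θ k w x i)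

/-- The total second moment of a kernel at the observations. -/
def kernelEnergy {n : ℕ} (K : ℝ → ℝ) (θ : Fin n → ℝ) (x : ℝ) : ℝ :=
  ∑ i, ∫ z, K (x - θ i - z) ^ 2 ∂stdGauss

section
variable {n : ℕ} (θ : Fin n → ℝ) (k : Fin n) (x : ℝ)

lemma kernelEnergy_nonneg (K : ℝ → ℝ) : 0 ≤ kernelEnergy K θ x :=
  Finset.sum_nonneg fun _ _ => integral_nonneg fun _ => sq_nonneg _

lemma measurable_kernelEnergy {K : ℝ → ℝ} (hK : Continuous K) : Measurable (kernelEnergy K θ) := by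
  unfold kernelEnergy
  refine Finset.measurable_fun_sum _ fun i _ => ?_
  have : StronglyMeasurable fun p : ℝ × ℝ => K (p.1 - θ i - p.2) ^ 2 :=
    Continuous.stronglyMeasurable (by fun_prop)
  exact this.integral_prod_right.measurable

/-- Tonelli and translation invariance: each observation contributes ∫ K² ≤ cπ, wherever its mean
is. -/
lemma lintegral_kernelEnergy_le {K : ℝ → ℝ} (hK : Continuous K) {M : ℝ} (hM : ∀ v, |K v| ≤ M)
    {c : ℝ} (hc : 0 ≤ c) (hKc : ∀ v, K v ^ 2 ≤ c * (1 + v ^ 2)⁻¹) :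
    ∫⁻ x, ENNReal.ofReal (kernelEnergy K θ x) ≤ ENNReal.ofReal (n * (c * Real.pi)) := by
  have e1 : ∀ x, ENNReal.ofReal (kernelEnergy K θ x) =
      ∑ i, ∫⁻ z, ENNReal.ofReal (K (x - θ i - z) ^ 2) ∂stdGauss := fun x => by
    unfold kernelEnergy
    rw [ENNReal.ofReal_sum_of_nonneg fun i _ => integral_nonneg fun _ => sq_nonneg _]
    refine Finset.sum_congr rfl fun i _ => ?_
    refine ofReal_integral_eq_lintegral_ofReal ?_ (ae_of_all _ fun _ => sq_nonneg _)
    have hc : Continuous fun z => K (x - θ i - z) ^ 2 := by fun_prop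
    refine integrable_of_continuous_of_abs_le (C := M ^ 2) hc fun z => ?_
    rw [abs_pow]
    exact pow_le_pow_left₀ (abs_nonneg _) (hM _) 2
  have hm : ∀ i, Measurable (Function.uncurry
      fun x z => ENNReal.ofReal (K (x - θ i - z) ^ 2)) := fun i => by
    have : Continuous (Function.uncurry fun x z => K (x - θ i - z) ^ 2) := by fun_prop
    exact this.measurable.ennreal_ofReal
  simp_rw [e1]
  rw [lintegral_finsetSum (f := fun i x => ∫⁻ z, ENNReal.ofReal (K (x - θ i - z) ^ 2) ∂stdGauss) _
    fun i _ => (hm i).lintegral_prod_right]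
  have e2 : ∀ i, ∫⁻ x, ∫⁻ z, ENNReal.ofReal (K (x - θ i - z) ^ 2) ∂stdGauss ≤
      ENNReal.ofReal (c * Real.pi) := fun i => by
    rw [lintegral_lintegral_swap (hm i).aemeasurable]
    calc _ ≤ ∫⁻ _z, ENNReal.ofReal (c * Real.pi) ∂stdGauss := by
          refine lintegral_mono fun z => ?_
          simp_rw [sub_sub]
          rw [lintegral_sub_right_eq_self (fun x => ENNReal.ofReal (K x ^ 2)) (θ i + z),
            ← lintegral_inv_one_add_sq c hc]
          exact lintegral_mono fun v => ENNReal.ofReal_le_ofReal (hKc v)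
      _ = _ := by simp
  refine (Finset.sum_le_sum fun i _ => e2 i).trans (le_of_eq ?_)
  have := Real.pi_pos
  rw [← ENNReal.ofReal_sum_of_nonneg fun i _ => by positivity]
  simp

/-- Mean squared error of a leave-one-out kernel average. -/
lemma lintegral_sq_loo_sub_le {K : ℝ → ℝ} (hK : Continuous K) {M : ℝ} (hM : ∀ v, |K v| ≤ M)
    {y : Fin n → ℝ} {ε₁ ε₂ : ℝ} (h1 : ∀ i, |∫ z, K (x - θ i - z) ∂stdGauss - y i| ≤ ε₁)
    (h2 : |K 0 - y k| ≤ ε₂) (hε₁ : 0 ≤ ε₁) :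
    |(1 / (n : ℝ)) * ∑ i, ∫ z, K (if i = k then 0 else x - θ i - z) ∂stdGauss -
        (1 / (n : ℝ)) * ∑ i, y i| ≤ ε₁ + ε₂ / n ∧
    ∫⁻ w, ENNReal.ofReal (((1 / (n : ℝ)) * ∑ i, K (looArg θ k w x i)
        - (1 / (n : ℝ)) * ∑ i, y i) ^ 2) ∂blockNoise n ≤
      ENNReal.ofReal ((1 / (n : ℝ)) ^ 2 * kernelEnergy K θ x + (ε₁ + ε₂ / n) ^ 2) := by
  have hn : 0 < (n : ℝ) := by exact_mod_cast Fin.pos k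
  have hbias : |(1 / (n : ℝ)) * ∑ i, ∫ z, K (if i = k then 0 else x - θ i - z) ∂stdGauss -
        (1 / (n : ℝ)) * ∑ i, y i| ≤ ε₁ + ε₂ / n := by
    rw [← mul_sub, ← Finset.sum_sub_distrib, abs_mul, abs_of_pos (by positivity)]
    -- The index `k` enters through the constant K(0): it adds no variance, and its bias ε₂ is
    -- divided by `n` in the average.
    have : ∑ i, |∫ z, K (if i = k then 0 else x - θ i - z) ∂stdGauss - y i| ≤
        ∑ i, (ε₁ + if i = k then ε₂ else 0) := by
      refine Finset.sum_le_sum fun i _ => ?_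
      split_ifs with hi
      · subst hi
        simp only [integral_const, probReal_univ, smul_eq_mul, one_mul]
        linarith
      · rw [add_zero]; exact h1 i
    rw [Finset.sum_add_distrib] at this
    simp only [Finset.sum_const, Finset.card_univ, Fintype.card_fin, nsmul_eq_mul,
      Finset.sum_ite_eq', Finset.mem_univ, if_true] at this
    calc _ ≤ 1 / (n : ℝ) * (n * ε₁ + ε₂) := by
          gcongr
          exact (Finset.abs_sum_le_sum_abs _ _).trans this
      _ = _ := by field_simp
  refine ⟨hbias, ?_⟩
  have hmeas : ∀ i, Continuous fun z => K (if i = k then 0 else x - θ i - z) := fun i => by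
    split_ifs <;> fun_prop
  have := lintegral_sq_average_sub_le (n := n)
    (h := fun i z => K (if i = k then 0 else x - θ i - z)) (M := M)
    (v := fun i => ∫ z, K (x - θ i - z) ^ 2 ∂stdGauss) (fun i => (hmeas i).measurable)
    (fun i z => hM _) (fun i => ?_) hbias
  · exact this
  · split_ifs with hi
    · refine le_trans (le_of_eq ?_) (integral_nonneg fun _ => sq_nonneg _)
      simp [variance_eq_integral (measurable_const.aemeasurable)]
    · exact variance_le_expectation_sq (Continuous.aestronglyMeasurable (by fun_prop))

end

/-! ### Comparison of regularized ratios -/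

/-- Since max(ρ, ·) is 1-Lipschitz, adding and subtracting leaves the numerator errors over the
single denominator max(ρ, f). -/
lemma abs_div_max_sub_le {ρ f g f' g' A : ℝ} (hρ : 0 < ρ) (hA : 0 ≤ A)
    (hg : |g'| ≤ A * max ρ g) :
    |f' / max ρ f - g' / max ρ g| ≤ (|f' - g'| + A * |f - g|) / max ρ f := by
  have hM : 0 < max ρ f := lt_max_of_lt_left hρ
  have hN : 0 < max ρ g := lt_max_of_lt_left hρ
  have hMN : |max ρ g - max ρ f| ≤ |f - g| := by
    have := abs_max_sub_max_le_max ρ g ρ f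
    rw [abs_sub_comm f g]
    simpa using this
  set M := max ρ f
  set N := max ρ g
  have e : f' / M - g' / N = ((f' - g') + g' / N * (N - M)) / M := by
    field_simp
    ring
  rw [e, abs_div, abs_of_pos hM]
  gcongr
  refine (abs_add_le _ _).trans ?_
  rw [abs_mul]
  have : |g' / N| ≤ A := by
    rw [abs_div, abs_of_pos hN, div_le_iff₀ hN]; exact hg
  gcongr

/-- Trades the random denominator max(ρ, f) for the deterministic max(Lρ, g). Where g ≤ Lρ the
factor L/(Lρ) is just 1/ρ. Where g > Lρ, either f ≥ g/2, at the cost of a factor 2, or the density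
is badly underestimated and the crude bound D is paid. -/
lemma sq_div_max_sub_le {ρ f g f' g' A L D : ℝ} (hρ : 0 < ρ) (hA : 0 ≤ A) (hL : 1 ≤ L)
    (hg : |g'| ≤ A * max ρ g) (hD : |f'| / ρ + A ≤ D) :
    (f' / max ρ f - g' / max ρ g) ^ 2 ≤
      8 * ((f' - g') ^ 2 + A ^ 2 * (f - g) ^ 2) * (L / max (L * ρ) g) ^ 2 +
        if L * ρ < g ∧ f < g / 2 then D ^ 2 else 0 := by
  have hM : 0 < max ρ f := lt_max_of_lt_left hρ
  have hN : 0 < max ρ g := lt_max_of_lt_left hρ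
  have hLρ : 0 < L * ρ := by positivity
  have hmain : (f' / max ρ f - g' / max ρ g) ^ 2 ≤
      2 * ((f' - g') ^ 2 + A ^ 2 * (f - g) ^ 2) * (1 / max ρ f) ^ 2 := by
    rw [← sq_abs]
    calc _ ≤ ((|f' - g'| + A * |f - g|) / max ρ f) ^ 2 := by
          have := abs_div_max_sub_le (f := f) (f' := f') hρ hA hg
          gcongr
      _ = (|f' - g'| + A * |f - g|) ^ 2 * (1 / max ρ f) ^ 2 := by rw [div_eq_mul_one_div, mul_pow]
      _ ≤ _ := by
          gcongr
          have h1 := sq_abs (f' - g')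
          have h2 := sq_abs (f - g)
          nlinarith [sq_nonneg (|f' - g'| - A * |f - g|)]
  have hfin : ∀ c : ℝ, 0 ≤ c → (1 / max ρ f) ≤ 2 * (L / max (L * ρ) g) →
      (f' / max ρ f - g' / max ρ g) ^ 2 ≤
      8 * ((f' - g') ^ 2 + A ^ 2 * (f - g) ^ 2) * (L / max (L * ρ) g) ^ 2 + c := by
    intro c hc h
    calc _ ≤ 2 * ((f' - g') ^ 2 + A ^ 2 * (f - g) ^ 2) * (2 * (L / max (L * ρ) g)) ^ 2 :=
          hmain.trans (by gcongr)
      _ = 8 * ((f' - g') ^ 2 + A ^ 2 * (f - g) ^ 2) * (L / max (L * ρ) g) ^ 2 := by ring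
      _ ≤ _ := by linarith
  rcases le_or_gt g (L * ρ) with hgl | hgl
  · refine hfin _ (by split_ifs <;> positivity) ?_
    rw [max_eq_left hgl]
    have : L / (L * ρ) = 1 / ρ := by field_simp
    rw [this]
    have h1 : 1 / max ρ f ≤ 1 / ρ := one_div_le_one_div_of_le hρ (le_max_left _ _)
    have : 0 < 1 / ρ := by positivity
    linarith
  · rcases le_or_gt (g / 2) f with hf | hf
    · refine hfin _ (by split_ifs <;> positivity) ?_
      rw [max_eq_right hgl.le]
      have hg0 : 0 < g := hLρ.trans hgl
      have h1 : 1 / max ρ f ≤ 1 / (g / 2) :=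
        one_div_le_one_div_of_le (by positivity) (hf.trans (le_max_right _ _))
      refine h1.trans ?_
      rw [one_div_div, ← mul_div_assoc]
      gcongr
      linarith
    · rw [if_pos ⟨hgl, hf⟩]
      have h1 : |f' / max ρ f - g' / max ρ g| ≤ D := by
        refine (abs_sub _ _).trans (le_trans ?_ hD)
        rw [abs_div, abs_div, abs_of_pos hM, abs_of_pos hN]
        gcongr
        · exact le_max_left _ _
        · rw [div_le_iff₀ hN]; exact hg
      have h2 : (f' / max ρ f - g' / max ρ g) ^ 2 ≤ D ^ 2 := by
        rw [← sq_abs]; gcongr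
      have : 0 ≤ 8 * ((f' - g') ^ 2 + A ^ 2 * (f - g) ^ 2) * (L / max (L * ρ) g) ^ 2 := by
        positivity
      linarith

/-! ### Error of the leave-one-out rule -/

section
variable {n : ℕ} (θ : Fin n → ℝ)

@[fun_prop]
lemma continuous_looArg (k : Fin n) (i : Fin n) :
    Continuous fun p : (Fin n → ℝ) × ℝ => looArg θ k p.1 p.2 i := by
  unfold looArg
  split_ifs <;> fun_prop

lemma continuous_looDensity (a : ℝ) (k : Fin n) :
    Continuous fun p : (Fin n → ℝ) × ℝ => looDensity a θ k p.1 p.2 := by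
  unfold looDensity; fun_prop

lemma continuous_looDeriv (a : ℝ) (k : Fin n) :
    Continuous fun p : (Fin n → ℝ) × ℝ => looDeriv a θ k p.1 p.2 := by
  unfold looDeriv; fun_prop

lemma continuous_pair_const (x : ℝ) : Continuous fun w : Fin n → ℝ => (w, x) := by fun_prop

lemma continuous_looDensity_left (a : ℝ) (k : Fin n) (x : ℝ) :
    Continuous fun w => looDensity a θ k w x := by
  have := (continuous_looDensity θ a k).comp (continuous_pair_const x)
  exact this

lemma continuous_looDeriv_left (a : ℝ) (k : Fin n) (x : ℝ) :
    Continuous fun w => looDeriv a θ k w x := by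
  have := (continuous_looDeriv θ a k).comp (continuous_pair_const x)
  exact this

/-- The difference between the leave-one-out rule and the regularized Bayes rule. -/
def looError (a ρ : ℝ) (k : Fin n) (w : Fin n → ℝ) (x : ℝ) : ℝ :=
  looDeriv a θ k w x / max ρ (looDensity a θ k w x) - mixDeriv θ x / max ρ (mixPDF θ x)

lemma measurable_looError (a ρ : ℝ) (k : Fin n) :
    Measurable fun p : (Fin n → ℝ) × ℝ => looError θ a ρ k p.1 p.2 := by
  unfold looError
  have h1 := (continuous_looDeriv θ a k).measurable
  have h2 := (continuous_looDensity θ a k).measurable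
  fun_prop

lemma abs_average_le_of_abs_le {a : Fin n → ℝ} {c : ℝ} (hc : 0 ≤ c) (h : ∀ k, |a k| ≤ c) :
    |(1 / (n : ℝ)) * ∑ k, a k| ≤ c := by
  rcases Nat.eq_zero_or_pos n with rfl | hn
  · simpa using hc
  · have hn : 0 < (n : ℝ) := by exact_mod_cast hn
    rw [abs_mul, abs_of_pos (by positivity)]
    calc _ ≤ 1 / (n : ℝ) * ∑ _k : Fin n, c := by
          gcongr
          exact (Finset.abs_sum_le_sum_abs _ _).trans (Finset.sum_le_sum fun k _ => h k)
      _ = c := by simp; field_simp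

lemma measurable_looError_left (a ρ : ℝ) (k : Fin n) (x : ℝ) :
    Measurable fun w => looError θ a ρ k w x := by
  have := (measurable_looError θ a ρ k).comp (continuous_pair_const x).measurable
  exact this

/-- Hypotheses on the tuning constants of a block: `a` is the inverse bandwidth, `ρ` the
regularization level, `A` and `L` are truncation levels. -/
structure Tuning (n : ℕ) (a ρ A L : ℝ) : Prop where
  one_le_a : 1 ≤ a
  exp_a : Real.exp (-a ^ 2 / 2) ≤ 1 / n
  rho_pos : 0 < ρ
  A_nonneg : 0 ≤ A
  exp_A : Real.exp (-A ^ 2 / 4) ≤ ρ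
  one_le_L : 1 ≤ L
  bias_le : 4 * a / n ≤ L * ρ / 4

variable {θ} {a ρ A L : ℝ}

lemma Tuning.abs_mixDeriv_le_mul_max [NeZero n] (h : Tuning n a ρ A L) (x : ℝ) :
    |mixDeriv θ x| ≤ (A + 1) * max ρ (mixPDF θ x) := by
  have h1 := abs_mixDeriv_le θ x A h.A_nonneg
  have h2 := h.exp_A
  have h3 : A * mixPDF θ x ≤ A * max ρ (mixPDF θ x) :=
    mul_le_mul_of_nonneg_left (le_max_right _ _) h.A_nonneg
  have h4 := le_max_left ρ (mixPDF θ x)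
  linarith

lemma Tuning.loo_mse [NeZero n] (h : Tuning n a ρ A L) (k : Fin n) (x : ℝ) :
    |(1 / (n : ℝ)) * ∑ i, ∫ z, scaledKernel a (if i = k then 0 else x - θ i - z) ∂stdGauss -
        mixPDF θ x| ≤ 4 * a / n ∧
    ∫⁻ w, ENNReal.ofReal ((looDensity a θ k w x - mixPDF θ x) ^ 2) ∂blockNoise n ≤
      ENNReal.ofReal ((1 / (n : ℝ)) ^ 2 * kernelEnergy (scaledKernel a) θ x + (4 * a / n) ^ 2) ∧
    ∫⁻ w, ENNReal.ofReal ((looDeriv a θ k w x - mixDeriv θ x) ^ 2) ∂blockNoise n ≤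
      ENNReal.ofReal
        ((1 / (n : ℝ)) ^ 2 * kernelEnergy (scaledKernelDeriv a) θ x + (4 * a / n) ^ 2) := by
  have hn : 0 < (n : ℝ) := by exact_mod_cast NeZero.pos n
  have ha := h.one_le_a
  -- The Fourier bias is at most 1/n; the leave-one-out bias is at most 2a/n, both for the kernel (a
  -- + 1/2 ≤ 2a) and for its derivative, which vanishes at 0.
  have hle : 1 / (n : ℝ) + (2 * a) / n ≤ 4 * a / n := by
    rw [← add_div]; gcongr; linarith
  obtain ⟨h1, h2⟩ := lintegral_sq_loo_sub_le θ k x (continuous_scaledKernel a)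
    (abs_scaledKernel_le (by linarith : 0 ≤ a)) (y := fun i => npdf (x - θ i))
    (ε₁ := 1 / n) (ε₂ := 2 * a)
    (fun i => (abs_integral_scaledKernel_sub_le ha _).trans h.exp_a) (by
      refine (abs_sub _ _).trans ?_
      have := abs_scaledKernel_le (by linarith : 0 ≤ a) 0
      have := npdf_le_half (x - θ k)
      rw [abs_of_pos (npdf_pos _)]
      linarith) (by positivity)
  obtain ⟨-, h3⟩ := lintegral_sq_loo_sub_le θ k x (continuous_scaledKernelDeriv a)
    (abs_scaledKernelDeriv_le (by linarith : 0 ≤ a))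
    (y := fun i => -((x - θ i) * npdf (x - θ i)))
    (ε₁ := 1 / n) (ε₂ := 2 * a)
    (fun i => (abs_integral_scaledKernelDeriv_sub_le ha _).trans h.exp_a) (by
      rw [scaledKernelDeriv_zero, zero_sub, neg_neg, abs_mul, abs_of_pos (npdf_pos _)]
      -- With A = 0 the bound reads |u| φ(u) ≤ 1.
      have := abs_mul_npdf_le (x - θ k) 0 le_rfl
      simp at this
      linarith) (by positivity)
  unfold looDensity looDeriv mixPDF mixDeriv
  refine ⟨h1.trans hle, h2.trans ?_, h3.trans ?_⟩ <;>
  · apply ENNReal.ofReal_le_ofReal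
    gcongr

/-- Falling below g/2 is a deviation of more than Lρ/2 from g. The bias accounts for at most Lρ/4 of
it, and Hoeffding with bound a handles the remaining Lρ/4. -/
lemma Tuning.measure_looDensity_lt_le [NeZero n] (h : Tuning n a ρ A L) (k : Fin n) (x : ℝ)
    (hx : L * ρ < mixPDF θ x) :
    blockNoise n {w | looDensity a θ k w x < mixPDF θ x / 2} ≤
      ENNReal.ofReal (Real.exp (-(n * (L * ρ) ^ 2) / (32 * a ^ 2))) := by
  have hn : 0 < (n : ℝ) := by exact_mod_cast NeZero.pos n
  have ha := h.one_le_a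
  have hLρ : 0 < L * ρ := mul_pos (by linarith [h.one_le_L]) h.rho_pos
  have hcont : ∀ i, Continuous fun z => scaledKernel a (if i = k then 0 else x - θ i - z) :=
    fun i => by split_ifs <;> fun_prop
  have := measure_sum_sub_le_neg_le (n := n) (M := a) (t := n * (L * ρ) / 4)
    (h := fun i z => scaledKernel a (if i = k then 0 else x - θ i - z))
    (fun i => (hcont i).measurable) (fun i z => abs_scaledKernel_le (by linarith) _)
    (by positivity)
  refine (measure_mono fun w hw => ?_).trans (this.trans (ENNReal.ofReal_le_ofReal ?_))
  · have hw' : looDensity a θ k w x < mixPDF θ x / 2 := hw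
    change ∑ i, (scaledKernel a (looArg θ k w x i) -
      ∫ z, scaledKernel a (if i = k then 0 else x - θ i - z) ∂stdGauss) ≤ -(n * (L * ρ) / 4)
    have hb := (abs_le.1 (h.loo_mse (θ := θ) k x).1).1
    have hb2 := h.bias_le
    rw [Finset.sum_sub_distrib]
    have e1 : ∑ i, scaledKernel a (looArg θ k w x i) = n * looDensity a θ k w x := by
      unfold looDensity; field_simp
    set S := ∑ i, ∫ z, scaledKernel a (if i = k then 0 else x - θ i - z) ∂stdGauss
    have e2 : S = n * (1 / n * S) := by field_simp
    rw [e1, e2, ← mul_sub]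
    have : looDensity a θ k w x - 1 / n * S ≤ -(L * ρ / 4) := by linarith
    calc _ ≤ (n : ℝ) * -(L * ρ / 4) := by gcongr
      _ = _ := by ring
  · apply Real.exp_le_exp.2
    apply le_of_eq
    field_simp
    ring

/-- Mean squared error at a fixed point. -/
lemma Tuning.lintegral_sq_looError_le [NeZero n] (h : Tuning n a ρ A L) (k : Fin n) (x : ℝ)
    {m D P : ℝ} (hm : m = (L / max (L * ρ) (mixPDF θ x)) ^ 2) (hD : D = a ^ 2 / ρ + (A + 1))
    (hP : P = Real.exp (-(n * (L * ρ) ^ 2) / (32 * a ^ 2))) :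
    ∫⁻ w, ENNReal.ofReal (looError θ a ρ k w x ^ 2) ∂blockNoise n ≤
      ENNReal.ofReal (8 * ((1 / (n : ℝ)) ^ 2 * (kernelEnergy (scaledKernelDeriv a) θ x
          + (A + 1) ^ 2 * kernelEnergy (scaledKernel a) θ x)
          + (1 + (A + 1) ^ 2) * (4 * a / n) ^ 2) * m
        + D ^ 2 * P) := by
  have hn : 0 < (n : ℝ) := by exact_mod_cast NeZero.pos n
  have ha := h.one_le_a
  have hρ := h.rho_pos
  have hA := h.A_nonneg
  obtain ⟨-, hm0, hm1⟩ := h.loo_mse (θ := θ) k x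
  have hm0' : 0 ≤ m := by rw [hm]; positivity
  have hD0 : 0 ≤ D := by rw [hD]; positivity
  have hP0 : 0 < P := by rw [hP]; exact Real.exp_pos _
  -- The deterministic condition makes the event empty at points of low density, where the Hoeffding
  -- bound is not available.
  let E : Set (Fin n → ℝ) := {w | L * ρ < mixPDF θ x ∧ looDensity a θ k w x < mixPDF θ x / 2}
  have hc0 := continuous_looDensity_left θ a k x
  have hc1 := continuous_looDeriv_left θ a k x
  have hEm : MeasurableSet E :=
    (MeasurableSet.const _).inter (measurableSet_lt hc0.measurable measurable_const)
  have hE : blockNoise n E ≤ ENNReal.ofReal P := by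
    by_cases hx : L * ρ < mixPDF θ x
    · exact (measure_mono fun w hw => hw.2).trans (hP ▸ h.measure_looDensity_lt_le k x hx)
    · have : E = ∅ := Set.eq_empty_of_forall_notMem fun w hw => hx hw.1
      simp [this]
  have hpt : ∀ w, ENNReal.ofReal (looError θ a ρ k w x ^ 2) ≤
      ENNReal.ofReal (8 * m) * ENNReal.ofReal ((looDeriv a θ k w x - mixDeriv θ x) ^ 2) +
      ENNReal.ofReal (8 * m * (A + 1) ^ 2) *
        ENNReal.ofReal ((looDensity a θ k w x - mixPDF θ x) ^ 2) +
      E.indicator (fun _ => ENNReal.ofReal (D ^ 2)) w := by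
    intro w
    have h1 := sq_div_max_sub_le (f := looDensity a θ k w x) (f' := looDeriv a θ k w x)
      (g := mixPDF θ x) (g' := mixDeriv θ x) (D := D) hρ (by linarith : 0 ≤ A + 1) h.one_le_L
      (h.abs_mixDeriv_le_mul_max x) (by
        have : |looDeriv a θ k w x| ≤ a ^ 2 := abs_average_le_of_abs_le (by positivity)
          fun i => abs_scaledKernelDeriv_le (by linarith) _
        rw [hD]
        gcongr)
    have e : E.indicator (fun _ => ENNReal.ofReal (D ^ 2)) w =
        ENNReal.ofReal (if L * ρ < mixPDF θ x ∧ looDensity a θ k w x < mixPDF θ x / 2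
          then D ^ 2 else 0) := by
      by_cases hw : w ∈ E
      · rw [Set.indicator_of_mem hw, if_pos (show _ ∧ _ from hw)]
      · rw [Set.indicator_of_notMem hw, if_neg (show ¬(_ ∧ _) from hw), ENNReal.ofReal_zero]
    rw [e, ← ENNReal.ofReal_mul (by positivity), ← ENNReal.ofReal_mul (by positivity),
      ← ENNReal.ofReal_add (by positivity) (by positivity),
      ← ENNReal.ofReal_add (by positivity) (by split_ifs <;> positivity)]
    apply ENNReal.ofReal_le_ofReal
    unfold looError
    rw [← hm] at h1
    refine h1.trans (le_of_eq ?_)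
    ring
  have hc0' := hc0.measurable
  have hc1' := hc1.measurable
  refine (lintegral_mono hpt).trans ?_
  rw [lintegral_add_left (by fun_prop), lintegral_add_left (by fun_prop),
    lintegral_const_mul _ (by fun_prop), lintegral_const_mul _ (by fun_prop),
    lintegral_indicator_const hEm]
  calc _ ≤ ENNReal.ofReal (8 * m) * ENNReal.ofReal
          ((1 / (n : ℝ)) ^ 2 * kernelEnergy (scaledKernelDeriv a) θ x + (4 * a / n) ^ 2) +
        ENNReal.ofReal (8 * m * (A + 1) ^ 2) * ENNReal.ofReal
          ((1 / (n : ℝ)) ^ 2 * kernelEnergy (scaledKernel a) θ x + (4 * a / n) ^ 2) +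
        ENNReal.ofReal (D ^ 2) * ENNReal.ofReal P := by
        gcongr
    _ = _ := by
        have := kernelEnergy_nonneg θ x (scaledKernel a)
        have := kernelEnergy_nonneg θ x (scaledKernelDeriv a)
        rw [← ENNReal.ofReal_mul (by positivity), ← ENNReal.ofReal_mul (by positivity),
          ← ENNReal.ofReal_mul (by positivity), ← ENNReal.ofReal_add (by positivity)
          (by positivity), ← ENNReal.ofReal_add (by positivity) (by positivity)]
        congr 1
        ring

/-- Total squared error of the leave-one-out rules. -/
theorem Tuning.sum_lintegral_sq_looError_le [NeZero n] (h : Tuning n a ρ A L)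
    {P : ℝ} (hP : P = Real.exp (-(n * (L * ρ) ^ 2) / (32 * a ^ 2))) :
    ∑ k, ∫⁻ w, ∫⁻ z, ENNReal.ofReal (looError θ a ρ k w (θ k + z) ^ 2) ∂stdGauss ∂blockNoise n ≤
      ENNReal.ofReal (8 * L / ρ * (8 * (a ^ 4 + (A + 1) ^ 2 * a ^ 2))
        + n * (8 * (1 + (A + 1) ^ 2) * (4 * a / n) ^ 2 / ρ ^ 2
        + (a ^ 2 / ρ + (A + 1)) ^ 2 * P)) := by
  have hn : 0 < (n : ℝ) := by exact_mod_cast NeZero.pos n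
  have ha := h.one_le_a
  have hρ := h.rho_pos
  have hA := h.A_nonneg
  have hL := h.one_le_L
  have hLρ : 0 < L * ρ := by positivity
  have hpi := Real.pi_pos
  have hP0 : 0 < P := by rw [hP]; exact Real.exp_pos _
  obtain ⟨V1, hV1e⟩ : ∃ V, V = kernelEnergy (scaledKernelDeriv a) θ := ⟨_, rfl⟩
  obtain ⟨V0, hV0e⟩ : ∃ V, V = kernelEnergy (scaledKernel a) θ := ⟨_, rfl⟩
  have hV1 : ∀ x, 0 ≤ V1 x := fun x => by subst hV1e hV0e; exact kernelEnergy_nonneg θ x _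
  have hV0 : ∀ x, 0 ≤ V0 x := fun x => by subst hV1e hV0e; exact kernelEnergy_nonneg θ x _
  have hV1m : Measurable V1 := by
    subst hV1e hV0e; exact measurable_kernelEnergy θ (by fun_prop)
  have hV0m : Measurable V0 := by
    subst hV1e hV0e; exact measurable_kernelEnergy θ (by fun_prop)
  have hV1i : ∫⁻ x, ENNReal.ofReal (V1 x) ≤ ENNReal.ofReal (n * (2 * (a ^ 2) ^ 2 * Real.pi)) := by
    subst hV1e hV0e
    exact lintegral_kernelEnergy_le θ (by fun_prop) (abs_scaledKernelDeriv_le (by linarith))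
      (by positivity) (sq_scaledKernelDeriv_le ha)
  have hV0i : ∫⁻ x, ENNReal.ofReal (V0 x) ≤ ENNReal.ofReal (n * (2 * a ^ 2 * Real.pi)) := by
    subst hV1e hV0e
    exact lintegral_kernelEnergy_le θ (by fun_prop) (abs_scaledKernel_le (by linarith))
      (by positivity) (sq_scaledKernel_le ha)
  obtain ⟨Q, hQ⟩ : ∃ Q, Q = 8 * (1 + (A + 1) ^ 2) * (4 * a / n) ^ 2 / ρ ^ 2
    + (a ^ 2 / ρ + (A + 1)) ^ 2 * P := ⟨_, rfl⟩
  have hQ0 : 0 ≤ Q := by rw [hQ]; positivity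
  obtain ⟨c, hc⟩ : ∃ c, c = 8 * L / (n * ρ) := ⟨_, rfl⟩
  have hc0 : 0 ≤ c := by rw [hc]; positivity
  rw [← hQ]
  -- Tonelli moves the error at a fixed x inside. Its bound does not depend on `k`, so the weights
  -- φ(x - θ_k) then add up to n g(x).
  have step : ∀ k, ∫⁻ w, ∫⁻ z, ENNReal.ofReal (looError θ a ρ k w (θ k + z) ^ 2)
      ∂stdGauss ∂blockNoise n = ∫⁻ x, ENNReal.ofReal (npdf (x - θ k)) *
        ∫⁻ w, ENNReal.ofReal (looError θ a ρ k w x ^ 2) ∂blockNoise n := by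
    intro k
    have hm := measurable_looError θ a ρ k
    have hm' : Measurable (Function.uncurry fun (w : Fin n → ℝ) x =>
        ENNReal.ofReal (npdf (x - θ k)) * ENNReal.ofReal (looError θ a ρ k w x ^ 2)) := by
      unfold Function.uncurry
      fun_prop
    calc _ = ∫⁻ w, (∫⁻ x, ENNReal.ofReal (npdf (x - θ k)) *
          ENNReal.ofReal (looError θ a ρ k w x ^ 2)) ∂blockNoise n :=
          lintegral_congr fun w => lintegral_stdGauss_shift
            (fun x => ENNReal.ofReal (looError θ a ρ k w x ^ 2)) (θ k)
      _ = _ := by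
          rw [lintegral_lintegral_swap hm'.aemeasurable]
          refine lintegral_congr fun x => ?_
          have hmx := measurable_looError_left θ a ρ k x
          rw [lintegral_const_mul _ (by fun_prop)]
  simp_rw [step]
  calc _ ≤ ∑ k, ∫⁻ x, ENNReal.ofReal (npdf (x - θ k)) * ENNReal.ofReal
          (8 * ((1 / (n : ℝ)) ^ 2 * (V1 x + (A + 1) ^ 2 * V0 x)
          + (1 + (A + 1) ^ 2) * (4 * a / n) ^ 2) * (L / max (L * ρ) (mixPDF θ x)) ^ 2
        + (a ^ 2 / ρ + (A + 1)) ^ 2 * P) := by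
        gcongr with k _ x
        subst hV1e hV0e
        exact h.lintegral_sq_looError_le k x rfl rfl hP
    _ = ∫⁻ x, ENNReal.ofReal (n * mixPDF θ x * 
          (8 * ((1 / (n : ℝ)) ^ 2 * (V1 x + (A + 1) ^ 2 * V0 x)
          + (1 + (A + 1) ^ 2) * (4 * a / n) ^ 2) * (L / max (L * ρ) (mixPDF θ x)) ^ 2
        + (a ^ 2 / ρ + (A + 1)) ^ 2 * P)) := by
        rw [← lintegral_finsetSum _ fun k _ => by fun_prop]
        refine lintegral_congr fun x => ?_
        rw [← Finset.sum_mul, ← ENNReal.ofReal_sum_of_nonneg fun k _ => npdf_nonneg _,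
          sum_npdf_eq, ENNReal.ofReal_mul (p := n * mixPDF θ x) (by have := mixPDF_pos θ x; positivity)]
    _ ≤ ∫⁻ x, (ENNReal.ofReal c * ENNReal.ofReal (V1 x)
          + ENNReal.ofReal (c * (A + 1) ^ 2) * ENNReal.ofReal (V0 x)
          + ENNReal.ofReal Q * ENNReal.ofReal (n * mixPDF θ x)) := by
        refine lintegral_mono fun x => ?_
        have hg := mixPDF_pos θ x
        rw [← ENNReal.ofReal_mul hc0, ← ENNReal.ofReal_mul (by positivity),
          ← ENNReal.ofReal_mul hQ0, ← ENNReal.ofReal_add (mul_nonneg hc0 (hV1 x))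
            (mul_nonneg (by positivity) (hV0 x)), ← ENNReal.ofReal_add
            (add_nonneg (mul_nonneg hc0 (hV1 x)) (mul_nonneg (by positivity) (hV0 x)))
            (by positivity)]
        apply ENNReal.ofReal_le_ofReal
        generalize mixPDF θ x = g at hg ⊢
        obtain ⟨m, hm⟩ : ∃ m, m = (L / max (L * ρ) g) ^ 2 := ⟨_, rfl⟩
        rw [← hm]
        have hmax1 : L * ρ ≤ max (L * ρ) g := le_max_left _ _
        have hmax2 : g ≤ max (L * ρ) g := le_max_right _ _
        have hmax0 : 0 < max (L * ρ) g := hLρ.trans_le hmax1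
        -- This is the gain over the trivial bound 1/ρ² on m: the density weight cancels one power
        -- of 1/ρ, so the variance term costs L/ρ, of order √n, against the integrable kernel
        -- energy.
        have hgm : g * m ≤ L / ρ := by
          rw [hm, div_pow, ← mul_div_assoc, div_le_div_iff₀ (by positivity) hρ]
          nlinarith [mul_le_mul hmax2 hmax1 hLρ.le hmax0.le]
        have hm1 : m ≤ 1 / ρ ^ 2 := by
          rw [hm, div_pow, div_le_div_iff₀ (by positivity) (by positivity), one_mul, ← mul_pow]
          gcongr
        have h1 : 0 ≤ V1 x + (A + 1) ^ 2 * V0 x :=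
          add_nonneg (hV1 x) (mul_nonneg (by positivity) (hV0 x))
        calc _ = (8 / n * (V1 x + (A + 1) ^ 2 * V0 x)) * (g * m) +
              (n * g) * (8 * (1 + (A + 1) ^ 2) * (4 * a / n) ^ 2 * m
                + (a ^ 2 / ρ + (A + 1)) ^ 2 * P) := by field_simp; ring
          _ ≤ (8 / n * (V1 x + (A + 1) ^ 2 * V0 x)) * (L / ρ) +
              (n * g) * (8 * (1 + (A + 1) ^ 2) * (4 * a / n) ^ 2 * (1 / ρ ^ 2)
                + (a ^ 2 / ρ + (A + 1)) ^ 2 * P) := by gcongr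
          _ = _ := by rw [hc, hQ]; field_simp
    _ ≤ ENNReal.ofReal c * ENNReal.ofReal (n * (2 * (a ^ 2) ^ 2 * Real.pi)) +
        ENNReal.ofReal (c * (A + 1) ^ 2) * ENNReal.ofReal (n * (2 * a ^ 2 * Real.pi)) +
        ENNReal.ofReal Q * ENNReal.ofReal n := by
        rw [lintegral_add_left (by fun_prop), lintegral_add_left (by fun_prop),
          lintegral_const_mul _ (by fun_prop), lintegral_const_mul _ (by fun_prop),
          lintegral_const_mul _ (by fun_prop), lintegral_mixPDF]
        gcongr
        simp
    _ ≤ _ := by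
        rw [← ENNReal.ofReal_mul hc0, ← ENNReal.ofReal_mul (by positivity),
          ← ENNReal.ofReal_mul hQ0, ← ENNReal.ofReal_add (by positivity) (by positivity),
          ← ENNReal.ofReal_add (by positivity) (by positivity)]
        apply ENNReal.ofReal_le_ofReal
        have hpi4 := Real.pi_lt_four
        have e : c * (n * (2 * (a ^ 2) ^ 2 * Real.pi)) +
            c * (A + 1) ^ 2 * (n * (2 * a ^ 2 * Real.pi)) =
            8 * L / ρ * (2 * Real.pi * (a ^ 4 + (A + 1) ^ 2 * a ^ 2)) := by
          rw [hc]; field_simp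
        rw [e, mul_comm Q]
        gcongr
        linarith

end

/-! ### The empirical Bayes rule at the observations -/

section
variable {n : ℕ} (θ : Fin n → ℝ)

lemma hasDerivAt_densityEst (x : Fin n → ℝ) (u : ℝ) :
    HasDerivAt (densityEst x)
      ((1 / (n : ℝ)) * ∑ k, scaledKernelDeriv (√(2 * Real.log n)) (u - x k)) u := by
  have : densityEst x = fun u => (1 / (n : ℝ)) *
      ∑ k, scaledKernel (√(2 * Real.log n)) (u - x k) := rfl
  rw [this]
  refine HasDerivAt.const_mul _ (HasDerivAt.fun_sum fun k _ => ?_)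
  simpa using (hasDerivAt_scaledKernel (√(2 * Real.log n)) (u - x k)).comp_sub_const u (x k)

/-- At x = X_k the own argument X_k - X_k is already 0, so the leave-one-out convention changes
nothing there, and observation `k` enters through x alone. -/
lemma looArg_at_observation (k : Fin n) (w : Fin n → ℝ) (i : Fin n) :
    looArg θ k w (θ k + w k) i = (θ k + w k) - (θ i + w i) := by
  unfold looArg
  split_ifs with h
  · subst h; ring
  · ring

lemma densityEst_at_observation (k : Fin n) (w : Fin n → ℝ) :
    densityEst (fun i => θ i + w i) (θ k + w k) =
      looDensity (√(2 * Real.log n)) θ k w (θ k + w k) := by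
  unfold looDensity
  simp_rw [looArg_at_observation]
  rfl

lemma deriv_densityEst_at_observation (k : Fin n) (w : Fin n → ℝ) :
    deriv (densityEst fun i => θ i + w i) (θ k + w k) =
      looDeriv (√(2 * Real.log n)) θ k w (θ k + w k) := by
  rw [(hasDerivAt_densityEst _ _).deriv]
  unfold looDeriv
  simp_rw [looArg_at_observation]

/-- The error of the regularized empirical Bayes rule at the coordinate `k`. -/
def ebError (a ρ : ℝ) (k : Fin n) (w : Fin n → ℝ) : ℝ :=
  w k + looDeriv a θ k w (θ k + w k) / max ρ (looDensity a θ k w (θ k + w k))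

lemma measurable_ebError (a ρ : ℝ) (k : Fin n) : Measurable (ebError θ a ρ k) := by
  have hp : Measurable fun w : Fin n → ℝ => (w, θ k + w k) := by fun_prop
  have h1 := (continuous_looDeriv θ a k).measurable.comp hp
  have h2 := (continuous_looDensity θ a k).measurable.comp hp
  simp only [Function.comp_def] at h1 h2
  unfold ebError
  fun_prop

lemma ebError_eq (a ρ : ℝ) (k : Fin n) (w : Fin n → ℝ) :
    ebError θ a ρ k w =
      (regRule ρ θ (θ k + w k) - θ k) + looError θ a ρ k w (θ k + w k) := by
  unfold ebError regRule looError
  ring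

lemma looError_update (a ρ : ℝ) (k : Fin n) (w : Fin n → ℝ) (z x : ℝ) :
    looError θ a ρ k (Function.update w k z) x = looError θ a ρ k w x := by
  have : ∀ i, looArg θ k (Function.update w k z) x i = looArg θ k w x i := fun i => by
    unfold looArg
    split_ifs with h
    · rfl
    · rw [Function.update_of_ne h]
  unfold looError looDeriv looDensity
  simp_rw [this]

/-- The total risk of the regularized empirical Bayes rule. -/
def ebRisk (a ρ : ℝ) : ℝ≥0∞ :=
  ∑ k, ∫⁻ w, ENNReal.ofReal (ebError θ a ρ k w ^ 2) ∂blockNoise n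

/-- Uses (u + v)² ≤ (1 + s) u² + (1 + 1/s) v² with s still free. Since `looError` ignores coordinate
`k` of the noise, that coordinate can be replaced by an independent copy z. -/
lemma ebRisk_le (a ρ : ℝ) {s : ℝ} (hs : 0 < s) :
    ebRisk θ a ρ ≤ ENNReal.ofReal (1 + s) * ruleRisk θ (regRule ρ θ) +
      ENNReal.ofReal (1 + 1 / s) * ∑ k, ∫⁻ w, ∫⁻ z,
        ENNReal.ofReal (looError θ a ρ k w (θ k + z) ^ 2) ∂stdGauss ∂blockNoise n := by
  unfold ebRisk ruleRisk
  rw [Finset.mul_sum, Finset.mul_sum, ← Finset.sum_add_distrib]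
  refine Finset.sum_le_sum fun k _ => ?_
  have hp : Measurable fun w : Fin n → ℝ => (w, θ k + w k) := by fun_prop
  have hm1 : Measurable fun w : Fin n → ℝ =>
      ENNReal.ofReal (looError θ a ρ k w (θ k + w k) ^ 2) := by
    have := (measurable_looError θ a ρ k).comp hp
    simp only [Function.comp_def] at this
    fun_prop
  have hm2 : Measurable fun z : ℝ => ENNReal.ofReal ((regRule ρ θ (θ k + z) - θ k) ^ 2) := by
    fun_prop
  have e1 : ∫⁻ w, ENNReal.ofReal (looError θ a ρ k w (θ k + w k) ^ 2) ∂blockNoise n =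
      ∫⁻ w, ∫⁻ z, ENNReal.ofReal (looError θ a ρ k w (θ k + z) ^ 2) ∂stdGauss ∂blockNoise n := by
    rw [lintegral_blockNoise_update k hm1]
    simp only [looError_update, Function.update_self]
  rw [← e1, ← lintegral_blockNoise_eval k hm2, ← lintegral_const_mul _ hm1,
    ← lintegral_const_mul _ (by fun_prop), ← lintegral_add_right _ (by fun_prop)]
  refine lintegral_mono fun w => ?_
  rw [← ENNReal.ofReal_mul (by positivity), ← ENNReal.ofReal_mul (by positivity),
    ← ENNReal.ofReal_add (by positivity) (by positivity), ebError_eq]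
  apply ENNReal.ofReal_le_ofReal
  generalize regRule ρ θ (θ k + w k) - θ k = u
  generalize looError θ a ρ k w (θ k + w k) = v
  have : (1 + s) * u ^ 2 + (1 + 1 / s) * v ^ 2 - (u + v) ^ 2 = (s * u - v) ^ 2 / s := by
    field_simp
    ring
  have : 0 ≤ (s * u - v) ^ 2 / s := by positivity
  linarith

lemma sq_ebError_le {a ρ : ℝ} (ha : 0 ≤ a) (hρ : 0 < ρ) (k : Fin n) (w : Fin n → ℝ) :
    ebError θ a ρ k w ^ 2 ≤ 2 * w k ^ 2 + 2 * (a ^ 2 / ρ) ^ 2 := by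
  unfold ebError
  have h1 : |looDeriv a θ k w (θ k + w k)| ≤ a ^ 2 := abs_average_le_of_abs_le (by positivity)
    fun i => abs_scaledKernelDeriv_le ha _
  have h2 : |looDeriv a θ k w (θ k + w k) / max ρ (looDensity a θ k w (θ k + w k))| ≤
      a ^ 2 / ρ := by
    rw [abs_div, abs_of_pos (lt_max_of_lt_left hρ : 0 < max ρ _)]
    gcongr
    exact le_max_left _ _
  generalize looDeriv a θ k w (θ k + w k) / max ρ (looDensity a θ k w (θ k + w k)) = v at h2 ⊢
  have h3 : v ^ 2 ≤ (a ^ 2 / ρ) ^ 2 := by rw [← sq_abs v]; gcongr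
  nlinarith [sq_nonneg (w k - v)]

/-! ### The switching statistic -/

lemma kappaEst_sub_sparsity [NeZero n] (w : Fin n → ℝ) :
    ∑ i, (√2 * Real.exp (-(θ i + w i) ^ 2 / 2) -
      ∫ z, √2 * Real.exp (-(θ i + z) ^ 2 / 2) ∂stdGauss) =
      n * (sparsity θ - kappaEst fun i => θ i + w i) := by
  have hn : (n : ℝ) ≠ 0 := by exact_mod_cast NeZero.ne n
  simp_rw [integral_sqrt_two_mul_exp]
  unfold sparsity kappaEst
  rw [Finset.sum_sub_distrib, Finset.sum_sub_distrib, ← Finset.mul_sum]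
  simp only [Finset.sum_const, Finset.card_univ, Fintype.card_fin, nsmul_eq_mul]
  field_simp
  ring

lemma abs_sqrt_two_mul_exp_le (c z : ℝ) : |√2 * Real.exp (-(c + z) ^ 2 / 2)| ≤ √2 := by
  rw [abs_of_nonneg (by positivity)]
  exact mul_le_of_le_one_right (by positivity)
    (Real.exp_le_one_iff.2 (by nlinarith [sq_nonneg (c + z)]))

/-- Hoeffding for summands bounded by √2. The gap is b here and b/2 for the opposite error; the
constant 16 is the one the smaller gap requires. -/
lemma measure_kappaEst_le_le [NeZero n] {b : ℝ} (hb : 0 ≤ b) (h : 2 * b ≤ sparsity θ) :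
    blockNoise n {w | kappaEst (fun i => θ i + w i) ≤ b} ≤
      ENNReal.ofReal (Real.exp (-(n * b ^ 2) / 16)) := by
  have hn : 0 < (n : ℝ) := by exact_mod_cast NeZero.pos n
  have := measure_sum_sub_ge_le (n := n) (M := √2) (t := n * b)
    (h := fun i z => √2 * Real.exp (-(θ i + z) ^ 2 / 2)) (fun i => by fun_prop)
    (fun i z => abs_sqrt_two_mul_exp_le _ _) (by positivity)
  refine (measure_mono fun w hw => ?_).trans (this.trans (ENNReal.ofReal_le_ofReal ?_))
  · have hw' : kappaEst (fun i => θ i + w i) ≤ b := hw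
    change n * b ≤ ∑ i, _
    rw [kappaEst_sub_sparsity]
    gcongr
    linarith
  · apply Real.exp_le_exp.2
    rw [Real.sq_sqrt (by norm_num), mul_pow, neg_div, neg_div, neg_le_neg_iff,
      div_le_div_iff₀ (by positivity) (by positivity)]
    have : 0 ≤ (n : ℝ) ^ 2 * b ^ 2 := by positivity
    nlinarith

lemma measure_lt_kappaEst_le [NeZero n] {b : ℝ} (hb : 0 ≤ b) (h : sparsity θ ≤ b / 2) :
    blockNoise n {w | b < kappaEst (fun i => θ i + w i)} ≤
      ENNReal.ofReal (Real.exp (-(n * b ^ 2) / 16)) := by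
  have hn : 0 < (n : ℝ) := by exact_mod_cast NeZero.pos n
  have := measure_sum_sub_le_neg_le (n := n) (M := √2) (t := n * b / 2)
    (h := fun i z => √2 * Real.exp (-(θ i + z) ^ 2 / 2)) (fun i => by fun_prop)
    (fun i z => abs_sqrt_two_mul_exp_le _ _) (by positivity)
  refine (measure_mono fun w hw => ?_).trans (this.trans (ENNReal.ofReal_le_ofReal ?_))
  · have hw' : b < kappaEst (fun i => θ i + w i) := hw
    change ∑ i, _ ≤ -(n * b / 2)
    rw [kappaEst_sub_sparsity]
    have : sparsity θ - kappaEst (fun i => θ i + w i) ≤ -(b / 2) := by linarith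
    calc _ ≤ (n : ℝ) * -(b / 2) := by gcongr
      _ = _ := by ring
  · apply Real.exp_le_exp.2
    apply le_of_eq
    rw [Real.sq_sqrt (by norm_num)]
    field_simp
    ring

lemma measurable_kappaEst : Measurable fun w : Fin n → ℝ => kappaEst fun i => θ i + w i := by
  unfold kappaEst
  fun_prop

/-- The fourth moment of the standard normal law. -/
def fourthMoment : ℝ := (∫⁻ z, ENNReal.ofReal (z ^ 4) ∂stdGauss).toReal

/-- On an event of probability at most t², the bound 2w² ≤ t w⁴ + 1/t turns rarity and a finite
fourth moment into a contribution of order t. -/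
lemma setLIntegral_sq_le (k : Fin n) {E : Set (Fin n → ℝ)} {t c : ℝ}
    (ht : 0 < t) (hc : 0 ≤ c) (hP : blockNoise n E ≤ ENNReal.ofReal (t ^ 2)) :
    ∫⁻ w in E, ENNReal.ofReal (2 * w k ^ 2 + 2 * c) ∂blockNoise n ≤
      ENNReal.ofReal (t * (fourthMoment + 1) + 2 * c * t ^ 2) := by
  have h4 : ∫⁻ w, ENNReal.ofReal (w k ^ 4) ∂blockNoise n = ENNReal.ofReal fourthMoment := by
    rw [lintegral_blockNoise_eval k (f := fun z => ENNReal.ofReal (z ^ 4)) (by fun_prop),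
      fourthMoment, ENNReal.ofReal_toReal lintegral_pow_four_stdGauss_lt_top.ne]
  have hf : 0 ≤ fourthMoment := ENNReal.toReal_nonneg
  calc _ ≤ ∫⁻ w in E, (ENNReal.ofReal t * ENNReal.ofReal (w k ^ 4) +
        ENNReal.ofReal (1 / t + 2 * c)) ∂blockNoise n := by
        refine setLIntegral_mono (by fun_prop) fun w _ => ?_
        rw [← ENNReal.ofReal_mul ht.le, ← ENNReal.ofReal_add (by positivity) (by positivity)]
        apply ENNReal.ofReal_le_ofReal
        have : t * w k ^ 4 + 1 / t - 2 * w k ^ 2 = (t * w k ^ 2 - 1) ^ 2 / t := by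
          field_simp
          ring
        have : 0 ≤ (t * w k ^ 2 - 1) ^ 2 / t := by positivity
        linarith
    _ ≤ ENNReal.ofReal t * ENNReal.ofReal fourthMoment +
        ENNReal.ofReal (1 / t + 2 * c) * ENNReal.ofReal (t ^ 2) := by
        rw [lintegral_add_right _ (by fun_prop), setLIntegral_const,
          lintegral_const_mul _ (by fun_prop)]
        gcongr
        rw [← h4]
        exact setLIntegral_le_lintegral _ _
    _ = _ := by
        rw [← ENNReal.ofReal_mul ht.le, ← ENNReal.ofReal_mul (by positivity),
          ← ENNReal.ofReal_add (by positivity) (by positivity)]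
        congr 1
        field_simp
        ring

/-! ### The hybrid rule -/

variable (ρ₀ b₀ : ℝ) (η : ℕ → ℝ)

/-- The total risk of the hybrid rule. -/
def hybridRisk : ℝ≥0∞ :=
  ∑ k, ∫⁻ w, ENNReal.ofReal
    ((hybridRule ρ₀ b₀ η (fun i => θ i + w i) (θ k + w k) - θ k) ^ 2) ∂blockNoise n

lemma hybridRule_sub_of_lt {w : Fin n → ℝ}
    (h : switchLevel b₀ n < kappaEst fun i => θ i + w i) (k : Fin n) :
    hybridRule ρ₀ b₀ η (fun i => θ i + w i) (θ k + w k) - θ k =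
      ebError θ (√(2 * Real.log n)) (rhoLevel ρ₀ η n) k w := by
  unfold hybridRule ebError
  rw [if_pos h, densityEst_at_observation, deriv_densityEst_at_observation]
  ring

lemma hybridRule_sub_of_le {w : Fin n → ℝ}
    (h : (kappaEst fun i => θ i + w i) ≤ switchLevel b₀ n) (k : Fin n) :
    hybridRule ρ₀ b₀ η (fun i => θ i + w i) (θ k + w k) - θ k =
      softThreshold (√(2 * Real.log n)) (θ k + w k) - θ k := by
  unfold hybridRule
  rw [if_neg h.not_gt]

/-- Charges the empirical Bayes risk on the whole space and soft thresholding only where it is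
selected: the decomposition for dense blocks. The mirror inequality below serves sparse ones. -/
lemma hybridRisk_le_ebRisk_add :
    hybridRisk θ ρ₀ b₀ η ≤ ebRisk θ (√(2 * Real.log n)) (rhoLevel ρ₀ η n) +
      ∑ k, ∫⁻ w in {w | kappaEst (fun i => θ i + w i) ≤ switchLevel b₀ n},
        ENNReal.ofReal ((softThreshold (√(2 * Real.log n)) (θ k + w k) - θ k) ^ 2)
          ∂blockNoise n := by
  unfold hybridRisk ebRisk
  rw [← Finset.sum_add_distrib]
  refine Finset.sum_le_sum fun k _ => ?_
  have hE : MeasurableSet {w : Fin n → ℝ | kappaEst (fun i => θ i + w i) ≤ switchLevel b₀ n} :=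
    measurableSet_le (measurable_kappaEst θ) measurable_const
  have hm := measurable_ebError θ (√(2 * Real.log n)) (rhoLevel ρ₀ η n) k
  rw [← lintegral_indicator hE, ← lintegral_add_left (by fun_prop)]
  refine lintegral_mono fun w => ?_
  by_cases hw : kappaEst (fun i => θ i + w i) ≤ switchLevel b₀ n
  · rw [hybridRule_sub_of_le θ ρ₀ b₀ η hw,
      Set.indicator_of_mem (show w ∈ {w | kappaEst (fun i => θ i + w i) ≤ _} from hw)]
    exact le_add_self
  · rw [hybridRule_sub_of_lt θ ρ₀ b₀ η (not_le.1 hw)]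
    exact le_self_add

lemma hybridRisk_le_ruleRisk_add :
    hybridRisk θ ρ₀ b₀ η ≤ ruleRisk θ (softThreshold (√(2 * Real.log n))) +
      ∑ k, ∫⁻ w in {w | switchLevel b₀ n < kappaEst (fun i => θ i + w i)},
        ENNReal.ofReal (ebError θ (√(2 * Real.log n)) (rhoLevel ρ₀ η n) k w ^ 2)
          ∂blockNoise n := by
  unfold hybridRisk ruleRisk
  rw [← Finset.sum_add_distrib]
  refine Finset.sum_le_sum fun k _ => ?_
  have hE : MeasurableSet {w : Fin n → ℝ | switchLevel b₀ n < kappaEst (fun i => θ i + w i)} :=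
    measurableSet_lt measurable_const (measurable_kappaEst θ)
  have hm := measurable_ebError θ (√(2 * Real.log n)) (rhoLevel ρ₀ η n) k
  rw [← lintegral_blockNoise_eval k (by fun_prop), ← lintegral_indicator hE,
    ← lintegral_add_left (by fun_prop)]
  refine lintegral_mono fun w => ?_
  by_cases hw : switchLevel b₀ n < kappaEst (fun i => θ i + w i)
  · rw [hybridRule_sub_of_lt θ ρ₀ b₀ η hw,
      Set.indicator_of_mem (show w ∈ {w | _ < kappaEst (fun i => θ i + w i)} from hw)]
    exact le_add_self
  · rw [hybridRule_sub_of_le θ ρ₀ b₀ η (not_lt.1 hw)]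
    exact le_self_add

/-- A crude bound for the risk of the hybrid rule. -/
lemma hybridRisk_le_crude (hρ : 0 < rhoLevel ρ₀ η n) :
    hybridRisk θ ρ₀ b₀ η ≤ ENNReal.ofReal (n * (2 + 2 * (√(2 * Real.log n) ^ 2
      + (√(2 * Real.log n) ^ 2 / rhoLevel ρ₀ η n) ^ 2))) := by
  set a := √(2 * Real.log n) with ha
  have ha0 : 0 ≤ a := Real.sqrt_nonneg _
  have : ∀ k, ∫⁻ w, ENNReal.ofReal
      ((hybridRule ρ₀ b₀ η (fun i => θ i + w i) (θ k + w k) - θ k) ^ 2) ∂blockNoise n ≤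
      ENNReal.ofReal (2 + 2 * (a ^ 2 + (a ^ 2 / rhoLevel ρ₀ η n) ^ 2)) := by
    intro k
    calc _ ≤ ∫⁻ w, (ENNReal.ofReal 2 * ENNReal.ofReal (w k ^ 2) +
          ENNReal.ofReal (2 * (a ^ 2 + (a ^ 2 / rhoLevel ρ₀ η n) ^ 2))) ∂blockNoise n := by
          refine lintegral_mono fun w => ?_
          rw [← ENNReal.ofReal_mul (by norm_num), ← ENNReal.ofReal_add (by positivity)
            (by positivity)]
          apply ENNReal.ofReal_le_ofReal
          have h1 : 0 ≤ a ^ 2 := by positivity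
          have h2 : 0 ≤ (a ^ 2 / rhoLevel ρ₀ η n) ^ 2 := by positivity
          by_cases hw : switchLevel b₀ n < kappaEst (fun i => θ i + w i)
          · rw [hybridRule_sub_of_lt θ ρ₀ b₀ η hw]
            have := sq_ebError_le θ ha0 hρ k w
            linarith
          · rw [hybridRule_sub_of_le θ ρ₀ b₀ η (not_lt.1 hw)]
            have := sq_softThreshold_sub_le' ha0 (θ k) (w k)
            linarith
      _ = _ := by
          rw [lintegral_add_right _ (by fun_prop), lintegral_const_mul _ (by fun_prop),
            lintegral_blockNoise_eval k (f := fun z => ENNReal.ofReal (z ^ 2)) (by fun_prop),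
            lintegral_sq_stdGauss, ENNReal.ofReal_add (by norm_num) (by positivity)]
          simp
  refine (Finset.sum_le_sum fun k _ => this k).trans (le_of_eq ?_)
  rw [← ENNReal.ofReal_sum_of_nonneg fun k _ => by positivity]
  simp only [Finset.sum_const, Finset.card_univ, Fintype.card_fin, nsmul_eq_mul]

end

/-! ### Oracle inequality in a large block -/

/-- Numerical relations between the size `n` of a large block, the inverse bandwidth `a`, the
regularization level `ρ`, the switching level `b` and the slowly growing factor `T`. -/
structure LargeBlock (r₁ r₂ b₁ : ℝ) (n : ℕ) (a ρ b T : ℝ) : Prop where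
  n_pos : 0 < (n : ℝ)
  one_le_a : 1 ≤ a
  sq_a_le : a ^ 2 ≤ T
  sq_T_le : T ^ 2 ≤ n
  exp_a : Real.exp (-a ^ 2 / 2) = 1 / n
  le_rho : r₁ * a / √n ≤ ρ
  rho_le : ρ ≤ r₂ * a / √n
  r₁_pos : 0 < r₁
  le_r₁ : 16 ≤ r₁ * √n
  exp_T₁ : (n : ℝ) ^ 3 * Real.exp (-(r₁ ^ 2 / 32 * T ^ 2)) ≤ 1
  exp_T₂ : (n : ℝ) ^ 3 * Real.exp (-(1 / 32 * T ^ 2)) ≤ 1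
  b₁_pos : 0 < b₁
  le_b : b₁ / √n ≤ b
  b_le : b ≤ b₁ * T / √n
  exp_b : Real.exp (-(n * b ^ 2) / 16) ≤ ((1 / (n : ℝ)) ^ 5) ^ 2

namespace LargeBlock

variable {r₁ r₂ b₁ : ℝ} {n : ℕ} {a ρ b T : ℝ} (h : LargeBlock r₁ r₂ b₁ n a ρ b T)
include h

lemma one_le_T : 1 ≤ T := by nlinarith [h.one_le_a, h.sq_a_le]

lemma T_le : T ≤ n := by nlinarith [h.one_le_T, h.sq_T_le]

lemma one_le_n : 1 ≤ (n : ℝ) := h.one_le_T.trans h.T_le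

lemma cube_a_le : a ^ 3 ≤ T ^ 2 := by
  have h1 := h.one_le_a
  have h2 := h.sq_a_le
  have h3 : a ≤ T := by nlinarith
  have h4 := h.one_le_T
  calc a ^ 3 = a ^ 2 * a := by ring
    _ ≤ T * T := by gcongr
    _ = _ := by ring

lemma one_le_sqrt : 1 ≤ √(n : ℝ) := by
  rw [Real.one_le_sqrt]; exact h.one_le_n

lemma sqrt_mul_sqrt : √(n : ℝ) * √(n : ℝ) = n := Real.mul_self_sqrt h.n_pos.le

lemma rho_pos : 0 < ρ := by
  have := h.r₁_pos
  have := h.one_le_a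
  have := h.one_le_sqrt
  exact lt_of_lt_of_le (by positivity) h.le_rho

lemma r₂_pos : 0 < r₂ := by
  have h1 := h.rho_pos.trans_le h.rho_le
  have := h.one_le_a
  have := h.one_le_sqrt
  by_contra hr
  push Not at hr
  have : r₂ * a / √n ≤ 0 := div_nonpos_of_nonpos_of_nonneg
    (mul_nonpos_of_nonpos_of_nonneg hr (by linarith)) (by positivity)
  linarith

lemma one_le_main : 1 ≤ T ^ 3 * √n := by
  have := one_le_pow₀ h.one_le_T (n := 3)
  have := h.one_le_sqrt
  nlinarith

lemma exp_two_a : Real.exp (-(2 * a) ^ 2 / 4) = (1 / (n : ℝ)) ^ 2 := by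
  rw [← h.exp_a, ← Real.exp_nat_mul]
  congr 1
  push_cast
  ring

/-- A = 2a makes exp(-A²/4) = n⁻², below ρ. Taking L = T is essential: nρ²/a² is only bounded below
by the constant r₁², so without the growing factor T² the Hoeffding exponent would not beat powers
of `n`. -/
lemma tuning : Tuning n a ρ (2 * a) T where
  one_le_a := h.one_le_a
  exp_a := h.exp_a.le
  rho_pos := h.rho_pos
  A_nonneg := by linarith [h.one_le_a]
  exp_A := by
    rw [h.exp_two_a]
    refine le_trans ?_ h.le_rho
    have h1 := h.le_r₁
    have h2 := h.one_le_sqrt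
    have h3 := h.sqrt_mul_sqrt
    have h4 := h.one_le_n
    have h5 := h.one_le_a
    have h6 := h.r₁_pos
    rw [div_pow, one_pow, div_le_div_iff₀ (by positivity) (by positivity), one_mul]
    calc √(n : ℝ) ≤ 16 * √n := by linarith
      _ ≤ (r₁ * √n) * √n := by gcongr
      _ = r₁ * 1 * n := by rw [mul_assoc, h3, mul_one]
      _ ≤ r₁ * a * (n : ℝ) ^ 2 := by gcongr; nlinarith
  one_le_L := h.one_le_T
  bias_le := by
    have h1 := h.le_r₁
    have h2 := h.one_le_sqrt
    have h3 := h.sqrt_mul_sqrt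
    have h4 := h.one_le_n
    have h5 := h.one_le_a
    have h6 := h.r₁_pos
    have h7 : 16 * a / n ≤ r₁ * a / √n := by
      rw [div_le_div_iff₀ (by positivity) (by positivity)]
      calc 16 * a * √n ≤ (r₁ * √n) * a * √n := by gcongr
        _ = r₁ * a * n := by linear_combination (r₁ * a) * h3
    have h8 : ρ ≤ T * ρ := le_mul_of_one_le_left h.rho_pos.le h.one_le_T
    have h9 := h.le_rho
    have : 4 * a / n = (16 * a / n) / 4 := by ring
    linarith

lemma inv_rho_le : 1 / ρ ≤ √n / (r₁ * a) := by
  have := h.r₁_pos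
  have := h.one_le_a
  have := h.one_le_sqrt
  calc 1 / ρ ≤ 1 / (r₁ * a / √n) := one_div_le_one_div_of_le (by positivity) h.le_rho
    _ = _ := one_div_div _ _

lemma sq_div_rho_le : a ^ 2 / ρ ≤ a * √n / r₁ := by
  have := h.r₁_pos
  have := h.one_le_a
  calc a ^ 2 / ρ = a ^ 2 * (1 / ρ) := by ring
    _ ≤ a ^ 2 * (√n / (r₁ * a)) := mul_le_mul_of_nonneg_left h.inv_rho_le (sq_nonneg a)
    _ = _ := by field_simp

/-- The summands come from the variance, the bias and the underestimated density. The first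
dominates, being of order T a³ √n, and a³ ≤ T². -/
lemma estimation_bound :
    8 * T / ρ * (8 * (a ^ 4 + (2 * a + 1) ^ 2 * a ^ 2))
        + n * (8 * (1 + (2 * a + 1) ^ 2) * (4 * a / n) ^ 2 / ρ ^ 2
        + (a ^ 2 / ρ + (2 * a + 1)) ^ 2 * Real.exp (-(n * (T * ρ) ^ 2) / (32 * a ^ 2))) ≤
      (640 / r₁ + 1280 / r₁ ^ 2 + (1 / r₁ + 3) ^ 2) * (T ^ 3 * √n) := by
  have hr := h.r₁_pos
  have ha := h.one_le_a
  have hs := h.one_le_sqrt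
  have hss := h.sqrt_mul_sqrt
  have hT := h.one_le_T
  have hn := h.one_le_n
  have hρ := h.rho_pos
  have hmain := h.one_le_main
  have h9 : (2 * a + 1) ^ 2 ≤ 9 * a ^ 2 := by nlinarith
  have ha2 : 1 ≤ a ^ 2 := one_le_pow₀ ha
  have hinv := h.inv_rho_le
  have t1 : 8 * T / ρ * (8 * (a ^ 4 + (2 * a + 1) ^ 2 * a ^ 2)) ≤ 640 / r₁ * (T ^ 3 * √n) := by
    calc _ = 8 * T * (1 / ρ) * (8 * (a ^ 4 + (2 * a + 1) ^ 2 * a ^ 2)) := by ring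
      _ ≤ 8 * T * (√n / (r₁ * a)) * (8 * (a ^ 4 + 9 * a ^ 2 * a ^ 2)) := by gcongr
      _ = 640 / r₁ * (T * a ^ 3 * √n) := by field_simp; ring
      _ ≤ 640 / r₁ * (T * T ^ 2 * √n) := by gcongr; exact h.cube_a_le
      _ = _ := by ring
  have t2 : n * (8 * (1 + (2 * a + 1) ^ 2) * (4 * a / n) ^ 2 / ρ ^ 2) ≤
      1280 / r₁ ^ 2 * (T ^ 3 * √n) := by
    calc _ = n * (8 * (1 + (2 * a + 1) ^ 2) * (4 * a / n) ^ 2 * (1 / ρ) ^ 2) := by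
          rw [div_pow 1 ρ, one_pow]; ring
      _ ≤ n * (8 * (a ^ 2 + 9 * a ^ 2) * (4 * a / n) ^ 2 * (√n / (r₁ * a)) ^ 2) := by gcongr
      _ = 1280 / r₁ ^ 2 * a ^ 2 := by
          rw [div_pow (√(n : ℝ)), Real.sq_sqrt h.n_pos.le]
          field_simp
          ring
      _ ≤ 1280 / r₁ ^ 2 * (T ^ 3 * √n) := by
          gcongr
          have : T ≤ T ^ 3 := by nlinarith [one_le_pow₀ hT (n := 2)]
          nlinarith [h.sq_a_le]
  have t3 : n * ((a ^ 2 / ρ + (2 * a + 1)) ^ 2 * Real.exp (-(n * (T * ρ) ^ 2) / (32 * a ^ 2))) ≤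
      (1 / r₁ + 3) ^ 2 * (T ^ 3 * √n) := by
    have e1 : a ^ 2 / ρ + (2 * a + 1) ≤ a * √n * (1 / r₁ + 3) := by
      have := h.sq_div_rho_le
      have e : a * √n * (1 / r₁ + 3) = a * √n / r₁ + 3 * (a * √n) := by ring
      have : a ≤ a * √n := le_mul_of_one_le_right (by linarith) hs
      linarith
    have e2 : Real.exp (-(n * (T * ρ) ^ 2) / (32 * a ^ 2)) ≤
        Real.exp (-(r₁ ^ 2 / 32 * T ^ 2)) := by
      apply Real.exp_le_exp.2
      have e3 : r₁ ^ 2 * a ^ 2 ≤ n * ρ ^ 2 := by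
        have h1 : r₁ * a ≤ √n * ρ := by
          have := h.le_rho
          rw [div_le_iff₀ (by positivity)] at this
          linarith
        calc r₁ ^ 2 * a ^ 2 = (r₁ * a) ^ 2 := by ring
          _ ≤ (√n * ρ) ^ 2 := by gcongr
          _ = _ := by rw [mul_pow, Real.sq_sqrt h.n_pos.le]
      rw [neg_div, neg_le_neg_iff, le_div_iff₀ (by positivity)]
      calc _ = T ^ 2 * (r₁ ^ 2 * a ^ 2) := by ring
        _ ≤ T ^ 2 * (n * ρ ^ 2) := by gcongr
        _ = _ := by ring
    calc _ ≤ n * ((a * √n * (1 / r₁ + 3)) ^ 2 * Real.exp (-(r₁ ^ 2 / 32 * T ^ 2))) := by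
          gcongr
      _ = (1 / r₁ + 3) ^ 2 * (n ^ 2 * a ^ 2 * Real.exp (-(r₁ ^ 2 / 32 * T ^ 2))) := by
          rw [mul_pow, mul_pow, Real.sq_sqrt h.n_pos.le]; ring
      _ ≤ (1 / r₁ + 3) ^ 2 * (n ^ 2 * n * Real.exp (-(r₁ ^ 2 / 32 * T ^ 2))) := by
          gcongr
          exact h.sq_a_le.trans h.T_le
      _ ≤ (1 / r₁ + 3) ^ 2 * 1 := by
          gcongr
          have := h.exp_T₁
          calc _ = (n : ℝ) ^ 3 * Real.exp (-(r₁ ^ 2 / 32 * T ^ 2)) := by ring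
            _ ≤ 1 := this
      _ ≤ _ := by gcongr
  rw [mul_add]
  linarith

lemma tail_bound (far : ℝ) :
    n * (2 * T * ((2 * a) ^ 2 * ρ + 2 * Real.exp (-(2 * a) ^ 2 / 4)))
        + 12 * (far + n * Real.exp (-T ^ 2 / 32)) ≤
      (8 * r₂ + 16) * (T ^ 3 * √n) + 12 * far := by
  have hr := h.r₂_pos
  have ha := h.one_le_a
  have hs := h.one_le_sqrt
  have hss := h.sqrt_mul_sqrt
  have hT := h.one_le_T
  have hn := h.one_le_n
  have hmain := h.one_le_main
  have t1 : n * (2 * T * ((2 * a) ^ 2 * ρ)) ≤ 8 * r₂ * (T ^ 3 * √n) := by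
    calc _ ≤ n * (2 * T * ((2 * a) ^ 2 * (r₂ * a / √n))) := by gcongr; exact h.rho_le
      _ = 8 * r₂ * (T * a ^ 3 * √n) := by
          nth_rewrite 1 [← hss]
          field_simp
          ring
      _ ≤ 8 * r₂ * (T * T ^ 2 * √n) := by gcongr; exact h.cube_a_le
      _ = _ := by ring
  have t2 : n * (2 * T * (2 * Real.exp (-(2 * a) ^ 2 / 4))) ≤ 4 := by
    rw [h.exp_two_a]
    have : n * (2 * T * (2 * (1 / (n : ℝ)) ^ 2)) = 4 * T / n := by field_simp; ring
    rw [this, div_le_iff₀ h.n_pos]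
    linarith [h.T_le]
  have t3 : n * Real.exp (-T ^ 2 / 32) ≤ 1 := by
    have h1 := h.exp_T₂
    have e : -T ^ 2 / 32 = -(1 / 32 * T ^ 2) := by ring
    rw [e]
    have : (n : ℝ) ≤ n ^ 3 := le_self_pow₀ hn (by norm_num)
    calc _ ≤ (n : ℝ) ^ 3 * Real.exp (-(1 / 32 * T ^ 2)) := by gcongr
      _ ≤ 1 := h1
  have e : n * (2 * T * ((2 * a) ^ 2 * ρ + 2 * Real.exp (-(2 * a) ^ 2 / 4))) =
    n * (2 * T * ((2 * a) ^ 2 * ρ)) + n * (2 * T * (2 * Real.exp (-(2 * a) ^ 2 / 4))) := by ring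
  rw [e]
  linarith

/-- At the level a one has n exp(-a²/2) = 1, so a null block costs only 32/a³. -/
lemma soft_bound {κ : ℝ} (hκ : 0 ≤ κ) :
    n * (32 * Real.exp (-a ^ 2 / 2) / a ^ 3) + 10 * (1 + a ^ 2) * (n * κ) ≤
      32 / a ^ 3 + 20 * T * (n * κ) := by
  have ha := h.one_le_a
  have hn := h.one_le_n
  have ha2 : 1 ≤ a ^ 2 := one_le_pow₀ ha
  rw [h.exp_a]
  have e : n * (32 * (1 / (n : ℝ)) / a ^ 3) = 32 / a ^ 3 := by field_simp
  rw [e]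
  have : 10 * (1 + a ^ 2) ≤ 20 * T := by linarith [h.sq_a_le]
  gcongr

end LargeBlock

lemma sparsity_nonneg {n : ℕ} (θ : Fin n → ℝ) : 0 ≤ sparsity θ := by
  unfold sparsity
  refine mul_nonneg (by positivity) (Finset.sum_nonneg fun k _ => ?_)
  have : Real.exp (-(θ k) ^ 2 / 4) ≤ 1 := Real.exp_le_one_iff.2 (by nlinarith [sq_nonneg (θ k)])
  linarith

/-- The constant of `LargeBlock.ebRisk_le`, with `K = (b₁ / 2) ^ (-1/2)`. -/
def ebConst (r₁ r₂ K : ℝ) : ℝ :=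
  32 * K ^ 2 + 20 + (1 + K) * (8 * r₂ + 16) * K +
    (K + 1) * (640 / r₁ + 1280 / r₁ ^ 2 + (1 / r₁ + 3) ^ 2)

namespace LargeBlock

variable {r₁ r₂ b₁ : ℝ} {n : ℕ} {a ρ b T : ℝ} (h : LargeBlock r₁ r₂ b₁ n a ρ b T)
include h

lemma neZero : NeZero n := ⟨by have := h.n_pos; rintro rfl; simp at this⟩

/-- In dense blocks √n κ stays away from 0, so constants can be absorbed into its powers. -/
lemma b₁_div_two_le {κ : ℝ} (hκ : b / 2 ≤ κ) : b₁ / 2 ≤ √n * κ := by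
  have h1 := h.le_b
  have h2 := h.one_le_sqrt
  rw [div_le_iff₀ (by positivity)] at h1
  nlinarith

lemma ruleRisk_bayesRule_le_soft (θ : Fin n → ℝ) :
    ruleRisk θ (bayesRule θ) ≤
      ENNReal.ofReal (32 / a ^ 3 + 20 * T * (n * sparsity θ)) := by
  have := h.neZero
  have ha := h.one_le_a
  refine (ruleRisk_bayesRule_le θ (measurable_softThreshold a)).trans ?_
  refine (ruleRisk_softThreshold_le θ (by linarith)).trans (ENNReal.ofReal_le_ofReal ?_)
  exact h.soft_bound (sparsity_nonneg θ)

/-- With u = √n κ, the Bayes risk is at most of order T √n u because soft thresholding is a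
competitor, while the estimation error is of order T³ √n. The relative loss s = 1/√u balances s
times the former with 1/s times the latter at T³ √n √u. -/
lemma ebRisk_le (θ : Fin n → ℝ) {K : ℝ} (hK : K = 1 / √(b₁ / 2))
    (hκ : b / 2 ≤ sparsity θ) :
    GEB.ebRisk θ a ρ ≤ ruleRisk θ (bayesRule θ) + ENNReal.ofReal
      (ebConst r₁ r₂ K * (T ^ 3 * √n * √(√n * sparsity θ))
        + 12 * (1 + K) * farCount θ (T / 2)) := by
  have := h.neZero
  have ha := h.one_le_a
  have hs := h.one_le_sqrt
  have hT := h.one_le_T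
  have hmain := h.one_le_main
  have hr₁ := h.r₁_pos
  have hr₂ := h.r₂_pos
  have hb₁ := h.b₁_pos
  have hc := h.b₁_div_two_le hκ
  obtain ⟨u, hu⟩ : ∃ u, u = √n * sparsity θ := ⟨_, rfl⟩
  rw [← hu] at hc ⊢
  have hu0 : 0 < u := lt_of_lt_of_le (by positivity) hc
  have hK0 : 0 < K := by rw [hK]; positivity
  have hsu : 0 < √u := Real.sqrt_pos.2 hu0
  have hKu : 1 ≤ K * √u := by
    rw [hK, one_div_mul_eq_div, one_le_div (Real.sqrt_pos.2 (by positivity))]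
    exact Real.sqrt_le_sqrt hc
  have hsK : 1 / √u ≤ K := by rw [div_le_iff₀ hsu]; exact hKu
  have hnu : n * sparsity θ = √n * u := by rw [hu, ← mul_assoc, h.sqrt_mul_sqrt]
  have hR := h.ruleRisk_bayesRule_le_soft θ
  rw [hnu] at hR
  obtain ⟨M, hM⟩ : ∃ M, M = T ^ 3 * √n := ⟨_, rfl⟩
  obtain ⟨Cd, hCd⟩ : ∃ C, C = 640 / r₁ + 1280 / r₁ ^ 2 + (1 / r₁ + 3) ^ 2 := ⟨_, rfl⟩
  have hCd0 : 0 < Cd := by rw [hCd]; positivity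
  have hfar : 0 ≤ (farCount θ (T / 2) : ℝ) := Nat.cast_nonneg _
  have hM1 : 1 ≤ M := hM ▸ hmain
  have hreg : ruleRisk θ (regRule ρ θ) ≤ ruleRisk θ (bayesRule θ) +
      ENNReal.ofReal ((8 * r₂ + 16) * M + 12 * farCount θ (T / 2)) := by
    rw [ruleRisk_eq_add θ (measurable_regRule θ ρ)]
    gcongr
    refine (lintegral_regRule_excess_le θ (A := 2 * a) (x₀ := T) h.rho_pos (by linarith)
      (by linarith)).trans (ENNReal.ofReal_le_ofReal ?_)
    rw [hM]
    exact h.tail_bound _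
  have hest := h.tuning.sum_lintegral_sq_looError_le (θ := θ) rfl
  have hest' := hest.trans (ENNReal.ofReal_le_ofReal h.estimation_bound)
  rw [← hM, ← hCd] at hest'
  refine (GEB.ebRisk_le θ a ρ (s := 1 / √u) (by positivity)).trans ?_
  rw [one_div_one_div]
  calc _ ≤ ENNReal.ofReal (1 + 1 / √u) * (ruleRisk θ (bayesRule θ) +
          ENNReal.ofReal ((8 * r₂ + 16) * M + 12 * farCount θ (T / 2))) +
        ENNReal.ofReal (1 + √u) * ENNReal.ofReal (Cd * M) := by gcongr
    _ = ruleRisk θ (bayesRule θ) + (ENNReal.ofReal (1 / √u) * ruleRisk θ (bayesRule θ) +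
          ENNReal.ofReal (1 + 1 / √u) *
            ENNReal.ofReal ((8 * r₂ + 16) * M + 12 * farCount θ (T / 2)) +
        ENNReal.ofReal (1 + √u) * ENNReal.ofReal (Cd * M)) := by
        rw [ENNReal.ofReal_add (by norm_num) (by positivity : 0 ≤ 1 / √u), ENNReal.ofReal_one]
        ring
    _ ≤ ruleRisk θ (bayesRule θ) + (ENNReal.ofReal (1 / √u) *
          ENNReal.ofReal (32 / a ^ 3 + 20 * T * (√n * u)) +
          ENNReal.ofReal (1 + 1 / √u) *
            ENNReal.ofReal ((8 * r₂ + 16) * M + 12 * farCount θ (T / 2)) +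
        ENNReal.ofReal (1 + √u) * ENNReal.ofReal (Cd * M)) := by gcongr
    _ ≤ _ := by
        gcongr
        rw [← ENNReal.ofReal_mul (by positivity), ← ENNReal.ofReal_mul (by positivity),
          ← ENNReal.ofReal_mul (by positivity), ← ENNReal.ofReal_add (by positivity)
          (by positivity), ← ENNReal.ofReal_add (by positivity) (by positivity)]
        apply ENNReal.ofReal_le_ofReal
        rw [← hM]
        have hMu : 0 < M * √u := by positivity
        have t1 : 1 / √u * (32 / a ^ 3 + 20 * T * (√n * u)) ≤ (32 * K ^ 2 + 20) * (M * √u) := by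
          have e1 : 32 / a ^ 3 ≤ 32 := div_le_self (by norm_num) (one_le_pow₀ ha)
          have e2 : T * √n ≤ M := by
            rw [hM]
            gcongr
            exact le_self_pow₀ hT (by norm_num)
          have e3 : 1 / √u * u = √u := by
            nth_rewrite 2 [← Real.mul_self_sqrt hu0.le]
            field_simp
          calc _ = 1 / √u * (32 / a ^ 3) + 20 * (T * √n) * (1 / √u * u) := by ring
            _ ≤ K * 32 + 20 * M * √u := by rw [e3]; gcongr
            _ ≤ (K * 32) * (K * √u) * M + 20 * M * √u := by
                have h1 : K * 32 ≤ (K * 32) * (K * √u) := le_mul_of_one_le_right (by positivity) hKu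
                have h2 : K * 32 ≤ (K * 32) * (K * √u) * M :=
                  h1.trans (le_mul_of_one_le_right (by positivity) hM1)
                linarith
            _ = _ := by ring
        have t2 : (1 + 1 / √u) * ((8 * r₂ + 16) * M + 12 * farCount θ (T / 2)) ≤
            (1 + K) * (8 * r₂ + 16) * K * (M * √u) + 12 * (1 + K) * farCount θ (T / 2) := by
          calc _ ≤ (1 + K) * ((8 * r₂ + 16) * M + 12 * farCount θ (T / 2)) := by gcongr
            _ = (1 + K) * (8 * r₂ + 16) * M + 12 * (1 + K) * farCount θ (T / 2) := by ring
            _ ≤ (1 + K) * (8 * r₂ + 16) * M * (K * √u) + 12 * (1 + K) * farCount θ (T / 2) := by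
                have h1 := le_mul_of_one_le_right
                  (by positivity : 0 ≤ (1 + K) * (8 * r₂ + 16) * M) hKu
                linarith
            _ = _ := by ring
        have t3 : (1 + √u) * (Cd * M) ≤ (K + 1) * Cd * (M * √u) := by
          calc _ ≤ (K * √u + √u) * (Cd * M) := by gcongr
            _ = _ := by ring
        unfold ebConst
        rw [← hCd]
        linarith

lemma inv_n_le : 1 / (n : ℝ) ≤ 1 / a ^ 3 := by
  have ha := h.one_le_a
  exact one_div_le_one_div_of_le (by positivity) (h.cube_a_le.trans h.sq_T_le)

/-- The probability n⁻¹⁰ allows t = n⁻⁵ in `setLIntegral_sq_le`. This is small enough for a sum over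
`n` coordinates and for c of order n², as produced by the crude bound a²/ρ. -/
lemma sum_setLIntegral_le {E : Set (Fin n → ℝ)} {c : ℝ} (hc : 0 ≤ c)
    {F : Fin n → (Fin n → ℝ) → ℝ} (hF : ∀ k w, F k w ≤ 2 * w k ^ 2 + 2 * c)
    (hP : blockNoise n E ≤ ENNReal.ofReal (Real.exp (-(n * b ^ 2) / 16))) :
    ∑ k, ∫⁻ w in E, ENNReal.ofReal (F k w) ∂blockNoise n ≤
      ENNReal.ofReal ((fourthMoment + 1 + 2 * c / n ^ 2) / n) := by
  have hn := h.one_le_n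
  have hf : 0 ≤ fourthMoment := ENNReal.toReal_nonneg
  have hP' := hP.trans (ENNReal.ofReal_le_ofReal h.exp_b)
  have : ∀ k, ∫⁻ w in E, ENNReal.ofReal (F k w) ∂blockNoise n ≤
      ENNReal.ofReal ((1 / (n : ℝ)) ^ 5 * (fourthMoment + 1)
        + 2 * c * ((1 / (n : ℝ)) ^ 5) ^ 2) := fun k =>
    (setLIntegral_mono (by fun_prop) fun w _ => ENNReal.ofReal_le_ofReal (hF k w)).trans
      (setLIntegral_sq_le k (by positivity) hc hP')
  refine (Finset.sum_le_sum fun k _ => this k).trans ?_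
  rw [← ENNReal.ofReal_sum_of_nonneg fun k _ => by positivity]
  apply ENNReal.ofReal_le_ofReal
  simp only [Finset.sum_const, Finset.card_univ, Fintype.card_fin, nsmul_eq_mul]
  have hi : 1 / (n : ℝ) ≤ 1 := by rw [div_le_one (by linarith)]; exact hn
  have hi0 : 0 < 1 / (n : ℝ) := by positivity
  have e : (n : ℝ) * (1 / n) = 1 := by field_simp
  have e5 : (n : ℝ) * (1 / (n : ℝ)) ^ 5 ≤ 1 / n := by
    calc _ = (n : ℝ) * (1 / n) * (1 / n) * (1 / n) ^ 3 := by ring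
      _ ≤ (n : ℝ) * (1 / n) * (1 / n) * 1 := by gcongr; exact pow_le_one₀ hi0.le hi
      _ = _ := by rw [e]; ring
  have e10 : (n : ℝ) * ((1 / (n : ℝ)) ^ 5) ^ 2 ≤ 1 / n ^ 2 / n := by
    calc _ = (n : ℝ) * (1 / n) * (1 / n) ^ 3 * (1 / n) ^ 6 := by ring
      _ ≤ (n : ℝ) * (1 / n) * (1 / n) ^ 3 * 1 := by gcongr; exact pow_le_one₀ hi0.le hi
      _ = _ := by rw [e]; field_simp
  calc _ = ((n : ℝ) * (1 / (n : ℝ)) ^ 5) * (fourthMoment + 1)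
        + 2 * c * ((n : ℝ) * ((1 / (n : ℝ)) ^ 5) ^ 2) := by ring
    _ ≤ 1 / n * (fourthMoment + 1) + 2 * c * (1 / n ^ 2 / n) := by gcongr
    _ = _ := by ring

/-- Near or below the switching level, u = √n κ is at most a multiple of T, so u = u^s u^(1-s) costs
one extra factor T and takes the common form with exponent s. -/
lemma soft_part_le {θ : Fin n → ℝ} {s : ℝ} (hs0 : 0 ≤ s) (hs : s ≤ 1)
    (hκ : sparsity θ ≤ 2 * b) :
    32 / a ^ 3 + 20 * T * (n * sparsity θ) ≤
      32 * (1 / a ^ 3) + 20 * (1 + 2 * b₁) * (T ^ 3 * √n * (√n * sparsity θ) ^ s) := by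
  have hκ0 := sparsity_nonneg θ
  have hsq := h.one_le_sqrt
  have hT := h.one_le_T
  have hb := h.b₁_pos
  obtain ⟨u, hu⟩ : ∃ u, u = √n * sparsity θ := ⟨_, rfl⟩
  have hu0 : 0 ≤ u := by rw [hu]; positivity
  have hnu : n * sparsity θ = √n * u := by rw [hu, ← mul_assoc, h.sqrt_mul_sqrt]
  rw [hnu, ← hu]
  have hub : u ≤ (1 + 2 * b₁) * T := by
    have h1 : u ≤ √n * (2 * (b₁ * T / √n)) := by
      rw [hu]; gcongr; exact hκ.trans (by linarith [h.b_le])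
    have h2 : √n * (2 * (b₁ * T / √n)) = 2 * b₁ * T := by field_simp
    nlinarith
  have hsplit : u ≤ u ^ s * ((1 + 2 * b₁) * T) := by
    rcases hu0.eq_or_lt with h0 | h0
    · rw [← h0]; positivity
    · have h3 : u ^ (1 - s) ≤ (1 + 2 * b₁) * T := by
        have h4 : 1 ≤ (1 + 2 * b₁) * T := by nlinarith
        calc u ^ (1 - s) ≤ ((1 + 2 * b₁) * T) ^ (1 - s) :=
              Real.rpow_le_rpow hu0 hub (by linarith)
          _ ≤ ((1 + 2 * b₁) * T) ^ (1 : ℝ) := Real.rpow_le_rpow_of_exponent_le h4 (by linarith)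
          _ = _ := Real.rpow_one _
      calc u = u ^ s * u ^ (1 - s) := by rw [← Real.rpow_add h0]; simp
        _ ≤ _ := by gcongr
  have hus : 0 ≤ u ^ s := Real.rpow_nonneg hu0 s
  have hT2 : T ^ 2 ≤ T ^ 3 := pow_le_pow_right₀ hT (by norm_num)
  calc _ ≤ 32 / a ^ 3 + 20 * T * (√n * (u ^ s * ((1 + 2 * b₁) * T))) := by gcongr
    _ = 32 * (1 / a ^ 3) + 20 * (1 + 2 * b₁) * (T ^ 2 * √n * u ^ s) := by ring
    _ ≤ _ := by gcongr

end LargeBlock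

/-- The constant of the oracle inequality in a large block. -/
def oracleConst (r₁ r₂ b₁ s : ℝ) : ℝ :=
  ebConst r₁ r₂ (1 / √(b₁ / 2)) * (b₁ / 2) ^ (1 / 2 - s) + 12 * (1 + 1 / √(b₁ / 2))
    + 32 + 20 * (1 + 2 * b₁) + (fourthMoment + 3 + 2 / r₁ ^ 2)

/-- Oracle inequality in a large block. -/
theorem LargeBlock.hybridRisk_le {r₁ r₂ b₁ ρ₀ b₀ : ℝ} {η : ℕ → ℝ} {n : ℕ} {T s : ℝ}
    (h : LargeBlock r₁ r₂ b₁ n (√(2 * Real.log n)) (rhoLevel ρ₀ η n) (switchLevel b₀ n) T)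
    (hs0 : 1 / 2 ≤ s) (hs : s ≤ 1) (θ : Fin n → ℝ) :
    hybridRisk θ ρ₀ b₀ η ≤ ruleRisk θ (bayesRule θ) + ENNReal.ofReal (oracleConst r₁ r₂ b₁ s *
      (T ^ 3 * √n * (√n * sparsity θ) ^ s + farCount θ (T / 2) + 1 / √(2 * Real.log n) ^ 3)) := by
  have := h.neZero
  have ha := h.one_le_a
  have hn := h.one_le_n
  have hsq := h.one_le_sqrt
  have hT := h.one_le_T
  have hb₁ := h.b₁_pos
  have hr₁ := h.r₁_pos
  have hr₂ := h.r₂_pos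
  have hρ := h.rho_pos
  have hκ0 := sparsity_nonneg θ
  have hf : 0 ≤ fourthMoment := ENNReal.toReal_nonneg
  have hb0 : 0 ≤ switchLevel b₀ n := le_trans (by positivity) h.le_b
  have hinv := h.inv_n_le
  have hst : ∀ (k : Fin n) (w : Fin n → ℝ), (softThreshold (√(2 * Real.log n)) (θ k + w k) - θ k) ^ 2 ≤
      2 * w k ^ 2 + 2 * √(2 * Real.log n) ^ 2 := fun k w =>
    sq_softThreshold_sub_le' (Real.sqrt_nonneg _) _ _
  have heb : ∀ (k : Fin n) (w : Fin n → ℝ), ebError θ (√(2 * Real.log n)) (rhoLevel ρ₀ η n) k w ^ 2 ≤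
      2 * w k ^ 2 + 2 * (√(2 * Real.log n) ^ 2 / rhoLevel ρ₀ η n) ^ 2 := fun k w =>
    sq_ebError_le θ (Real.sqrt_nonneg _) hρ k w
  have hsoft := (ruleRisk_softThreshold_le θ (by linarith : 0 < √(2 * Real.log n))).trans
    (ENNReal.ofReal_le_ofReal (h.soft_bound hκ0))
  have hcard : ∀ E : Set (Fin n → ℝ), ∑ k, ∫⁻ w in E,
      ENNReal.ofReal ((softThreshold (√(2 * Real.log n)) (θ k + w k) - θ k) ^ 2) ∂blockNoise n ≤
      ruleRisk θ (softThreshold (√(2 * Real.log n))) := fun E => by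
    unfold ruleRisk
    refine Finset.sum_le_sum fun k _ => (setLIntegral_le_lintegral _ _).trans (le_of_eq ?_)
    exact lintegral_blockNoise_eval k
      (f := fun z => ENNReal.ofReal ((softThreshold (√(2 * Real.log n)) (θ k + z) - θ k) ^ 2))
      (by fun_prop)
  have hcase1 := hybridRisk_le_ebRisk_add θ ρ₀ b₀ η
  have hcase2 := hybridRisk_le_ruleRisk_add θ ρ₀ b₀ η
  have hPle := measure_kappaEst_le_le θ hb0
  have hPlt := measure_lt_kappaEst_le θ hb0
  generalize √(2 * Real.log n) = a at *
  generalize rhoLevel ρ₀ η n = ρ at *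
  generalize switchLevel b₀ n = b at *
  obtain ⟨K, hK⟩ : ∃ K, K = 1 / √(b₁ / 2) := ⟨_, rfl⟩
  have hK0 : 0 < K := by rw [hK]; positivity
  have hEC : 0 < ebConst r₁ r₂ K := by unfold ebConst; positivity
  have hoc : oracleConst r₁ r₂ b₁ s = ebConst r₁ r₂ K * (b₁ / 2) ^ (1 / 2 - s) + 12 * (1 + K)
    + 32 + 20 * (1 + 2 * b₁) + (fourthMoment + 3 + 2 / r₁ ^ 2) := by rw [hK]; rfl
  have hfar : 0 ≤ (farCount θ (T / 2) : ℝ) := Nat.cast_nonneg _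
  obtain ⟨W, hW⟩ : ∃ W, W = T ^ 3 * √n * (√n * sparsity θ) ^ s := ⟨_, rfl⟩
  have hW0 : 0 ≤ W := by rw [hW]; positivity
  have ha3 : 0 < 1 / a ^ 3 := by positivity
  have hcpos : 0 < (b₁ / 2) ^ (1 / 2 - s) := by positivity
  have hr₁2 : 0 < 2 / r₁ ^ 2 := by positivity
  rw [← hW]
  -- Dense blocks are compared with empirical Bayes, sparse ones with soft thresholding; the other
  -- rule enters on the event where it is selected.
  rcases le_or_gt (b / 2) (sparsity θ) with hκ | hκ
  · have hc := h.b₁_div_two_le hκ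
    have hu0 : 0 < √n * sparsity θ := lt_of_lt_of_le (by positivity) hc
    -- The base is at least b₁/2 and 1/2 - s ≤ 0, so the exponent 1/2 may be raised to s at a
    -- constant cost.
    have hsqrt_le : √(√n * sparsity θ) ≤
        (b₁ / 2) ^ (1 / 2 - s) * (√n * sparsity θ) ^ s := by
      have h1 : (√n * sparsity θ) ^ (1 / 2 - s) ≤ (b₁ / 2) ^ (1 / 2 - s) :=
        Real.rpow_le_rpow_of_nonpos (by positivity) hc (by linarith)
      calc √(√n * sparsity θ) = (√n * sparsity θ) ^ (1 / 2 - s) * (√n * sparsity θ) ^ s := by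
            rw [← Real.rpow_add hu0, Real.sqrt_eq_rpow]; congr 1; ring
        _ ≤ _ := by gcongr
    have hWsqrt : T ^ 3 * √n * √(√n * sparsity θ) ≤ (b₁ / 2) ^ (1 / 2 - s) * W := by
      calc _ ≤ T ^ 3 * √n * ((b₁ / 2) ^ (1 / 2 - s) * (√n * sparsity θ) ^ s) := by gcongr
        _ = _ := by rw [hW]; ring
    have hebr := h.ebRisk_le θ hK hκ
    have hsoftpart : ∑ k, ∫⁻ w in {w | kappaEst (fun i => θ i + w i) ≤ b},
        ENNReal.ofReal ((softThreshold a (θ k + w k) - θ k) ^ 2) ∂blockNoise n ≤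
        ENNReal.ofReal (32 * (1 / a ^ 3) + 20 * (1 + 2 * b₁) * W +
          (fourthMoment + 3) * (1 / a ^ 3)) := by
      -- Above 2b, selecting soft thresholding is a rare error. Between b/2 and 2b it is not rare,
      -- but its full risk is affordable.
      rcases le_or_gt (2 * b) (sparsity θ) with hκ2 | hκ2
      · refine (h.sum_setLIntegral_le (sq_nonneg a) hst (hPle hκ2)).trans
          (ENNReal.ofReal_le_ofReal ?_)
        have e1 : 2 * a ^ 2 / n ^ 2 ≤ 2 := by
          have : a ^ 2 ≤ (n : ℝ) ^ 2 := (h.sq_a_le.trans h.T_le).trans (by nlinarith)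
          rw [div_le_iff₀ (by positivity)]
          linarith
        have e2 : (fourthMoment + 1 + 2 * a ^ 2 / n ^ 2) / n ≤ (fourthMoment + 3) * (1 / a ^ 3) := by
          rw [div_eq_mul_one_div]
          exact mul_le_mul (by linarith) hinv (by positivity) (by linarith)
        have : 0 ≤ 20 * (1 + 2 * b₁) * W := by positivity
        linarith
      · refine ((hcard _).trans hsoft).trans (ENNReal.ofReal_le_ofReal ?_)
        have := h.soft_part_le (by linarith : 0 ≤ s) hs hκ2.le
        rw [← hW] at this
        have : 0 ≤ (fourthMoment + 3) * (1 / a ^ 3) := by positivity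
        linarith
    refine (hcase1.trans (add_le_add hebr hsoftpart)).trans ?_
    rw [add_assoc, ← ENNReal.ofReal_add (by positivity) (by positivity)]
    gcongr
    have e1 : ebConst r₁ r₂ K * (T ^ 3 * √n * √(√n * sparsity θ)) ≤
        ebConst r₁ r₂ K * ((b₁ / 2) ^ (1 / 2 - s) * W) := by gcongr
    rw [hoc]
    obtain ⟨Q, hQ⟩ : ∃ Q, Q = ebConst r₁ r₂ K * (b₁ / 2) ^ (1 / 2 - s) := ⟨_, rfl⟩
    have hQ0 : 0 < Q := by rw [hQ]; positivity
    rw [← mul_assoc (ebConst r₁ r₂ K) _ W, ← hQ] at e1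
    rw [← hQ]
    generalize 1 / a ^ 3 = y at *
    generalize (farCount θ (T / 2) : ℝ) = f at *
    generalize 2 / r₁ ^ 2 = q at *
    have p1 : 0 ≤ Q * f + Q * y := by positivity
    have p2 : 0 ≤ 12 * (1 + K) * W + 12 * (1 + K) * y := by positivity
    have p3 : 0 ≤ 32 * W + 32 * f := by positivity
    have p4 : 0 ≤ 20 * (1 + 2 * b₁) * f + 20 * (1 + 2 * b₁) * y := by positivity
    have p5 : 0 ≤ (fourthMoment + 3 + q) * W + (fourthMoment + 3 + q) * f + q * y := by positivity
    linarith
  · have hebpart := h.sum_setLIntegral_le (sq_nonneg _) heb (hPlt hκ.le)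
    have hb2 : sparsity θ ≤ 2 * b := by
      have : 0 ≤ b := hb0
      linarith
    have hsp := h.soft_part_le (by linarith : 0 ≤ s) hs hb2
    rw [← hW] at hsp
    have hsoft' := hsoft.trans (ENNReal.ofReal_le_ofReal hsp)
    refine (hcase2.trans (add_le_add hsoft' hebpart)).trans ?_
    -- For a sparse block the entire risk fits in the remainder, so the Bayes risk is dropped.
    refine le_trans ?_ le_add_self
    rw [← ENNReal.ofReal_add (by positivity) (by positivity)]
    apply ENNReal.ofReal_le_ofReal
    have e1 : 2 * (a ^ 2 / ρ) ^ 2 / n ^ 2 ≤ 2 / r₁ ^ 2 := by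
      have h1 : (a ^ 2 / ρ) ^ 2 ≤ (a * √n / r₁) ^ 2 := by
        have := h.sq_div_rho_le
        gcongr
      have h2 : (a * √n / r₁) ^ 2 = a ^ 2 * n / r₁ ^ 2 := by
        rw [div_pow, mul_pow, Real.sq_sqrt h.n_pos.le]
      have h3 : a ^ 2 * n ≤ (n : ℝ) ^ 2 := by
        have := h.sq_a_le.trans h.T_le
        nlinarith
      rw [div_le_div_iff₀ (by positivity) (by positivity)]
      have h4 : (a ^ 2 / ρ) ^ 2 * r₁ ^ 2 ≤ n ^ 2 := by
        rw [h2] at h1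
        calc _ ≤ a ^ 2 * n / r₁ ^ 2 * r₁ ^ 2 := by gcongr
          _ = a ^ 2 * n := by field_simp
          _ ≤ _ := h3
      linarith
    have e2 : (fourthMoment + 1 + 2 * (a ^ 2 / ρ) ^ 2 / n ^ 2) / n ≤
        (fourthMoment + 1 + 2 / r₁ ^ 2) * (1 / a ^ 3) := by
      rw [div_eq_mul_one_div _ (n : ℝ)]
      gcongr
    rw [hoc]
    obtain ⟨Q, hQ⟩ : ∃ Q, Q = ebConst r₁ r₂ K * (b₁ / 2) ^ (1 / 2 - s) := ⟨_, rfl⟩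
    have hQ0 : 0 < Q := by rw [hQ]; positivity
    rw [← hQ]
    generalize 1 / a ^ 3 = y at *
    generalize (farCount θ (T / 2) : ℝ) = f at *
    generalize 2 / r₁ ^ 2 = q at *
    have p1 : 0 ≤ Q * W + Q * f + Q * y := by positivity
    have p2 : 0 ≤ 12 * (1 + K) * W + 12 * (1 + K) * f + 12 * (1 + K) * y := by positivity
    have p3 : 0 ≤ 32 * W + 32 * f := by positivity
    have p4 : 0 ≤ 20 * (1 + 2 * b₁) * f + 20 * (1 + 2 * b₁) * y := by positivity
    have p5 : 0 ≤ (fourthMoment + 3 + q) * W + (fourthMoment + 3 + q) * f + 2 * y := by positivity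
    linarith

/-! ### Numerical relations for all large block sizes. -/

lemma eventually_mul_log_le_rpow {c s : ℝ} (hc : 0 < c) (hs : 0 < s) :
    ∀ᶠ n : ℕ in atTop, Real.log n ≤ c * (n : ℝ) ^ s := by
  have h := (isLittleO_log_rpow_atTop hs).def hc
  filter_upwards [tendsto_natCast_atTop_atTop.eventually h] with n hn
  have h1 : 0 ≤ (n : ℝ) ^ s := by positivity
  rw [Real.norm_eq_abs, Real.norm_eq_abs, abs_of_nonneg h1] at hn
  exact (le_abs_self _).trans hn

lemma cube_mul_exp_le_one {c s : ℝ} (hc : 0 < c) (hs : 0 < s) :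
    ∀ᶠ n : ℕ in atTop, (n : ℝ) ^ 3 * Real.exp (-(c * ((n : ℝ) ^ s) ^ 2)) ≤ 1 := by
  filter_upwards [eventually_mul_log_le_rpow (by positivity : 0 < c / 3)
    (by positivity : 0 < s * 2), eventually_gt_atTop 0] with n hn hn0
  have h0 : (0 : ℝ) < n := by exact_mod_cast hn0
  rw [← Real.rpow_natCast ((n : ℝ) ^ s), ← Real.rpow_mul h0.le, ← Real.exp_log h0,
    ← Real.exp_nat_mul, ← Real.exp_add, Real.exp_le_one_iff, Real.exp_log h0]
  push_cast
  linarith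

/-- All large blocks satisfy the numerical relations of `LargeBlock`. -/
theorem eventually_largeBlock {ρ₀ b₀ : ℝ} (hρ₀ : 0 < ρ₀) (hb₀ : 0 < b₀) {η : ℕ → ℝ}
    (hη : Tendsto η atTop (𝓝 0)) {g : ℝ} (hg0 : 0 < g) (hg : g ≤ 1 / 2) :
    ∀ᶠ n : ℕ in atTop, LargeBlock (ρ₀ / 2) (2 * ρ₀) b₀ n (√(2 * Real.log n)) (rhoLevel ρ₀ η n)
      (switchLevel b₀ n) ((n : ℝ) ^ g) := by
  have hlog : Tendsto (fun n : ℕ => Real.log n) atTop atTop :=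
    Real.tendsto_log_atTop.comp tendsto_natCast_atTop_atTop
  have hsqrt : Tendsto (fun n : ℕ => √(n : ℝ)) atTop atTop :=
    Real.tendsto_sqrt_atTop.comp tendsto_natCast_atTop_atTop
  have hη1 : ∀ᶠ n in atTop, |η n| < 1 / 2 := by
    have := (Metric.tendsto_nhds.1 hη) (1 / 2) (by norm_num)
    filter_upwards [this] with n hn
    simpa [Real.dist_eq] using hn
  filter_upwards [eventually_ge_atTop 1, hη1, hlog.eventually_ge_atTop 1,
    hlog.eventually_ge_atTop (160 / b₀ ^ 2), hsqrt.eventually_ge_atTop (16 / (ρ₀ / 2)),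
    eventually_mul_log_le_rpow (by norm_num : (0 : ℝ) < 1 / 2) hg0,
    cube_mul_exp_le_one (by positivity : 0 < (ρ₀ / 2) ^ 2 / 32) hg0,
    cube_mul_exp_le_one (by norm_num : (0 : ℝ) < 1 / 32) hg0] with n hn hηn hl1 hl2 hs hlT e1 e2
  have h0 : (0 : ℝ) < n := by exact_mod_cast hn
  have h1 : (1 : ℝ) ≤ n := by exact_mod_cast hn
  have hsq0 : 0 < √(n : ℝ) := Real.sqrt_pos.2 h0
  have ha2 : √(2 * Real.log n) ^ 2 = 2 * Real.log n := Real.sq_sqrt (by linarith)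
  have hrho : rhoLevel ρ₀ η n = (1 + η n) * (ρ₀ * (√(2 * Real.log n) / √n)) := by
    unfold rhoLevel
    rw [Real.sqrt_div (by linarith)]
    ring
  rw [abs_lt] at hηn
  have hP : 0 ≤ ρ₀ * (√(2 * Real.log n) / √n) := by positivity
  refine ⟨h0, ?_, ?_, ?_, ?_, ?_, ?_, by positivity, ?_, e1, e2, hb₀, ?_, ?_, ?_⟩
  · rw [Real.one_le_sqrt]; linarith
  · rw [ha2]; linarith
  · rw [← Real.rpow_natCast, ← Real.rpow_mul h0.le]
    nth_rewrite 2 [← Real.rpow_one (n : ℝ)]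
    apply Real.rpow_le_rpow_of_exponent_le h1
    push_cast
    linarith
  · rw [neg_div, ha2, mul_div_cancel_left₀ _ two_ne_zero, Real.exp_neg, Real.exp_log h0, one_div]
  · rw [hrho]
    calc ρ₀ / 2 * √(2 * Real.log n) / √n = 1 / 2 * (ρ₀ * (√(2 * Real.log n) / √n)) := by ring
      _ ≤ _ := mul_le_mul_of_nonneg_right (by linarith) hP
  · rw [hrho]
    calc _ ≤ 2 * (ρ₀ * (√(2 * Real.log n) / √n)) := mul_le_mul_of_nonneg_right (by linarith) hP
      _ = _ := by ring
  · rw [div_le_iff₀ (by positivity)] at hs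
    linarith
  · unfold switchLevel
    gcongr
    exact le_mul_of_one_le_right hb₀.le hl1
  · unfold switchLevel
    gcongr
    linarith
  · have hnb : n * switchLevel b₀ n ^ 2 = b₀ ^ 2 * Real.log n ^ 2 := by
      unfold switchLevel
      rw [div_pow, mul_pow, Real.sq_sqrt h0.le]
      field_simp
    rw [hnb]
    have hinv : 1 / (n : ℝ) = Real.exp (-Real.log n) := by
      rw [Real.exp_neg, Real.exp_log h0, one_div]
    rw [hinv, ← Real.exp_nat_mul, ← Real.exp_nat_mul, Real.exp_le_exp]
    -- The requirement is b₀² (log n)²/16 ≥ 10 log n, whence the threshold 160/b₀² for log n.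
    rw [div_le_iff₀ (by positivity)] at hl2
    push_cast
    nlinarith [mul_le_mul_of_nonneg_right hl2 (by linarith : 0 ≤ Real.log n)]

/-! ### Reduction of the sequence model to standardized blocks -/

/-- The standardized means of a block. -/
def blockMeans (ε : ℝ) (β : Seq) (l : ℕ) : Fin (blockSize l) → ℝ := fun k => β ⟨l, k⟩ / ε

lemma risk_eq_tsum (ε : ℝ) (δ : Seq → Seq) (β : Seq) :
    risk ε δ β = ∑' l, ∑ k : Fin (blockSize l),
      ∫⁻ z, ENNReal.ofReal ((δ (obs ε β z) ⟨l, k⟩ - β ⟨l, k⟩) ^ 2) ∂noise := by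
  unfold risk
  rw [ENNReal.tsum_sigma']
  simp only [tsum_fintype]

lemma lintegral_noise_eval (i : Idx) {f : ℝ → ℝ≥0∞} (hf : Measurable f) :
    ∫⁻ z, f (z i) ∂noise = ∫⁻ x, f x ∂stdGauss :=
  (measurePreserving_eval_infinitePi (fun _ : Idx => gaussianReal 0 1) i).lintegral_comp hf

/-- Currying makes the infinite product over pairs a product of block products; evaluating at `l`
then gives the finite product. -/
lemma map_noise_block (l : ℕ) :
    noise.map (fun z (k : Fin (blockSize l)) => z ⟨l, k⟩) = blockNoise (blockSize l) := by
  have h1 := Measure.infinitePi_map_piCurry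
    (fun (l : ℕ) (_ : Fin (blockSize l)) => (gaussianReal 0 1 : Measure ℝ))
  have h2 := Measure.infinitePi_map_eval (fun l : ℕ =>
    Measure.infinitePi fun (_ : Fin (blockSize l)) => (gaussianReal 0 1 : Measure ℝ)) l
  rw [← h1, Measure.map_map (by fun_prop) (by fun_prop),
    Measure.infinitePi_eq_pi (ι := Fin (blockSize l))] at h2
  exact h2

lemma lintegral_noise_block (l : ℕ) {F : (Fin (blockSize l) → ℝ) → ℝ≥0∞} (hF : Measurable F) :
    ∫⁻ z, F (fun k => z ⟨l, k⟩) ∂noise = ∫⁻ w, F w ∂blockNoise (blockSize l) := by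
  rw [← map_noise_block, lintegral_map hF (by fun_prop)]

lemma neZero_blockSize (l : ℕ) : NeZero (blockSize l) := by
  cases l with
  | zero => exact ⟨one_ne_zero⟩
  | succ j => exact ⟨by unfold blockSize; positivity⟩

lemma separable_block_risk {ε : ℝ} (hε : 0 < ε) (β : Seq) {h : ℝ → ℝ} (hh : Measurable h) (l : ℕ) :
    ∑ k : Fin (blockSize l),
      ∫⁻ z, ENNReal.ofReal ((h (obs ε β z ⟨l, k⟩) - β ⟨l, k⟩) ^ 2) ∂noise =
    ENNReal.ofReal (ε ^ 2) * ruleRisk (blockMeans ε β l) (fun x => h (ε * x) / ε) := by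
  unfold ruleRisk
  rw [Finset.mul_sum]
  refine Finset.sum_congr rfl fun k _ => ?_
  unfold obs blockMeans
  rw [lintegral_noise_eval ⟨l, k⟩ (f := fun x => ENNReal.ofReal
      ((h (β ⟨l, k⟩ + ε * x) - β ⟨l, k⟩) ^ 2)) (by fun_prop),
    ← lintegral_const_mul _ (by fun_prop)]
  refine lintegral_congr fun x => ?_
  rw [← ENNReal.ofReal_mul (by positivity), ← mul_pow, mul_sub, mul_div_cancel₀ _ hε.ne',
    mul_add, mul_div_cancel₀ _ hε.ne']

/-- The ideal separable risk dominates the sum of the Bayes risks of the blocks. -/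
theorem tsum_ruleRisk_le_idealRisk {ε : ℝ} (hε : 0 < ε) (β : Seq) :
    ∑' l, ENNReal.ofReal (ε ^ 2) *
      ruleRisk (blockMeans ε β l) (bayesRule (blockMeans ε β l)) ≤ idealRisk ε β := by
  unfold idealRisk
  refine le_iInf₂ fun δ hδ => ?_
  obtain ⟨h, hh, hδ⟩ := hδ
  rw [risk_eq_tsum]
  refine ENNReal.tsum_le_tsum fun l => ?_
  simp only [hδ]
  rw [separable_block_risk hε β (hh l)]
  have := neZero_blockSize l
  gcongr
  exact ruleRisk_bayesRule_le _ (by have := hh l; fun_prop)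

lemma measurable_hybridRule_sub {n : ℕ} (θ : Fin n → ℝ) (ρ₀ b₀ : ℝ) (η : ℕ → ℝ) (k : Fin n) :
    Measurable fun w : Fin n → ℝ =>
      hybridRule ρ₀ b₀ η (fun i => θ i + w i) (θ k + w k) - θ k := by
  classical
  have e : (fun w : Fin n → ℝ => hybridRule ρ₀ b₀ η (fun i => θ i + w i) (θ k + w k) - θ k) =
      fun w => if switchLevel b₀ n < kappaEst (fun i => θ i + w i) then
        ebError θ (√(2 * Real.log n)) (rhoLevel ρ₀ η n) k w
      else softThreshold (√(2 * Real.log n)) (θ k + w k) - θ k := by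
    ext w
    split_ifs with hw
    · exact hybridRule_sub_of_lt θ ρ₀ b₀ η hw k
    · exact hybridRule_sub_of_le θ ρ₀ b₀ η (not_lt.1 hw) k
  rw [e]
  refine Measurable.ite (measurableSet_lt measurable_const (measurable_kappaEst θ))
    (measurable_ebError θ _ _ k) ?_
  exact ((measurable_softThreshold _).comp (by fun_prop)).sub_const _

lemma geb_block_risk_of_lt {jstar l : ℕ} (hl : l < jstar + 1) (ρ₀ b₀ : ℝ) (η : ℕ → ℝ) (ε : ℝ)
    (β : Seq) :
    ∑ k : Fin (blockSize l), ∫⁻ z, ENNReal.ofReal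
      ((gebEstimator jstar ρ₀ b₀ η ε (obs ε β z) ⟨l, k⟩ - β ⟨l, k⟩) ^ 2) ∂noise =
    ENNReal.ofReal (ε ^ 2) * blockSize l := by
  have : ∀ k : Fin (blockSize l), ∫⁻ z, ENNReal.ofReal
      ((gebEstimator jstar ρ₀ b₀ η ε (obs ε β z) ⟨l, k⟩ - β ⟨l, k⟩) ^ 2) ∂noise =
      ENNReal.ofReal (ε ^ 2) := by
    intro k
    unfold gebEstimator obs
    simp only [hl, if_true, add_sub_cancel_left]
    rw [lintegral_noise_eval ⟨l, k⟩ (f := fun x => ENNReal.ofReal ((ε * x) ^ 2)) (by fun_prop)]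
    simp_rw [mul_pow, ENNReal.ofReal_mul (sq_nonneg ε)]
    rw [lintegral_const_mul _ (by fun_prop), lintegral_sq_stdGauss, mul_one]
  rw [Finset.sum_congr rfl fun k _ => this k]
  simp [mul_comm]

lemma geb_block_risk_of_ge {jstar l : ℕ} (hl : ¬ l < jstar + 1) (ρ₀ b₀ : ℝ) (η : ℕ → ℝ) {ε : ℝ}
    (hε : 0 < ε) (β : Seq) :
    ∑ k : Fin (blockSize l), ∫⁻ z, ENNReal.ofReal
      ((gebEstimator jstar ρ₀ b₀ η ε (obs ε β z) ⟨l, k⟩ - β ⟨l, k⟩) ^ 2) ∂noise =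
    ENNReal.ofReal (ε ^ 2) * hybridRisk (blockMeans ε β l) ρ₀ b₀ η := by
  unfold hybridRisk
  rw [Finset.mul_sum]
  refine Finset.sum_congr rfl fun k _ => ?_
  obtain ⟨F, hF⟩ : ∃ F : (Fin (blockSize l) → ℝ) → ℝ, F = fun w => hybridRule ρ₀ b₀ η
    (fun i => blockMeans ε β l i + w i) (blockMeans ε β l k + w k) - blockMeans ε β l k := ⟨_, rfl⟩
  have hm : Measurable fun w => ENNReal.ofReal (F w ^ 2) := by
    have : Measurable F := by
      rw [hF]
      exact measurable_hybridRule_sub (blockMeans ε β l) ρ₀ b₀ η k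
    fun_prop
  have e1 : ∫⁻ w, ENNReal.ofReal ((hybridRule ρ₀ b₀ η (fun i => blockMeans ε β l i + w i)
      (blockMeans ε β l k + w k) - blockMeans ε β l k) ^ 2) ∂blockNoise (blockSize l) =
      ∫⁻ w, ENNReal.ofReal (F w ^ 2) ∂blockNoise (blockSize l) := by rw [hF]
  have hm' : Measurable fun z : Seq => ENNReal.ofReal (F (fun k => z ⟨l, k⟩) ^ 2) :=
    hm.comp (by fun_prop : Measurable fun (z : Seq) (k : Fin (blockSize l)) => z ⟨l, k⟩)
  rw [e1, ← lintegral_noise_block l hm, ← lintegral_const_mul _ hm']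
  refine lintegral_congr fun z => ?_
  rw [← ENNReal.ofReal_mul (by positivity), ← mul_pow, hF]
  unfold gebEstimator obs blockMeans
  simp only [hl, if_false]
  have e : ∀ k' : Fin (blockSize l), (β ⟨l, k'⟩ + ε * z ⟨l, k'⟩) / ε =
      β ⟨l, k'⟩ / ε + z ⟨l, k'⟩ := fun k' => by field_simp
  simp only [e]
  rw [mul_sub, mul_div_cancel₀ _ hε.ne']

/-! ### Power means and Besov balls -/

/-- The mean of the `r`-th powers of the absolute values. -/
def powMean {n : ℕ} (r : ℝ) (θ : Fin n → ℝ) : ℝ := (1 / (n : ℝ)) * ∑ k, |θ k| ^ r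

/-- A mean with |θ_k| ≥ 1 contributes at most 1; for |θ_k| < 1, 1 - exp(-θ_k²/4) ≤ θ_k² ≤ |θ_k|^r
because r ≤ 2. -/
lemma sparsity_le_powMean {n : ℕ} {r : ℝ} (hr : 0 < r) (hr2 : r ≤ 2) (θ : Fin n → ℝ) :
    sparsity θ ≤ powMean r θ := by
  unfold sparsity powMean
  gcongr with k _
  rcases le_or_gt 1 |θ k| with h | h
  · have h1 := Real.one_le_rpow h hr.le
    have := Real.exp_pos (-(θ k) ^ 2 / 4)
    linarith
  · have h0 := abs_nonneg (θ k)
    have h1 : |θ k| ^ (2 : ℝ) ≤ |θ k| ^ r := Real.rpow_le_rpow_of_exponent_ge' h0 h.le hr.le hr2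
    rw [Real.rpow_two, sq_abs] at h1
    have := Real.add_one_le_exp (-(θ k) ^ 2 / 4)
    nlinarith [sq_nonneg (θ k)]

/-- Markov's inequality. The fraction of far means is at most 1, so it only grows when raised to a
power t ≤ 1; this freedom tunes the exponent of λ later. -/
lemma farCount_le_powMean {n : ℕ} {r y t : ℝ} (hr : 0 < r) (hy : 0 < y) (ht0 : 0 ≤ t) (ht : t ≤ 1)
    (θ : Fin n → ℝ) : (farCount θ y : ℝ) ≤ n * (powMean r θ / y ^ r) ^ t := by
  rcases Nat.eq_zero_or_pos n with rfl | hn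
  · simp [farCount]
  have hn0 : (0 : ℝ) < n := by exact_mod_cast hn
  have hyr : 0 < y ^ r := by positivity
  have h1 : (farCount θ y : ℝ) / n ≤ powMean r θ / y ^ r := by
    unfold powMean farCount
    rw [le_div_iff₀ hyr, div_eq_inv_mul, ← one_div, mul_assoc]
    gcongr
    rw [← nsmul_eq_mul]
    calc _ ≤ ∑ k ∈ Finset.univ.filter fun k => y < |θ k|, |θ k| ^ r :=
          Finset.card_nsmul_le_sum _ _ _ fun k hk => by
            have := (Finset.mem_filter.1 hk).2
            gcongr
      _ ≤ _ := Finset.sum_le_sum_of_subset_of_nonneg (Finset.filter_subset _ _)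
          fun k _ _ => by positivity
  have h2 : (farCount θ y : ℝ) / n ≤ 1 := by
    rw [div_le_one hn0]
    unfold farCount
    exact_mod_cast (Finset.card_filter_le _ _).trans (by simp)
  have h0 : 0 ≤ (farCount θ y : ℝ) / n := by positivity
  calc (farCount θ y : ℝ) = n * ((farCount θ y : ℝ) / n) ^ (1 : ℝ) := by
        rw [Real.rpow_one]; field_simp
    _ ≤ n * ((farCount θ y : ℝ) / n) ^ t := by
        refine mul_le_mul_of_nonneg_left ?_ hn0.le
        exact Real.rpow_le_rpow_of_exponent_ge' h0 h2 ht0 ht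
    _ ≤ _ := by gcongr

/-- Monotonicity of power means in the exponent. -/
lemma powMean_le_rpow {n : ℕ} [NeZero n] {r p : ℝ} (hr : 0 < r) (hrp : r ≤ p) (θ : Fin n → ℝ) :
    powMean r θ ≤ ((1 / (n : ℝ)) * ∑ k, |θ k| ^ p) ^ (r / p) := by
  have hn0 : (0 : ℝ) < n := by exact_mod_cast Nat.pos_of_ne_zero (NeZero.ne n)
  have := Real.arith_mean_le_rpow_mean Finset.univ (fun _ : Fin n => 1 / (n : ℝ))
    (fun k => |θ k| ^ r) (fun _ _ => by positivity) (by simp [hn0.ne']) (fun _ _ => by positivity)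
    (p := p / r) (by rwa [one_le_div hr])
  unfold powMean
  rw [Finset.mul_sum, Finset.mul_sum]
  refine this.trans (le_of_eq ?_)
  rw [one_div_div]
  congr 1
  refine Finset.sum_congr rfl fun k _ => ?_
  rw [← Real.rpow_mul (abs_nonneg _), mul_div_cancel₀ _ hr.ne']

lemma le_lpSum {ι : Type} {p : ℝ≥0∞} (hp : 0 < p) (a : ι → ℝ≥0∞) (i : ι) : a i ≤ lpSum p a := by
  unfold lpSum
  split_ifs with h
  · exact le_iSup a i
  · have hp0 : 0 < p.toReal := ENNReal.toReal_pos hp.ne' h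
    calc a i = (a i ^ p.toReal) ^ (1 / p.toReal) := by
          rw [← ENNReal.rpow_mul, mul_one_div_cancel hp0.ne', ENNReal.rpow_one]
      _ ≤ _ := by
          gcongr
          exact ENNReal.le_tsum (f := fun i => a i ^ p.toReal) i

/-- In a Besov ball the power means of the blocks decay geometrically. -/
lemma powMean_le_of_mem_besovBall {α : ℝ} {p q : ℝ≥0∞} (hq : 0 < q) {C : ℝ} (hC : 0 < C)
    {β : Seq} (hβ : β ∈ besovBall α p q C) {r : ℝ} (hr : 0 < r) (hrp : ENNReal.ofReal r ≤ p)
    {ε : ℝ} (hε : 0 < ε) (j : ℕ) :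
    powMean r (blockMeans ε β (j + 1)) ≤
      (C / ε) ^ r * ((2 ^ j : ℕ) : ℝ) ^ (-(r * (α + 1 / 2))) := by
  have hp : 0 < p := lt_of_lt_of_le (ENNReal.ofReal_pos.2 hr) hrp
  -- One block is bounded by the whole ℓ_q norm, whatever q is.
  have h1 := (le_lpSum hq (fun l : ℕ => ENNReal.ofReal (besovWeight α p l) *
    lpSum p fun k : Fin (blockSize l) => ENNReal.ofReal |β ⟨l, k⟩|) (j + 1)).trans hβ
  have hx0 : (0 : ℝ) < ((2 ^ j : ℕ) : ℝ) := by positivity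
  have hw : besovWeight α p (j + 1) = ((2 ^ j : ℕ) : ℝ) ^ (α + 1 / 2 - (p⁻¹).toReal) := by
    unfold besovWeight
    push_cast
    rw [Real.rpow_mul (by norm_num), Real.rpow_natCast]
  obtain ⟨x, hx⟩ : ∃ x : ℝ, x = ((2 ^ j : ℕ) : ℝ) := ⟨_, rfl⟩
  simp only [hw] at h1
  have hsz : ((blockSize (j + 1) : ℕ) : ℝ) = x := hx.symm
  rw [← hx] at hx0 h1 ⊢
  have := neZero_blockSize (j + 1)
  have hfin : x ^ (-(r * (α + 1 / 2))) = (x ^ (-(α + 1 / 2))) ^ r := by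
    rw [← Real.rpow_mul hx0.le]; congr 1; ring
  rcases eq_or_ne p ∞ with rfl | hpt
  · have hk : ∀ k, |blockMeans ε β (j + 1) k| ≤ C / ε * x ^ (-(α + 1 / 2)) := by
      intro k
      have h2 : ENNReal.ofReal |β ⟨j + 1, k⟩| ≤
          lpSum ∞ fun k : Fin (blockSize (j + 1)) => ENNReal.ofReal |β ⟨j + 1, k⟩| :=
        le_lpSum hp (fun k : Fin (blockSize (j + 1)) => ENNReal.ofReal |β ⟨j + 1, k⟩|) k
      have h3 := (mul_le_mul_right h2 _).trans h1
      rw [← ENNReal.ofReal_mul (by positivity), ENNReal.ofReal_le_ofReal_iff hC.le] at h3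
      simp only [ENNReal.inv_top, ENNReal.toReal_zero, sub_zero] at h3
      unfold blockMeans
      rw [abs_div, abs_of_pos hε, Real.rpow_neg hx0.le, ← div_eq_mul_inv, div_div, mul_comm ε,
        ← div_div]
      gcongr
      rw [le_div_iff₀ (by positivity)]
      linarith
    unfold powMean
    rw [hsz, hfin, ← Real.mul_rpow (by positivity) (by positivity)]
    calc _ ≤ 1 / x * ∑ _k : Fin (blockSize (j + 1)), (C / ε * x ^ (-(α + 1 / 2))) ^ r := by
          gcongr with k _
          exact hk k
      _ = _ := by
          rw [Finset.sum_const, Finset.card_univ, Fintype.card_fin, nsmul_eq_mul, hsz]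
          field_simp
  · have hp0 : 0 < p.toReal := ENNReal.toReal_pos hp.ne' hpt
    have hrp' : r ≤ p.toReal := (ENNReal.ofReal_le_iff_le_toReal hpt).1 hrp
    refine (powMean_le_rpow hr hrp' _).trans ?_
    rw [hsz]
    unfold lpSum at h1
    rw [if_neg hpt, tsum_fintype] at h1
    have e1 : ∀ k : Fin (blockSize (j + 1)), ENNReal.ofReal |β ⟨j + 1, k⟩| ^ p.toReal =
        ENNReal.ofReal (|β ⟨j + 1, k⟩| ^ p.toReal) := fun k =>
      ENNReal.ofReal_rpow_of_nonneg (abs_nonneg _) hp0.le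
    simp only [e1] at h1
    rw [← ENNReal.ofReal_sum_of_nonneg fun k _ => by positivity,
      ENNReal.ofReal_rpow_of_nonneg (Finset.sum_nonneg fun k _ => by positivity) (by positivity),
      ← ENNReal.ofReal_mul (by positivity), ENNReal.ofReal_le_ofReal_iff hC.le,
      ENNReal.toReal_inv] at h1
    generalize p.toReal = P at *
    have e2 : ∑ k, |blockMeans ε β (j + 1) k| ^ P =
        (1 / ε) ^ P * ∑ k : Fin (blockSize (j + 1)), |β ⟨j + 1, k⟩| ^ P := by
      rw [Finset.mul_sum]
      refine Finset.sum_congr rfl fun k _ => ?_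
      rw [← Real.mul_rpow (by positivity) (by positivity)]
      unfold blockMeans
      rw [abs_div, abs_of_pos hε]
      congr 1
      ring
    rw [e2]
    obtain ⟨Q, hQ⟩ : ∃ Q, Q = ∑ k : Fin (blockSize (j + 1)), |β ⟨j + 1, k⟩| ^ P := ⟨_, rfl⟩
    have hQ0 : 0 ≤ Q := by rw [hQ]; exact Finset.sum_nonneg fun k _ => by positivity
    rw [← hQ] at h1 ⊢
    have e3 : (1 / x * ((1 / ε) ^ P * Q)) ^ (r / P) =
        (1 / ε * (x ^ (-(1 / P)) * Q ^ (1 / P))) ^ r := by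
      rw [div_eq_mul_one_div r P, mul_comm r, Real.rpow_mul (by positivity),
        Real.mul_rpow (by positivity) (by positivity), Real.mul_rpow (by positivity) hQ0,
        ← Real.rpow_mul (by positivity), mul_one_div_cancel hp0.ne', Real.rpow_one,
        Real.rpow_neg hx0.le, one_div x, Real.inv_rpow hx0.le]
      congr 1
      ring
    rw [e3, hfin, ← Real.mul_rpow (by positivity) (by positivity), div_eq_mul_one_div C, mul_comm C,
      mul_assoc]
    refine Real.rpow_le_rpow (by positivity) (mul_le_mul_of_nonneg_left ?_ (by positivity)) hr.le
    -- The normalization n^(-1/p) of the power mean completes the Besov weight to n^(α+1/2).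
    calc x ^ (-(1 / P)) * Q ^ (1 / P) =
          x ^ (-(α + 1 / 2)) * (x ^ (α + 1 / 2 - P⁻¹) * Q ^ (1 / P)) := by
          rw [← mul_assoc, ← Real.rpow_add hx0]
          congr 2
          rw [one_div]; ring
      _ ≤ x ^ (-(α + 1 / 2)) * C := by gcongr
      _ = _ := mul_comm _ _

/-! ### Summation over the blocks -/

/-- With s = 1/(1 + 3d/2) the power (1+d)s of lam is below 1. The total power of x, apart from the
factor (x^(d/42))³ = x^(d/14), is 1/2 - s(1/2 + d) = -ds/4. As d ≤ 1/2 gives s ≥ 4/7, this is at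
most -d/7, and -d/14 is left. -/
lemma sparsity_term_le {A lam x κ d : ℝ} (hA : 0 < A) (hlam : 0 < lam) (hx : 1 ≤ x) (hκ0 : 0 ≤ κ)
    (hκ : κ ≤ A * (lam / x) ^ (1 + d)) (hd : 0 < d) (hd2 : d ≤ 1 / 2) :
    (x ^ (d / 42)) ^ 3 * √x * (√x * κ) ^ (1 / (1 + 3 * d / 2)) ≤
      A ^ (1 / (1 + 3 * d / 2)) * lam ^ ((1 + d) / (1 + 3 * d / 2)) * x ^ (-(d / 14)) := by
  have hx0 : 0 < x := by linarith
  have hD : 0 < 1 + 3 * d / 2 := by linarith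
  obtain ⟨s, hs⟩ : ∃ s, s = 1 / (1 + 3 * d / 2) := ⟨_, rfl⟩
  have hs0 : 0 < s := by rw [hs]; positivity
  have hσ : (1 + d) / (1 + 3 * d / 2) = (1 + d) * s := by rw [hs]; ring
  rw [hσ, ← hs]
  have hexp : 3 * (d / 42) + 1 / 2 + (1 / 2 * s + -(1 + d) * s) ≤ -(d / 14) := by
    have : s * (1 / 2 + d) = 1 / 2 + d / 4 * s := by
      rw [hs]; field_simp; ring
    have h7 : 4 / 7 ≤ s := by
      rw [hs, le_div_iff₀ hD]; linarith
    nlinarith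
  calc (x ^ (d / 42)) ^ 3 * √x * (√x * κ) ^ s
      ≤ (x ^ (d / 42)) ^ 3 * √x * (√x * (A * (lam / x) ^ (1 + d))) ^ s := by gcongr
    _ = A ^ s * lam ^ ((1 + d) * s) *
        x ^ (3 * (d / 42) + 1 / 2 + (1 / 2 * s + -(1 + d) * s)) := by
        rw [Real.mul_rpow (by positivity) (by positivity),
          Real.mul_rpow (by positivity) (by positivity), ← Real.rpow_mul (by positivity),
          Real.div_rpow hlam.le hx0.le, Real.sqrt_eq_rpow, Real.rpow_add hx0, Real.rpow_add hx0,
          Real.rpow_add hx0, ← Real.rpow_mul hx0.le, neg_mul, Real.rpow_neg hx0.le,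
          mul_comm (3 : ℝ), Real.rpow_mul hx0.le _ 3]
        norm_num
        ring
    _ ≤ _ := by gcongr

/-- Markov at T/2 with T = n^g gains n^(-gr) before the power t. Half of this gain brings (1+d)t
below 1; the other half is the decay in `n`. -/
lemma far_term_le {n : ℕ} {A lam d r g t : ℝ} (hA : 0 < A) (hlam : 0 < lam) (hn : 1 ≤ (n : ℝ))
    (hr : 0 < r) (hd : 0 < d) (hg : 0 < g) (ht : t = 1 / (1 + d + g * r / 2)) {θ : Fin n → ℝ}
    (hθ : powMean r θ ≤ A * (lam / n) ^ (1 + d)) :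
    (farCount θ ((n : ℝ) ^ g / 2) : ℝ) ≤
      (A * 2 ^ r) ^ t * lam ^ ((1 + d) * t) * (n : ℝ) ^ (-(g * r / 2 * t)) := by
  have hx0 : 0 < (n : ℝ) := by linarith
  have hD : 0 < 1 + d + g * r / 2 := by positivity
  have ht0 : 0 < t := by rw [ht]; positivity
  have ht1 : t ≤ 1 := by
    rw [ht, div_le_one hD]
    have : 0 < g * r := by positivity
    linarith
  have hP : 0 ≤ powMean r θ := by
    unfold powMean
    positivity
  refine (farCount_le_powMean hr (by positivity) ht0.le ht1 θ).trans ?_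
  generalize (n : ℝ) = x at *
  have hexp : -(g * r / 2 * t) = 1 + -(1 + d) * t + -(g * r) * t := by
    rw [ht]; field_simp; ring
  have e : A * (lam / x) ^ (1 + d) / (x ^ g / 2) ^ r =
      (A * 2 ^ r) * lam ^ (1 + d) * (x ^ (-(1 + d)) * x ^ (-(g * r))) := by
    rw [Real.div_rpow hlam.le hx0.le, Real.div_rpow (by positivity) (by norm_num),
      ← Real.rpow_mul hx0.le, Real.rpow_neg hx0.le, Real.rpow_neg hx0.le]
    field_simp
  have hden : 0 ≤ (x ^ g / 2) ^ r := by positivity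
  calc x * (powMean r θ / (x ^ g / 2) ^ r) ^ t
      ≤ x * (A * (lam / x) ^ (1 + d) / (x ^ g / 2) ^ r) ^ t := by gcongr
    _ = _ := by
        rw [e, hexp, Real.rpow_add hx0, Real.rpow_add hx0, Real.rpow_one,
          Real.mul_rpow (by positivity) (by positivity),
          Real.mul_rpow (by positivity) (by positivity),
          Real.mul_rpow (by positivity) (by positivity), ← Real.rpow_mul hlam.le,
          Real.mul_rpow (x := x ^ (-(1 + d))) (by positivity) (by positivity),
          ← Real.rpow_mul hx0.le, ← Real.rpow_mul hx0.le]
        ring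

lemma summable_two_pow_rpow {e : ℝ} (he : 0 < e) :
    Summable fun j : ℕ => ((2 ^ j : ℕ) : ℝ) ^ (-e) := by
  have h : ∀ j : ℕ, ((2 ^ j : ℕ) : ℝ) ^ (-e) = ((2 : ℝ) ^ (-e)) ^ j := fun j => by
    push_cast
    rw [← Real.rpow_natCast, ← Real.rpow_natCast, ← Real.rpow_mul (by norm_num),
      ← Real.rpow_mul (by norm_num), mul_comm]
  simp_rw [h]
  exact summable_geometric_of_lt_one (by positivity)
    (Real.rpow_lt_one_of_one_lt_of_neg (by norm_num) (by linarith))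

/-- log(2^j) is proportional to j, so the terms are multiples of j^(-3/2); at j = 0 both forms are
1/0 = 0. -/
lemma summable_one_div_sqrt_log_cube :
    Summable fun j : ℕ => 1 / √(2 * Real.log ((2 ^ j : ℕ) : ℝ)) ^ 3 := by
  have hl : 0 < 2 * Real.log 2 := by positivity
  have h : ∀ j : ℕ, 1 / √(2 * Real.log ((2 ^ j : ℕ) : ℝ)) ^ 3 =
      1 / √(2 * Real.log 2) ^ 3 * (1 / (j : ℝ) ^ (3 / 2 : ℝ)) := fun j => by
    push_cast
    rw [Real.log_pow, mul_left_comm, Real.sqrt_mul (Nat.cast_nonneg _), mul_pow,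
      Real.sqrt_eq_rpow (j : ℝ), ← Real.rpow_natCast (_ ^ (1 / 2 : ℝ)),
      ← Real.rpow_mul (Nat.cast_nonneg _)]
    norm_num
  simp_rw [h]
  exact (Real.summable_one_div_nat_rpow.2 (by norm_num)).mul_left _

/-- Choice of the exponent used to measure the sparsity of a block. -/
lemma exists_exponent {κ : ℝ} (hκ : 1 / 2 < κ) {p : ℝ≥0∞} (hp : ENNReal.ofReal (1 / κ) < p) :
    ∃ r : ℝ, 0 < r ∧ r ≤ 2 ∧ ENNReal.ofReal r ≤ p ∧ 1 < r * κ ∧ r * κ ≤ 3 / 2 := by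
  have hκ0 : 0 < κ := by linarith
  -- The caps encode r ≤ 2, for `sparsity_le_powMean`, and rκ ≤ 3/2, that is d ≤ 1/2. There is room
  -- above 1/κ because κ > 1/2.
  have h1 : ENNReal.ofReal (1 / κ) < min p (ENNReal.ofReal (min 2 (3 / 2 / κ))) := by
    rw [lt_min_iff]
    refine ⟨hp, (ENNReal.ofReal_lt_ofReal_iff (by positivity)).2 (lt_min ?_ ?_)⟩
    · rw [div_lt_iff₀ hκ0]; linarith
    · gcongr; norm_num
  obtain ⟨r, hr1, hr2⟩ := ENNReal.lt_iff_exists_nnreal_btwn.1 h1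
  rw [lt_min_iff] at hr2
  have h2 : (r : ℝ) < min 2 (3 / 2 / κ) := by
    have := hr2.2
    rwa [← ENNReal.ofReal_coe_nnreal, ENNReal.ofReal_lt_ofReal_iff (by positivity)] at this
  have h3 : 1 / κ < r := by
    rwa [← ENNReal.ofReal_coe_nnreal, ENNReal.ofReal_lt_ofReal_iff_of_nonneg (by positivity)] at hr1
  rw [lt_min_iff] at h2
  refine ⟨r, lt_trans (by positivity) h3, h2.1.le, ?_, ?_, ?_⟩
  · rw [ENNReal.ofReal_coe_nnreal]; exact hr2.1.le
  · rwa [div_lt_iff₀ hκ0] at h3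
  · exact ((lt_div_iff₀ hκ0).1 h2.2).le

/-- The risk of the GEB estimator in one block. -/
def gebBlockRisk (jstar : ℕ) (ρ₀ b₀ : ℝ) (η : ℕ → ℝ) (ε : ℝ) (β : Seq) (l : ℕ) : ℝ≥0∞ :=
  ∑ k : Fin (blockSize l), ∫⁻ z, ENNReal.ofReal
    ((gebEstimator jstar ρ₀ b₀ η ε (obs ε β z) ⟨l, k⟩ - β ⟨l, k⟩) ^ 2) ∂noise

/-- The block risk of the GEB estimator is finite, uniformly in the means. -/
lemma exists_gebBlockRisk_le {jstar : ℕ} {ρ₀ b₀ : ℝ} {η : ℕ → ℝ}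
    (hρ : ∀ j : ℕ, jstar ≤ j → 0 < rhoLevel ρ₀ η (2 ^ j)) (l : ℕ) :
    ∃ D : ℝ, 0 ≤ D ∧ ∀ ε : ℝ, 0 < ε → ∀ β : Seq,
      gebBlockRisk jstar ρ₀ b₀ η ε β l ≤ ENNReal.ofReal (ε ^ 2) * ENNReal.ofReal D := by
  by_cases hl : l < jstar + 1
  · refine ⟨blockSize l, Nat.cast_nonneg _, fun ε _ β => ?_⟩
    unfold gebBlockRisk
    rw [geb_block_risk_of_lt hl, ENNReal.ofReal_natCast]
  · cases l with
    | zero => omega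
    | succ j =>
      have hD : 0 ≤ ((blockSize (j + 1) : ℕ) : ℝ) *
          (2 + 2 * (√(2 * Real.log (blockSize (j + 1))) ^ 2 +
            (√(2 * Real.log (blockSize (j + 1))) ^ 2 / rhoLevel ρ₀ η (blockSize (j + 1))) ^ 2)) := by
        positivity
      refine ⟨_, hD, fun ε hε β => ?_⟩
      unfold gebBlockRisk
      rw [geb_block_risk_of_ge hl ρ₀ b₀ η hε]
      gcongr
      exact hybridRisk_le_crude _ ρ₀ b₀ η (hρ j (by omega))

/-- The sparsity exponent loses nothing against the Besov radius at the critical level. -/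
lemma powMean_le_critical {α : ℝ} (hα : 0 < α) {p q : ℝ≥0∞} (hq : 0 < q) {C : ℝ} (hC : 0 < C)
    {β : Seq} (hβ : β ∈ besovBall α p q C) {r : ℝ} (hr : 0 < r) (hrp : ENNReal.ofReal r ≤ p)
    {ε : ℝ} (hε : 0 < ε) (j : ℕ) :
    powMean r (blockMeans ε β (j + 1)) ≤
      C ^ r * ((1 / ε) ^ (1 / (α + 1 / 2)) / ((2 ^ j : ℕ) : ℝ)) ^ (r * (α + 1 / 2)) := by
  refine (powMean_le_of_mem_besovBall hq hC hβ hr hrp hε j).trans (le_of_eq ?_)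
  have hx0 : (0 : ℝ) < ((2 ^ j : ℕ) : ℝ) := by positivity
  generalize ((2 ^ j : ℕ) : ℝ) = x at *
  rw [Real.div_rpow (by positivity) hx0.le, ← Real.rpow_mul (by positivity), Real.rpow_neg hx0.le,
    div_eq_mul_one_div C, Real.mul_rpow hC.le (by positivity)]
  have : 1 / (α + 1 / 2) * (r * (α + 1 / 2)) = r := by field_simp
  rw [this]
  ring

/-- The GEB estimator attains the ideal separable risk up to a smaller order term, uniformly over
a Besov ball. -/
theorem exists_risk_le_idealRisk_add {jstar : ℕ} {ρ₀ b₀ : ℝ} (hρ₀ : 0 < ρ₀) (hb₀ : 0 < b₀)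
    {η : ℕ → ℝ} (hη : Tendsto η atTop (𝓝 0))
    (hρ : ∀ j : ℕ, jstar ≤ j → 0 < rhoLevel ρ₀ η (2 ^ j))
    {α : ℝ} (hα : 0 < α) {p q : ℝ≥0∞} (hp : ENNReal.ofReal (1 / (α + 1 / 2)) < p) (hq : 0 < q)
    {C : ℝ} (hC : 0 < C) :
    ∃ c σ₁ σ₂ : ℝ, σ₁ < 1 ∧ σ₂ < 1 ∧ ∀ ε : ℝ, 0 < ε → ∀ β ∈ besovBall α p q C,
      risk ε (gebEstimator jstar ρ₀ b₀ η ε) β ≤ idealRisk ε β +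
        ENNReal.ofReal (ε ^ 2 * (c * (((1 / ε) ^ (1 / (α + 1 / 2))) ^ σ₁ +
          ((1 / ε) ^ (1 / (α + 1 / 2))) ^ σ₂ + 1))) := by
  obtain ⟨r, hr0, hr2, hrp, hrκ1, hrκ2⟩ := exists_exponent (by linarith : 1 / 2 < α + 1 / 2) hp
  obtain ⟨d, hd⟩ : ∃ d, d = r * (α + 1 / 2) - 1 := ⟨_, rfl⟩
  have hd1 : 1 + d = r * (α + 1 / 2) := by linarith
  have hd0 : 0 < d := by linarith
  have hd2 : d ≤ 1 / 2 := by linarith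
  -- The exponents of `sparsity_term_le` and of `far_term_le` with g = d/42; both make the power of
  -- λ strictly less than 1.
  obtain ⟨s, hs⟩ : ∃ s, s = 1 / (1 + 3 * d / 2) := ⟨_, rfl⟩
  obtain ⟨t, ht⟩ : ∃ t, t = 1 / (1 + d + d / 42 * r / 2) := ⟨_, rfl⟩
  have hs12 : 1 / 2 ≤ s := by
    rw [hs]; apply one_div_le_one_div_of_le <;> linarith
  have hs1 : s ≤ 1 := by
    rw [hs, div_le_one (by linarith)]; linarith
  have ht0 : 0 < t := by rw [ht]; positivity
  have hσ₁ : (1 + d) / (1 + 3 * d / 2) < 1 := by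
    rw [div_lt_one (by linarith)]; linarith
  have hσ₂ : (1 + d) * t < 1 := by
    rw [ht, mul_one_div, div_lt_one (by positivity)]
    have : 0 < d / 42 * r := by positivity
    linarith
  have hlarge := (tendsto_pow_atTop_atTop_of_one_lt (one_lt_two : (1 : ℕ) < 2)).eventually
    (eventually_largeBlock hρ₀ hb₀ hη (by positivity : 0 < d / 42) (by linarith))
  obtain ⟨j₀, hj₀⟩ := eventually_atTop.1 hlarge
  choose D hD0 hD using exists_gebBlockRisk_le (b₀ := b₀) hρ
  -- Only finitely many blocks lie below J; their risk, bounded by a multiple of ε² uniformly in β,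
  -- goes into the constant term of the remainder.
  obtain ⟨J, hJ⟩ : ∃ J, J = max j₀ jstar := ⟨_, rfl⟩
  have hA : 0 < C ^ r := by positivity
  obtain ⟨e, he⟩ : ∃ e : ℕ → ℝ, e = fun j => |oracleConst (ρ₀ / 2) (2 * ρ₀) b₀ s| *
      ((C ^ r) ^ s * ((2 ^ j : ℕ) : ℝ) ^ (-(d / 14)) +
        (C ^ r * 2 ^ r) ^ t * ((2 ^ j : ℕ) : ℝ) ^ (-(d / 42 * r / 2 * t)) +
        1 / √(2 * Real.log ((2 ^ j : ℕ) : ℝ)) ^ 3) := ⟨_, rfl⟩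
  have he0 : ∀ j, 0 ≤ e j := fun j => by rw [he]; positivity
  have hesum : Summable e := by
    rw [he]
    exact (((summable_two_pow_rpow (by positivity)).mul_left _).add
      ((summable_two_pow_rpow (by positivity)).mul_left _)
      |>.add summable_one_div_sqrt_log_cube).mul_left _
  -- Block l is the level l - 1. Bounding every block by c l times the same function V of λ avoids
  -- splitting the levels at the critical size n = λ.
  obtain ⟨c, hc⟩ : ∃ c : ℕ → ℝ, c = fun l => if l < J + 1 then D l else e (l - 1) := ⟨_, rfl⟩
  have hc0 : ∀ l, 0 ≤ c l := fun l => by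
    rw [hc]
    dsimp only
    split_ifs
    exacts [hD0 l, he0 _]
  have hcsum : Summable c := by
    rw [← summable_nat_add_iff (J + 1)]
    have : (fun l => c (l + (J + 1))) = fun l => e (l + J) := by
      ext l
      rw [hc]
      dsimp only
      rw [if_neg (by omega)]
      congr 1
    rw [this]
    exact (summable_nat_add_iff J).2 hesum
  refine ⟨∑' l, c l, _, _, hσ₁, hσ₂, fun ε hε β hβ => ?_⟩
  obtain ⟨lam, hlam⟩ : ∃ lam, lam = (1 / ε) ^ (1 / (α + 1 / 2)) := ⟨_, rfl⟩
  have hlam0 : 0 < lam := by rw [hlam]; positivity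
  rw [← hlam]
  obtain ⟨V, hV⟩ : ∃ V, V = lam ^ ((1 + d) / (1 + 3 * d / 2)) + lam ^ ((1 + d) * t) + 1 := ⟨_, rfl⟩
  have hv1 : 0 < lam ^ ((1 + d) / (1 + 3 * d / 2)) := by positivity
  have hv2 : 0 < lam ^ ((1 + d) * t) := by positivity
  have hV0 : 0 ≤ V := by linarith
  rw [← hV]
  have hblock : ∀ l, gebBlockRisk jstar ρ₀ b₀ η ε β l ≤ ENNReal.ofReal (ε ^ 2) *
      ruleRisk (blockMeans ε β l) (bayesRule (blockMeans ε β l)) +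
        ENNReal.ofReal (ε ^ 2 * (c l * V)) := by
    intro l
    by_cases hl : l < J + 1
    · refine ((hD l ε hε β).trans ?_).trans le_add_self
      rw [← ENNReal.ofReal_mul (by positivity)]
      apply ENNReal.ofReal_le_ofReal
      have : c l = D l := by rw [hc]; simp [hl]
      rw [this]
      gcongr
      exact le_mul_of_one_le_right (hD0 l) (by linarith)
    · cases l with
      | zero => omega
      | succ j =>
        have hcl : c (j + 1) = e j := by rw [hc]; simp [hl]
        have hLB := hj₀ j (by omega)
        unfold gebBlockRisk
        rw [geb_block_risk_of_ge (by omega) ρ₀ b₀ η hε, ENNReal.ofReal_mul (by positivity),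
          ← mul_add, hcl]
        gcongr
        refine (hLB.hybridRisk_le (η := η) (θ := blockMeans ε β (j + 1)) hs12 hs1).trans ?_
        refine add_le_add le_rfl (ENNReal.ofReal_le_ofReal ?_)
        have hpm := powMean_le_critical hα hq hC hβ hr0 hrp hε j
        rw [← hlam, ← hd1] at hpm
        have hx1 := hLB.one_le_n
        have q1 := sparsity_term_le hA hlam0 hx1 (sparsity_nonneg _)
          ((sparsity_le_powMean hr0 hr2 _).trans hpm) hd0 hd2
        have q2 := far_term_le hA hlam0 hx1 hr0 hd0 (by positivity) ht hpm
        rw [← hs] at q1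
        obtain ⟨q, hq⟩ : ∃ q, q = 1 / √(2 * Real.log ((2 ^ j : ℕ) : ℝ)) ^ 3 := ⟨_, rfl⟩
        obtain ⟨u, hu⟩ : ∃ u, u = (C ^ r) ^ s * ((2 ^ j : ℕ) : ℝ) ^ (-(d / 14)) := ⟨_, rfl⟩
        obtain ⟨v, hv⟩ : ∃ v, v = (C ^ r * 2 ^ r) ^ t *
          ((2 ^ j : ℕ) : ℝ) ^ (-(d / 42 * r / 2 * t)) := ⟨_, rfl⟩
        have hq0 : 0 ≤ q := by rw [hq]; positivity
        have hu0 : 0 ≤ u := by rw [hu]; positivity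
        have hv0 : 0 ≤ v := by rw [hv]; positivity
        have hej : e j = |oracleConst (ρ₀ / 2) (2 * ρ₀) b₀ s| * (u + v + q) := by
          rw [he, hu, hv, hq]
        rw [mul_right_comm ((C ^ r) ^ s), ← hu] at q1
        rw [mul_right_comm ((C ^ r * 2 ^ r) ^ t), ← hv] at q2
        have hsp := sparsity_nonneg (blockMeans ε β (j + 1))
        have hlhs : (0 : ℝ) ≤ (((2 ^ j : ℕ) : ℝ) ^ (d / 42)) ^ 3 * √((2 ^ j : ℕ) : ℝ) *
            (√((2 ^ j : ℕ) : ℝ) * sparsity (blockMeans ε β (j + 1))) ^ s := by positivity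
        have hfar : (0 : ℝ) ≤ farCount (blockMeans ε β (j + 1))
            (((2 ^ j : ℕ) : ℝ) ^ (d / 42) / 2) := Nat.cast_nonneg _
        rw [hej, ← hq, mul_assoc |oracleConst (ρ₀ / 2) (2 * ρ₀) b₀ s|]
        refine mul_le_mul (le_abs_self _) ?_ (add_nonneg (add_nonneg hlhs hfar) hq0) (abs_nonneg _)
        rw [hV]
        have w1 := mul_nonneg hu0 hv1.le
        have w2 := mul_nonneg hu0 hv2.le
        have w3 := mul_nonneg hv0 hv1.le
        have w4 := mul_nonneg hv0 hv2.le
        have w5 := mul_nonneg hq0 hv1.le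
        have w6 := mul_nonneg hq0 hv2.le
        refine (add_le_add (add_le_add q1 q2) le_rfl).trans ?_
        linarith
  calc risk ε (gebEstimator jstar ρ₀ b₀ η ε) β
      = ∑' l, gebBlockRisk jstar ρ₀ b₀ η ε β l := risk_eq_tsum _ _ _
    _ ≤ ∑' l, (ENNReal.ofReal (ε ^ 2) *
          ruleRisk (blockMeans ε β l) (bayesRule (blockMeans ε β l)) +
            ENNReal.ofReal (ε ^ 2 * (c l * V))) := ENNReal.tsum_le_tsum hblock
    _ = ∑' l, ENNReal.ofReal (ε ^ 2) *
          ruleRisk (blockMeans ε β l) (bayesRule (blockMeans ε β l)) +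
            ∑' l, ENNReal.ofReal (ε ^ 2 * (c l * V)) := ENNReal.tsum_add
    _ ≤ _ := by
        refine add_le_add (tsum_ruleRisk_le_idealRisk hε β) (le_of_eq ?_)
        rw [← ENNReal.ofReal_tsum_of_nonneg
          (fun l => mul_nonneg (sq_nonneg _) (mul_nonneg (hc0 l) hV0))
          ((hcsum.mul_right V).mul_left _), tsum_mul_left, tsum_mul_right]

/-! ### Asymptotics -/

lemma tendsto_one_div_rpow_atTop {a : ℝ} (ha : 0 < a) :
    Tendsto (fun ε : ℝ => (1 / ε) ^ a) (𝓝[>] 0) atTop := by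
  simp_rw [one_div]
  exact (tendsto_rpow_atTop ha).comp tendsto_inv_nhdsGT_zero

/-- The excess of the risk of the GEB estimator over the ideal separable risk is of smaller order
than the minimax rate, uniformly over a Besov ball. -/
theorem exists_risk_le_idealRisk_add_littleO {jstar : ℕ} {ρ₀ b₀ : ℝ} (hρ₀ : 0 < ρ₀) (hb₀ : 0 < b₀)
    {η : ℕ → ℝ} (hη : Tendsto η atTop (𝓝 0))
    (hρ : ∀ j : ℕ, jstar ≤ j → 0 < rhoLevel ρ₀ η (2 ^ j))
    {α : ℝ} (hα : 0 < α) {p q : ℝ≥0∞} (hp : ENNReal.ofReal (1 / (α + 1 / 2)) < p) (hq : 0 < q)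
    {C : ℝ} (hC : 0 < C) :
    ∃ e : ℝ → ℝ, Tendsto e (𝓝[>] 0) (𝓝 0) ∧ ∀ ε : ℝ, 0 < ε → ∀ β ∈ besovBall α p q C,
      risk ε (gebEstimator jstar ρ₀ b₀ η ε) β ≤ idealRisk ε β +
        ENNReal.ofReal (e ε * ε ^ (2 * α / (α + 1 / 2))) := by
  obtain ⟨c, σ₁, σ₂, h₁, h₂, h⟩ :=
    exists_risk_le_idealRisk_add (jstar := jstar) hρ₀ hb₀ hη hρ hα hp hq hC
  have hlam := tendsto_one_div_rpow_atTop (by positivity : 0 < 1 / (α + 1 / 2))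
  have hneg : ∀ σ : ℝ, σ < 1 → Tendsto
      (fun ε : ℝ => ((1 / ε) ^ (1 / (α + 1 / 2))) ^ (σ - 1)) (𝓝[>] 0) (𝓝 0) := fun σ hσ => by
    have := (tendsto_rpow_neg_atTop (by linarith : 0 < 1 - σ)).comp hlam
    simpa [Function.comp_def] using this
  refine ⟨fun ε => c * (((1 / ε) ^ (1 / (α + 1 / 2))) ^ (σ₁ - 1) +
    ((1 / ε) ^ (1 / (α + 1 / 2))) ^ (σ₂ - 1) + ((1 / ε) ^ (1 / (α + 1 / 2))) ^ ((0 : ℝ) - 1)),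
    ?_, fun ε hε β hβ => ?_⟩
  · simpa using ((((hneg _ h₁).add (hneg _ h₂)).add (hneg 0 zero_lt_one)).const_mul c)
  · refine (h ε hε β hβ).trans (le_of_eq ?_)
    -- 2 - 1/(α + 1/2) = 2α/(α + 1/2): the minimax rate is ε² λ, so powers λ^σ with σ < 1 are
    -- negligible.
    have hrate : ε ^ (2 * α / (α + 1 / 2)) = ε ^ 2 * (1 / ε) ^ (1 / (α + 1 / 2)) := by
      rw [one_div ε, Real.inv_rpow hε.le, ← Real.rpow_neg hε.le, ← Real.rpow_natCast ε 2,
        ← Real.rpow_add hε]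
      congr 1
      push_cast
      field_simp
      ring
    have hL : 0 < (1 / ε) ^ (1 / (α + 1 / 2)) := by positivity
    dsimp only
    rw [hrate, Real.rpow_sub hL, Real.rpow_sub hL, Real.rpow_sub hL, Real.rpow_one, Real.rpow_zero]
    generalize (1 / ε) ^ (1 / (α + 1 / 2)) = lam at *
    congr 2
    field_simp

/-! ### Passing between extended real differences and sums in [0, ∞]. -/

lemma le_add_ofReal_of_sub_le {a b : ℝ≥0∞} {m : ℝ} (h : (a : EReal) - b ≤ (m : ℝ)) :
    a ≤ b + ENNReal.ofReal m := by
  rcases eq_or_ne b ∞ with rfl | hb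
  · simp
  have h1 : (a : EReal) ≤ m + b := by
    refine (EReal.sub_le_iff_le_add ?_ ?_).1 h
    · left; simp
    · left; simpa using hb
  have h2 : (m : EReal) ≤ ((ENNReal.ofReal m : ℝ≥0∞) : EReal) := by
    rw [EReal.coe_ennreal_ofReal]
    exact_mod_cast le_max_left m 0
  have h3 : (a : EReal) ≤ ((ENNReal.ofReal m + b : ℝ≥0∞) : EReal) := by
    rw [EReal.coe_ennreal_add]
    exact h1.trans (add_le_add_left h2 _)
  rw [add_comm]
  exact_mod_cast h3

lemma sub_le_of_le_add_ofReal {a b : ℝ≥0∞} {m : ℝ} (hm : 0 ≤ m) (h : a ≤ b + ENNReal.ofReal m) :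
    (a : EReal) - b ≤ (m : ℝ) := by
  apply EReal.sub_le_of_le_add
  have h1 : (a : EReal) ≤ ((ENNReal.ofReal m + b : ℝ≥0∞) : EReal) := by
    rw [add_comm] at h
    exact_mod_cast h
  rwa [EReal.coe_ennreal_add, EReal.coe_ennreal_ofReal, max_eq_left hm] at h1

/-- If R is infinite the quotient is 0 in `EReal`, which the nonnegative bound covers. Otherwise R ≥
v > 0 and the division is real. -/
lemma div_le_of_le_of_le {x : EReal} {R : ℝ≥0∞} {m v : ℝ} (hm : 0 ≤ m) (hv : 0 < v)
    (hx : x ≤ (m : ℝ)) (hR : ENNReal.ofReal v ≤ R) : x / R ≤ ((m / v : ℝ) : EReal) := by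
  rcases eq_or_ne R ∞ with rfl | hR'
  · simp only [EReal.coe_ennreal_top, EReal.div_top]
    exact_mod_cast div_nonneg hm hv.le
  · lift R to NNReal using hR'
    have hR1 : v ≤ R := by
      rw [← ENNReal.ofReal_coe_nnreal] at hR
      exact (ENNReal.ofReal_le_ofReal_iff R.2).1 hR
    have hR0 : (0 : ℝ) < R := hv.trans_le hR1
    have e : (((R : ℝ≥0∞)) : EReal) = ((R : ℝ) : EReal) := rfl
    rw [e]
    calc x / ((R : ℝ) : EReal) ≤ ((m : ℝ) : EReal) / ((R : ℝ) : EReal) :=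
          EReal.div_le_div_right_of_nonneg (by exact_mod_cast hR0.le) hx
      _ = ((m / R : ℝ) : EReal) := by rw [EReal.coe_div]
      _ ≤ _ := by
        have : m / R ≤ m / v := by gcongr
        exact_mod_cast this

end

end GEB

/-! ### Comparison with the competing estimators. -/

theorem theorem3p6
    -- constants of the GEB estimator
    (jstar : ℕ) (hjstar : 0 < jstar) (ρ₀ b₀ : ℝ) (hρ₀ : 0 < ρ₀) (hb₀ : 0 < b₀)
    (η : ℕ → ℝ) (hη : Tendsto η atTop (𝓝 0))
    (hρ : ∀ j : ℕ, jstar ≤ j → 0 < GEB.rhoLevel ρ₀ η (2 ^ j))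
    -- the Besov ball and the class nested in it
    (α : ℝ) (hα : 0 < α) (p q : ℝ≥0∞) (hp : ENNReal.ofReal (1 / (α + 1 / 2)) < p) (hq : 0 < q)
    (C : ℝ) (hC : 0 < C) (B : Set GEB.Seq) (hB : B ⊆ GEB.besovBall α p q C)
    (hBrate : 0 < liminf (fun ε : ℝ =>
      ENNReal.ofReal (ε ^ (-(2 * α / (α + 1 / 2)))) * GEB.minimaxRisk ε B) (𝓝[>] 0))
    -- the restricted ideal risk
    (Rtilde : ℝ → GEB.Seq → ℝ≥0∞)
    (hRtilde : ∀ ε : ℝ, 0 < ε → ∀ β ∈ B, GEB.idealRisk ε β ≤ Rtilde ε β)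
    -- the competing estimators
    (δ : ℝ → GEB.Seq → GEB.Seq) (hδ : ∀ ε : ℝ, 0 < ε → Measurable (δ ε))
    (hδrisk : ∃ o : ℝ → ℝ, Tendsto o (𝓝[>] 0) (𝓝 0) ∧ ∀ᶠ ε : ℝ in 𝓝[>] 0,
      (⨆ β ∈ B, ((Rtilde ε β : EReal) - (GEB.risk ε (δ ε) β : EReal)))
        ≤ ((o ε * ε ^ (2 * α / (α + 1 / 2)) : ℝ) : EReal)) :
    limsup (fun ε : ℝ =>
        (⨆ β ∈ B, ((GEB.risk ε (GEB.gebEstimator jstar ρ₀ b₀ η ε) β : EReal)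
            - (GEB.risk ε (δ ε) β : EReal)))
          / (GEB.minimaxRisk ε B : EReal)) (𝓝[>] 0) ≤ 0 ∧
    limsup (fun ε : ℝ =>
        (⨆ β ∈ B, GEB.risk ε (GEB.gebEstimator jstar ρ₀ b₀ η ε) β)
          / (⨆ β ∈ B, GEB.risk ε (δ ε) β)) (𝓝[>] 0) ≤ 1 := by
  obtain ⟨e, he, hgeb⟩ := GEB.exists_risk_le_idealRisk_add_littleO
    (jstar := jstar) hρ₀ hb₀ hη hρ hα hp hq hC
  obtain ⟨o, ho, hoR⟩ := hδrisk
  obtain ⟨κ, hκ⟩ : ∃ κ, κ = 2 * α / (α + 1 / 2) := ⟨_, rfl⟩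
  rw [← hκ] at hBrate hgeb hoR
  -- A positive real below the liminf: eventually the minimax risk is at least c times the rate, so
  -- errors that are o(rate) vanish relative to it.
  obtain ⟨c, -, hc0, hcl⟩ := ENNReal.lt_iff_exists_real_btwn.1 hBrate
  have hcpos : 0 < c := ENNReal.ofReal_pos.1 hc0
  obtain ⟨m, hm⟩ : ∃ m : ℝ → ℝ, m = fun ε => |o ε| + |e ε| := ⟨_, rfl⟩
  have hm0 : ∀ ε, 0 ≤ m ε := fun ε => by rw [hm]; positivity
  have hmlim : Tendsto (fun ε => m ε / c) (𝓝[>] 0) (𝓝 0) := by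
    rw [hm]
    simpa using ((ho.abs.add he.abs).div_const c)
  have hmain : ∀ᶠ ε : ℝ in 𝓝[>] 0, 0 < ε ∧
      ENNReal.ofReal (c * ε ^ κ) ≤ GEB.minimaxRisk ε B ∧
      ∀ β ∈ B, GEB.risk ε (GEB.gebEstimator jstar ρ₀ b₀ η ε) β ≤
        GEB.risk ε (δ ε) β + ENNReal.ofReal (m ε * ε ^ κ) := by
    filter_upwards [self_mem_nhdsWithin, eventually_lt_of_lt_liminf hcl, hoR] with ε hε h1 h2
    have hε0 : 0 < ε := hε
    have hr : 0 < ε ^ κ := by positivity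
    refine ⟨hε0, ?_, fun β hβ => ?_⟩
    · calc ENNReal.ofReal (c * ε ^ κ) = ENNReal.ofReal (ε ^ κ) * ENNReal.ofReal c := by
            rw [mul_comm, ENNReal.ofReal_mul hr.le]
        _ ≤ ENNReal.ofReal (ε ^ κ) * (ENNReal.ofReal (ε ^ (-κ)) * GEB.minimaxRisk ε B) := by
            gcongr
        _ = GEB.minimaxRisk ε B := by
            rw [← mul_assoc, ← ENNReal.ofReal_mul hr.le, ← Real.rpow_add hε0]
            simp
    · have h3 : GEB.idealRisk ε β ≤ GEB.risk ε (δ ε) β + ENNReal.ofReal (o ε * ε ^ κ) :=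
        (hRtilde ε hε0 β hβ).trans (GEB.le_add_ofReal_of_sub_le ((le_iSup₂ (f := fun β (_ : β ∈ B) =>
          (Rtilde ε β : EReal) - (GEB.risk ε (δ ε) β : EReal)) β hβ).trans h2))
      calc _ ≤ GEB.idealRisk ε β + ENNReal.ofReal (e ε * ε ^ κ) := hgeb ε hε0 β (hB hβ)
        _ ≤ GEB.risk ε (δ ε) β + ENNReal.ofReal (|o ε| * ε ^ κ) +
            ENNReal.ofReal (|e ε| * ε ^ κ) := by
            gcongr
            · refine h3.trans ?_
              gcongr
              exact le_abs_self _
            · exact le_abs_self _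
        _ = _ := by
            rw [add_assoc, ← ENNReal.ofReal_add (by positivity) (by positivity), hm, add_mul]
  constructor
  · have hlim : Tendsto (fun ε : ℝ => ((m ε / c : ℝ) : EReal)) (𝓝[>] 0) (𝓝 0) :=
      (continuous_coe_real_ereal.tendsto 0).comp hmlim
    rw [← hlim.limsup_eq]
    refine limsup_le_limsup ?_
    filter_upwards [hmain] with ε ⟨hε, h1, h2⟩
    have hr : 0 < ε ^ κ := by positivity
    have hle := GEB.div_le_of_le_of_le (mul_nonneg (hm0 ε) hr.le) (mul_pos hcpos hr)
      (iSup₂_le fun β hβ => GEB.sub_le_of_le_add_ofReal (mul_nonneg (hm0 ε) hr.le) (h2 β hβ)) h1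
    rwa [mul_div_mul_right _ _ hr.ne'] at hle
  · have hlim : Tendsto (fun ε : ℝ => 1 + ENNReal.ofReal (m ε / c)) (𝓝[>] 0) (𝓝 1) := by
      have := (ENNReal.tendsto_ofReal hmlim).const_add 1
      simpa using this
    rw [← hlim.limsup_eq]
    refine limsup_le_limsup ?_
    filter_upwards [hmain] with ε ⟨hε, h1, h2⟩
    have hr : 0 < ε ^ κ := by positivity
    obtain ⟨D, hD⟩ : ∃ D, D = ⨆ β ∈ B, GEB.risk ε (δ ε) β := ⟨_, rfl⟩
    -- Each competitor is a measurable estimator, so its maximum risk dominates the minimax risk and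
    -- inherits the lower bound.
    have hDR : GEB.minimaxRisk ε B ≤ D := by
      rw [hD]
      exact iInf₂_le (δ ε) (hδ ε hε)
    have hsup : (⨆ β ∈ B, GEB.risk ε (GEB.gebEstimator jstar ρ₀ b₀ η ε) β) ≤
        D + ENNReal.ofReal (m ε * ε ^ κ) := by
      refine iSup₂_le fun β hβ => (h2 β hβ).trans ?_
      gcongr
      rw [hD]
      exact le_iSup₂ (f := fun β (_ : β ∈ B) => GEB.risk ε (δ ε) β) β hβ
    rw [← hD]
    calc _ ≤ (D + ENNReal.ofReal (m ε * ε ^ κ)) / D := by gcongr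
      _ = D / D + ENNReal.ofReal (m ε * ε ^ κ) / D := ENNReal.add_div
      _ ≤ 1 + ENNReal.ofReal (m ε * ε ^ κ) / ENNReal.ofReal (c * ε ^ κ) := by
          gcongr
          -- An inequality suffices and also covers D = ∞, where the quotient is 0.
          · exact ENNReal.div_self_le_one
          · exact h1.trans hDR
      _ = _ := by
          rw [← ENNReal.ofReal_div_of_pos (mul_pos hcpos hr), mul_div_mul_right _ _ hr.ne']
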